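/- Setting. Let $p\equiv 1\pmod 4$ be a prime, $m\ge 2$, $q=p^m$, $\zeta_p=e^{2\pi i/p}$, and let $\mathrm{Tr}:\mathbb F_q\to\mathbb F_p$ be the trace. For $f:\mathbb F_q\to\mathbb F_p$ put $\widehat\chi_f(\beta)=\sum_{x\in\mathbb F_q}\zeta_p^{f(x)-\mathrm{Tr}(\beta x)}$. The function $f$ is $s$-plateaued ($0\le s\le m$) if $|\widehat\chi_f(\beta)|^2\in\{0,p^{m+s}\}$ for all $\beta$; its Walsh support is $\mathcal S_f=\{\beta:|\widehat\chi_f(\beta)|^2=p^{m+s}\}$. It is weakly regular if there are $u\in\mathbb C$ with $|u|=1$ and $d:\mathbb F_q\to\mathbb F_p$ vanishing off $\mathcal S_f$ such that $\widehat\chi_f(\beta)\in\{0,u\,p^{(m+s)/2}\zeta_p^{d(\beta)}\}$ for all $\beta$. Then there are a unique sign $\varepsilon_f\in\{\pm1\}$ and a unique function $f^\star:\mathbb F_q\to\mathbb F_p$ vanishing off $\mathcal S_f$ with $\widehat\chi_f(\beta)=\varepsilon_f\sqrt p^{\,m+s}\zeta_p^{f^\star(\beta)}$ for $\beta\in\mathcal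 S_f$. The class WRP consists of the weakly regular plateaued $f$ with $\widehat\chi_f(0)\ne 0$ and $f(0)=0$ for which there is an even $h>0$ with $\gcd(h-1,p-1)=1$ and $f(zx)=z^hf(x)$ for all $z\in\mathbb F_p^*$, $x\in\mathbb F_q$. An even integer $l_f>0$ with $\gcd(l_f-1,p-1)=1$ is an index of $f$ if $f^\star(z\beta)=z^{l_f}f^\star(\beta)$ for all $z\in\mathbb F_p^*$, $\beta\in\mathcal S_f$. For $f,g:\mathbb F_q\to\mathbb F_p$ let $D_{f,g}=\{(x,y)\in\mathbb F_q^2\setminus\{(0,0)\}:f(x)+g(y)=0\}$ and $C_{D_{f,g}}=\{(\mathrm{Tr}(ax+by))_{(x,y)\in D_{f,g}}:a,b\in\mathbb F_q\}$. The number of weights of a code is the number of $w\ge1$ that occur as Hamming weights of its codewords. Theorem. Let $f,g\in$ WRP be $s$-plateaued and $t$-plateaued respectively, with $s+t$ even, let $l_f$ be an index of $f$, and let $l_g=\frac{p-1}2$ be an index of $g$. Put $\tau=2m+s+t$, $\gamma=2m-s-t$, $e=\varepsilon_f\varepsilon_g$, and, for $c\in\mathbb F_p$, $\mathcal N_f(c)=\#\{\beta\in\mathcal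 S_f:f^\star(\beta)=c\}$, $\mathcal N_g(c)=\#\{\beta\in\mathcal S_g:g^\star(\beta)=c\}$, $N=\mathcal N_f(0)\mathcal N_g(0)$, $F_1=\#\{(a,b)\in\mathcal S_f\times\mathcal S_g:f^\star(a)\ne0,\ g^\star(b)=\pm f^\star(a)\}$, $F_3=\#\{(a,b)\in\mathcal S_f\times\mathcal S_g:f^\star(a)g^\star(b)\text{ is a nonzero square}\}$. (i) $C_{D_{f,g}}$ has length $n=p^{2m-1}-1+(p-1)e\sqrt p^{\,\tau-2}$. (ii) If $m-s$ is even, then $\mathcal N_f(0)=p^{m-s-1}+(p-1)\varepsilon_f\sqrt p^{\,m-s-2}$ and $\mathcal N_f(c)=p^{m-s-1}-\varepsilon_f\sqrt p^{\,m-s-2}$ for $c\ne0$. If $m-s$ is odd, then $\mathcal N_f(0)=p^{m-s-1}$ and $\mathcal N_f(c)=p^{m-s-1}+\eta(c)\varepsilon_f\sqrt p^{\,m-s-1}$ for $c\neq 0$, with $\eta$ the quadratic character of $\mathbb F_p$. The same holds for $g$, with $t$ and $\varepsilon_g$. Moreover $F_1=2\sum_{c\ne0}\mathcal N_f(c)\mathcal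 N_g(c)$, and $F_3=\frac{(p-1)^2}4\bigl(\mathcal N_f(i)\mathcal N_g(i)+\mathcal N_f(j)\mathcal N_g(j)\bigr)$ for every nonzero square $i$ and every nonsquare $j$ of $\mathbb F_p$. (iii) Unless $\gamma=2$ and $e=-1$, the code $C_{D_{f,g}}$ has dimension $2m$, and its weight distribution is as follows. Apart from the zero codeword, the weight $(p-1)\bigl(p^{2m-2}+(p-1)e\sqrt p^{\,\tau-4}\bigr)$ has frequency $p^{2m}-p^{\gamma}$ in all four cases, and the other weights are: (1) if $l_f=\frac{p-1}2$: $(p-1)p^{2m-2}$ with frequency $p^{\gamma-1}+(p-1)e\sqrt p^{\,\gamma-2}-1$, and $(p-1)(p^{2m-2}+e\sqrt p^{\,\tau-2})$ with frequency $(p-1)(p^{\gamma-1}-e\sqrt p^{\,\gamma-2})$. If $0<s+t<2m$, the code has exactly three weights. (2) if $l_f=p-1$: $(p-1)p^{2m-2}$ with frequency $N-1$; $(p-1)(p^{2m-2}+\frac12e\sqrt p^{\,\tau-2})$ with frequency $F_1$; $(p-1)(p^{2m-2}+e\sqrt p^{\,\tau-2})$ with frequency $p^\gamma-N-F_1$.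 If $s+t>0$ and $s,t<m$, the code has exactly four weights. (3) if $l_f=2$ and $p\equiv1\pmod 8$: $(p-1)p^{2m-2}$ with frequency $N-1$; $(p-1)p^{2m-2}+(p-3)e\sqrt p^{\,\tau-2}$ with frequency $F_3$; $(p-1)(p^{2m-2}+e\sqrt p^{\,\tau-2})$ with frequency $p^\gamma-N-F_3$. If $s+t>0$ and $s,t<m$, the code has exactly four weights. (4) if $l_f=2$ and $p\equiv5\pmod 8$: $(p-1)p^{2m-2}$ with frequency $N-1$; $(p-1)p^{2m-2}+(p-5)e\sqrt p^{\,\tau-2}$ with frequency $\frac12F_3$; $(p-1)(p^{2m-2}+e\sqrt p^{\,\tau-2})$ with frequency $p^\gamma-N-\frac12F_3$. If $p\ne5$, $s+t>0$ and $s,t<m$, the code has exactly four weights. Here a row of frequency $0$ means that it contributes no codeword, and if two rows of a list have the same weight (in case (4) with $p=5$), their frequencies are added. -/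

import Mathlib

namespace PlateauedCode

/-! ### Linear codes, weights and weight distributions -/

section Codes

variable {p : ℕ} {ι : Type*} [Fintype ι]

/-- `A_w`: the number of codewords of Hamming weight `w` in the code `C`. -/
noncomputable def weightCount (C : Submodule (ZMod p) (ι → ZMod p)) (w : ℕ) : ℕ :=
  Set.ncard {c : ι → ZMod p | c ∈ C ∧ hammingNorm c = w}

/-- The number of `w` with `1 ≤ w ≤ n` and `A_w ≠ 0`, where `n` is the length of the code:
`C` is a `k`-weight code when this number is `k`. -/
noncomputable def numWeights (C : Submodule (ZMod p) (ι → ZMod p)) : ℕ :=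
  ((Finset.Icc 1 (Fintype.card ι)).filter (fun w => weightCount C w ≠ 0)).card

/-- The weight distribution of `C` is the one listed in the table `T`, whose rows are pairs
`(weight, frequency)`. Every row of nonzero frequency has a natural number as weight, and each `A_w`
is the sum of the frequencies of the rows of weight `w`: this is the frequency in the
only such row, except where two rows of the table happen to have the same weight. -/
def HasWeightTable (C : Submodule (ZMod p) (ι → ZMod p)) (T : List (ℝ × ℝ)) : Prop :=
  (∀ r ∈ T, r.2 ≠ 0 → ∃ w : ℕ, r.1 = w) ∧
  ∀ w : ℕ, (weightCount C w : ℝ) = (T.map fun r => open Classical in if r.1 = (w : ℝ) then r.2 else 0).sum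

end Codes

/-! ### Weakly regular plateaued functions on `𝔽_q`, `q = p ^ m` -/

section Functions

variable (p : ℕ) [Fact p.Prime] {F : Type*} [Field F] [Fintype F] [Algebra (ZMod p) F]

/-- The Walsh transform `∑ x, ζ_p ^ (f x - Tr (β x))`, where `ζ_p = exp (2πi / p)` and `Tr` is the
absolute trace. -/
noncomputable def walsh (f : F → ZMod p) (β : F) : ℂ :=
  ∑ x : F, ZMod.stdAddChar (f x - Algebra.trace (ZMod p) F (β * x))

/-- The Walsh support `𝒮_f` of an `s`-plateaued function. -/
def walshSupport (m s : ℕ) (f : F → ZMod p) : Set F :=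
  {β | ‖walsh p f β‖ ^ 2 = (p : ℝ) ^ (m + s)}

/-- `f` is `s`-plateaued. -/
def IsPlateaued (m s : ℕ) (f : F → ZMod p) : Prop :=
  s ≤ m ∧ ∀ β, ‖walsh p f β‖ ^ 2 = 0 ∨ ‖walsh p f β‖ ^ 2 = (p : ℝ) ^ (m + s)

/-- `f` is weakly regular `s`-plateaued. -/
def IsWeaklyRegular (m s : ℕ) (f : F → ZMod p) : Prop :=
  IsPlateaued p m s f ∧
  ∃ u : ℂ, ‖u‖ = 1 ∧ ∃ d : F → ZMod p, (∀ β, β ∉ walshSupport p m s f → d β = 0) ∧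
    ∀ β, walsh p f β = 0 ∨
      walsh p f β = u * ((√(p : ℝ) : ℝ) : ℂ) ^ (m + s) * ZMod.stdAddChar (d β)

/-- The class `WRP`: weakly regular unbalanced `s`-plateaued functions `f` with `f 0 = 0` which are
homogeneous, `f (z x) = z ^ h f x` for `z ∈ 𝔽_p^*`, of some even degree `h > 0` with
`gcd (h - 1, p - 1) = 1`. -/
structure IsWRP (m s : ℕ) (f : F → ZMod p) : Prop where
  weaklyRegular : IsWeaklyRegular p m s f
  unbalanced : walsh p f 0 ≠ 0
  map_zero : f 0 = 0
  homogeneous : ∃ h : ℕ, 0 < h ∧ 2 ∣ h ∧ Nat.gcd (h - 1) (p - 1) = 1 ∧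
    ∀ z : ZMod p, z ≠ 0 → ∀ x : F, f (z • x) = z ^ h * f x

/-- `ε ∈ {1, -1}` and `d` are the sign of the Walsh transform and the dual function of `f`, for
`p ≡ 1 (mod 4)` (where `p^* = p`): `walsh f β = ε √p ^ (m + s) ζ_p ^ (d β)` on the Walsh support,
and `d = 0` off it. -/
def IsSignDual (m s : ℕ) (f : F → ZMod p) (ε : ℤ) (d : F → ZMod p) : Prop :=
  (ε = 1 ∨ ε = -1) ∧
  (∀ β ∈ walshSupport p m s f,
    walsh p f β = (ε : ℂ) * ((√(p : ℝ) : ℝ) : ℂ) ^ (m + s) * ZMod.stdAddChar (d β)) ∧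
  ∀ β, β ∉ walshSupport p m s f → d β = 0

/-- The pair `(ε_f, f^⋆)` of the sign and the dual function of `f`, that is, the only
pair with the property `IsSignDual`. -/
noncomputable def signDual (m s : ℕ) (f : F → ZMod p) : ℤ × (F → ZMod p) :=
  Classical.epsilon fun e => IsSignDual p m s f e.1 e.2

/-- The sign `ε_f`. -/
noncomputable def sign (m s : ℕ) (f : F → ZMod p) : ℤ := (signDual p m s f).1

/-- The dual function `f^⋆`. -/
noncomputable def dual (m s : ℕ) (f : F → ZMod p) : F → ZMod p := (signDual p m s f).2

/-- `l` is the index of `f`. (It matters modulo `p - 1` only.) -/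
def IsIndex (m s : ℕ) (f : F → ZMod p) (l : ℕ) : Prop :=
  0 < l ∧ 2 ∣ l ∧ Nat.gcd (l - 1) (p - 1) = 1 ∧
  ∀ z : ZMod p, z ≠ 0 → ∀ β ∈ walshSupport p m s f,
    dual p m s f (z • β) = z ^ l * dual p m s f β

/-- `𝒩_f(c)`: the number of `β ∈ 𝒮_f` with `f^⋆ β = c`. -/
noncomputable def dualCount (m s : ℕ) (f : F → ZMod p) (c : ZMod p) : ℕ :=
  Set.ncard {β : F | β ∈ walshSupport p m s f ∧ dual p m s f β = c}

/-- The explicit value of `𝒩_f(c)` for `p ≡ 1 (mod 4)`, as a function of `ε = ε_f`. -/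
noncomputable def dualCountValue (m s : ℕ) (ε : ℤ) (c : ZMod p) : ℝ :=
  if Even (m - s) then
    if c = 0 then
      (p : ℝ) ^ ((m : ℤ) - s - 1) + (p - 1) * ε * √(p : ℝ) ^ ((m : ℤ) - s - 2)
    else
      (p : ℝ) ^ ((m : ℤ) - s - 1) - ε * √(p : ℝ) ^ ((m : ℤ) - s - 2)
  else
    if c = 0 then
      (p : ℝ) ^ ((m : ℤ) - s - 1)
    else
      (p : ℝ) ^ ((m : ℤ) - s - 1)
        + (quadraticChar (ZMod p) c : ℝ) * ε * √(p : ℝ) ^ ((m : ℤ) - s - 1)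

/-- `F₁`: the number of `(a, b) ∈ 𝒮_f × 𝒮_g` with `f^⋆ a ≠ 0` and `g^⋆ b = ± f^⋆ a`. -/
noncomputable def F₁ (m s t : ℕ) (f g : F → ZMod p) : ℕ :=
  Set.ncard {x : F × F | x.1 ∈ walshSupport p m s f ∧ x.2 ∈ walshSupport p m t g ∧
    dual p m s f x.1 ≠ 0 ∧
    (dual p m t g x.2 = dual p m s f x.1 ∨ dual p m t g x.2 = -dual p m s f x.1)}

/-- `F₃`: the number of `(a, b) ∈ 𝒮_f × 𝒮_g` such that `f^⋆ a * g^⋆ b` is a nonzero square. -/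
noncomputable def F₃ (m s t : ℕ) (f g : F → ZMod p) : ℕ :=
  Set.ncard {x : F × F | x.1 ∈ walshSupport p m s f ∧ x.2 ∈ walshSupport p m t g ∧
    dual p m s f x.1 * dual p m t g x.2 ≠ 0 ∧
    IsSquare (dual p m s f x.1 * dual p m t g x.2)}

/-! ### The code of the defining set `D_{f,g}` -/

variable [DecidableEq F]

/-- `D_{f,g} = {(x, y) ≠ (0, 0) : f x + g y = 0}`. -/
def definingSet (f g : F → ZMod p) : Finset (F × F) :=
  Finset.univ.filter fun x => x ≠ (0, 0) ∧ f x.1 + g x.2 = 0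

/-- The linear map `(a, b) ↦ c(a, b) = (Tr (a x + b y))_{(x, y) ∈ D_{f,g}}`. -/
noncomputable def encode (f g : F → ZMod p) :
    F × F →ₗ[ZMod p] (definingSet p f g → ZMod p) where
  toFun ab := fun xy => Algebra.trace (ZMod p) F (ab.1 * xy.1.1 + ab.2 * xy.1.2)
  map_add' u v := by
    funext xy
    rw [Pi.add_apply, ← map_add]
    congr 1
    simp only [Prod.fst_add, Prod.snd_add]
    ring
  map_smul' z u := by
    funext xy
    rw [RingHom.id_apply, Pi.smul_apply, ← map_smul]
    congr 1
    simp only [Prod.smul_fst, Prod.smul_snd, smul_add, smul_mul_assoc]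

/-- The code `C_{D_{f,g}}`. Its length is the cardinality of `definingSet p f g`. -/
noncomputable def code (f g : F → ZMod p) :
    Submodule (ZMod p) (definingSet p f g → ZMod p) :=
  LinearMap.range (encode p f g)

end Functions

/-! ### The tables

Here `e = ε_f ε_g`, `τ = 2m + s + t`, `γ = 2m - s - t`, `N = 𝒩_f(0) 𝒩_g(0)`. -/

section Tables

variable (p m : ℕ) (τ γ : ℤ) (e N : ℝ)

/-- The case `l_f = (p - 1) / 2`. -/
noncomputable def tableHalf : List (ℝ × ℝ) :=
  [(0, 1),
   ((p - 1) * p ^ (2 * m - 2),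
     (p : ℝ) ^ (γ - 1) + (p - 1) * e * √(p : ℝ) ^ (γ - 2) - 1),
   ((p - 1) * (p ^ (2 * m - 2) + e * √(p : ℝ) ^ (τ - 2)),
     (p - 1) * ((p : ℝ) ^ (γ - 1) - e * √(p : ℝ) ^ (γ - 2))),
   ((p - 1) * (p ^ (2 * m - 2) + (p - 1) * e * √(p : ℝ) ^ (τ - 4)),
     (p : ℝ) ^ (2 * m) - (p : ℝ) ^ γ)]

/-- The case `l_f = p - 1`, with `A = F₁`. -/
noncomputable def tableFull (A : ℝ) : List (ℝ × ℝ) :=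
  [(0, 1),
   ((p - 1) * p ^ (2 * m - 2), N - 1),
   ((p - 1) * (p ^ (2 * m - 2) + 1 / 2 * e * √(p : ℝ) ^ (τ - 2)), A),
   ((p - 1) * (p ^ (2 * m - 2) + e * √(p : ℝ) ^ (τ - 2)), (p : ℝ) ^ γ - N - A),
   ((p - 1) * (p ^ (2 * m - 2) + (p - 1) * e * √(p : ℝ) ^ (τ - 4)),
     (p : ℝ) ^ (2 * m) - (p : ℝ) ^ γ)]

/-- The case `l_f = 2`, `p ≡ 1 (mod 8)`, with `A = F₃`. -/
noncomputable def tableTwoOne (A : ℝ) : List (ℝ × ℝ) :=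
  [(0, 1),
   ((p - 1) * p ^ (2 * m - 2), N - 1),
   ((p - 1) * p ^ (2 * m - 2) + (p - 3) * e * √(p : ℝ) ^ (τ - 2), A),
   ((p - 1) * (p ^ (2 * m - 2) + e * √(p : ℝ) ^ (τ - 2)), (p : ℝ) ^ γ - N - A),
   ((p - 1) * (p ^ (2 * m - 2) + (p - 1) * e * √(p : ℝ) ^ (τ - 4)),
     (p : ℝ) ^ (2 * m) - (p : ℝ) ^ γ)]

/-- The case `l_f = 2`, `p ≡ 5 (mod 8)`, with `A = F₃`. -/
noncomputable def tableTwoFive (A : ℝ) : List (ℝ × ℝ) :=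
  [(0, 1),
   ((p - 1) * p ^ (2 * m - 2), N - 1),
   ((p - 1) * p ^ (2 * m - 2) + (p - 5) * e * √(p : ℝ) ^ (τ - 2), 1 / 2 * A),
   ((p - 1) * (p ^ (2 * m - 2) + e * √(p : ℝ) ^ (τ - 2)), (p : ℝ) ^ γ - N - 1 / 2 * A),
   ((p - 1) * (p ^ (2 * m - 2) + (p - 1) * e * √(p : ℝ) ^ (τ - 4)),
     (p : ℝ) ^ (2 * m) - (p : ℝ) ^ γ)]

end Tables

end PlateauedCode

open PlateauedCode

/-!
The proof turns statements about counts into statements about character sums and back. By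
`eq_of_sum_mul_stdAddChar_eq_zero`, the sum of all `p`-th roots of unity is, up to multiples, the
only integral linear relation between them; so a sum `∑ x ∈ T, ζ_p ^ φ x` that equals `c ζ_p ^ k`,
or `c √p`, determines how often `φ` takes each value on `T` (`mul_card_fiber_eq_of_sum_eq`,
`mul_card_fiber_eq_of_sum_eq_mul_sqrt`). The case of `c √p` needs the value `√p` of the quadratic
Gauss sum, including its sign.

*The sign and the dual function.* The Walsh transform at `0` is an element of `ℤ[ζ_p]` of absolute
value `√p ^ (m + s)`. Because `p` is totally ramified in `ℚ(ζ_p)`, the quotient of such an element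
by its complex conjugate is a unit all of whose conjugates have absolute value `1`, hence a root of
unity by Kronecker's theorem, and the element is `± √p ^ (m + s) ζ_p ^ k`
(`exists_eq_sign_mul_sqrt_pow_mul_stdAddChar`). This gives `ε_f` and `f^⋆`; Fourier inversion at `0`
then gives `∑ β, ζ_p ^ f^⋆ β = ε_f √p ^ (m - s)`, and with it the numbers `𝒩_f(c)`.

*The weights.* Counting the solutions of `f x + g y = w Tr (a x + b y)` for all `w ∈ 𝔽_p` expresses
the weight of the codeword `c(a, b)` through products `χ_f(w a) χ_g(w b)` of Walsh transforms.
Homogeneity of `f` and `g` makes the Walsh supports closed under nonzero scalars, and the index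
condition gives `f^⋆ (w a) = w ^ l_f f^⋆ a`. So the weight depends only on whether
`(a, b) ∈ 𝒮_f × 𝒮_g` and, if so, on `scalarCount`: the number of `w ≠ 0` with
`w ^ l_f f^⋆ a + w ^ l_g g^⋆ b = 0` (`sq_mul_hammingNorm_of_mem`, `sq_mul_hammingNorm_of_not_mem`).
This number is computed for each of the four pairs of indices by elementary arithmetic in `𝔽_p`.

*The number of weights.* All frequencies in the tables have to be positive. Sets of nonzero
elements closed under nonzero scalars have cardinality divisible by `p - 1`. This forces `m - s` to
be even and `ε_f = 1` if `l_f = p - 1`, or if `l_f = (p - 1) / 2` and `p ≠ 5`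
(`even_and_sign_eq_one_of_dvd`), and then every `𝒩_f(c)` is positive.
-/

namespace PlateauedCode

open Finset

/-! ### The quadratic Gauss sum of a prime `p ≡ 1 (mod 4)` -/

section GaussSum

open Polynomial

variable {p : ℕ} [Fact p.Prime]

theorem stdAddChar_one_isPrimitiveRoot : IsPrimitiveRoot (ZMod.stdAddChar (1 : ZMod p)) p := by
  have h := Complex.isPrimitiveRoot_exp p (NeZero.ne p)
  have : ZMod.stdAddChar (1 : ZMod p) = Complex.exp (2 * Real.pi * Complex.I / p) := by
    simpa using ZMod.stdAddChar_coe (N := p) 1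
  rwa [this]

theorem stdAddChar_one_pow (k : ℕ) :
    ZMod.stdAddChar (1 : ZMod p) ^ k = ZMod.stdAddChar (k : ZMod p) := by
  rw [← AddChar.map_nsmul_eq_pow, nsmul_one]

theorem stdAddChar_one_pow_val (j : ZMod p) :
    ZMod.stdAddChar (1 : ZMod p) ^ j.val = ZMod.stdAddChar j := by
  rw [stdAddChar_one_pow, ZMod.natCast_val, ZMod.cast_id', id]

theorem geomSum_dvd_of_aeval_eq_zero (f : ℤ[X])
    (hf : aeval (ZMod.stdAddChar (1 : ZMod p)) f = 0) :
    (∑ i ∈ range p, X ^ i : ℤ[X]) ∣ f := by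
  have hζ := stdAddChar_one_isPrimitiveRoot (p := p)
  rw [← cyclotomic_prime, cyclotomic_eq_minpoly hζ (NeZero.pos p)]
  exact minpoly.isIntegrallyClosed_dvd (hζ.isIntegral (NeZero.pos p)) hf

theorem sum_zmod_eq_sum_range {M : Type*} [AddCommMonoid M] (u : ZMod p → M) :
    ∑ j : ZMod p, u j = ∑ i ∈ range p, u (i : ZMod p) := by
  symm
  refine Finset.sum_bij' (fun i _ => (i : ZMod p)) (fun j _ => j.val) ?_ ?_ ?_ ?_ ?_
  · simp
  · intro j _; simpa using ZMod.val_lt j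
  · intro i hi; exact ZMod.val_cast_of_lt (by simpa using hi)
  · intro j _; simp
  · simp

/-- The only integral linear relations among the `p`-th roots of unity are the multiples of the
relation that says that their sum is zero. -/
theorem eq_of_sum_mul_stdAddChar_eq_zero (c : ZMod p → ℤ)
    (hc : ∑ j, (c j : ℂ) * ZMod.stdAddChar j = 0) (i j : ZMod p) : c i = c j := by
  have hp : p.Prime := Fact.out
  set f : ℤ[X] := ∑ i ∈ range p, C (c (i : ZMod p)) * X ^ i with hf
  have hcoef : ∀ k : ZMod p, f.coeff k.val = c k := by
    intro k
    have hk := ZMod.val_lt k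
    simp [hf, coeff_X_pow, hk]
  obtain ⟨r, hr⟩ := geomSum_dvd_of_aeval_eq_zero (p := p) f (by
    rw [sum_zmod_eq_sum_range] at hc
    rw [← hc, hf, map_sum]
    refine Finset.sum_congr rfl fun i _ => ?_
    simp [stdAddChar_one_pow])
  have hdf : f.degree < p := by
    rw [degree_lt_iff_coeff_zero]
    intro k hk
    simp [hf, coeff_X_pow, hk]
  have hr0 : r.natDegree = 0 := by
    by_cases hr' : r = 0
    · simp [hr']
    have hm : (∑ i ∈ range p, X ^ i : ℤ[X]).Monic := Polynomial.monic_geom_sum_X hp.ne_zero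
    have h1 : (∑ i ∈ range p, X ^ i : ℤ[X]).natDegree = p - 1 := by
      rw [← cyclotomic_prime, natDegree_cyclotomic, Nat.totient_prime hp]
    have h2 : f.natDegree < p := by
      by_cases hf0 : f = 0
      · simp [hf0, hp.pos]
      · exact (natDegree_lt_iff_degree_lt hf0).2 hdf
    rw [hr, hm.natDegree_mul' hr', h1] at h2
    omega
  obtain ⟨a, rfl⟩ : ∃ a, r = C a := ⟨_, eq_C_of_natDegree_eq_zero hr0⟩
  have key : ∀ k : ZMod p, c k = a := by
    intro k
    have hk := ZMod.val_lt k
    rw [← hcoef, hr, coeff_mul_C]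
    simp [coeff_X_pow, hk]
  rw [key, key]

/-- The polynomial `∑ j ^ i X ^ j` over `𝔽_p` is obtained from `∑ X ^ j = (X - 1) ^ (p - 1)` by
applying `X d/dX` repeatedly, so it is divisible by `(X - 1) ^ (p - 1 - i)`; the cofactor has
value `(-1) ^ i i!` at `1`. -/
theorem exists_sum_pow_mul_X_pow_eq (i : ℕ) (hi : i < p) :
    ∃ R : (ZMod p)[X], ∑ j ∈ range p, C ((j : ZMod p) ^ i) * X ^ j = (X - 1) ^ (p - 1 - i) * R ∧
      R.eval 1 = (-1) ^ i * (i.factorial : ZMod p) := by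
  have hp : p.Prime := Fact.out
  induction i with
  | zero =>
    refine ⟨1, ?_, by simp⟩
    have h := cyclotomic_prime (ZMod p) p
    have h2 := cyclotomic_prime_pow_mul_X_pow_sub_one (ZMod p) p 0
    have h3 : (X - 1 : (ZMod p)[X]) ^ p = X ^ p - 1 := by
      rw [sub_pow_char, one_pow]
    have h4 : (∑ j ∈ range p, X ^ j : (ZMod p)[X]) * (X - 1) = (X - 1) ^ (p - 1) * (X - 1) := by
      rw [← pow_succ, Nat.sub_add_cancel hp.one_le, h3, geom_sum_mul]
    simpa using mul_right_cancel₀ (X_sub_C_ne_zero (1 : ZMod p)) (by simpa using h4)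
  | succ i ih =>
    obtain ⟨R, hR, hR1⟩ := ih (by omega)
    have hd := congrArg (fun f => X * derivative f) hR
    obtain ⟨k, hk⟩ : ∃ k, p - 1 - i = k + 1 := ⟨p - 1 - i - 1, by omega⟩
    have hk' : p - 1 - (i + 1) = k := by omega
    have hkc : (k : ZMod p) + 1 = -1 - i := by
      have : ((k + 1 + (i + 1) : ℕ) : ZMod p) = 0 := by
        rw [show k + 1 + (i + 1) = p by omega]; simp
      push_cast at this
      linear_combination this
    refine ⟨X * (C ((k : ZMod p) + 1) * R + (X - 1) * derivative R), ?_, ?_⟩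
    · rw [hk']
      have e1 : X * derivative (∑ j ∈ range p, C ((j : ZMod p) ^ i) * X ^ j)
          = ∑ j ∈ range p, C ((j : ZMod p) ^ (i + 1)) * X ^ j := by
        rw [derivative_sum, Finset.mul_sum]
        refine Finset.sum_congr rfl fun j _ => ?_
        rw [derivative_C_mul_X_pow]
        rcases j with _ | j
        · simp
        · simp only [Nat.add_sub_cancel, pow_succ, map_mul]; ring
      rw [← e1]
      beta_reduce at hd
      rw [hd, hk, derivative_mul, derivative_pow]
      simp
      ring
    · simp [hR1, hkc, pow_succ, Nat.factorial_succ]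
      ring

/-- The polynomial `∏ (X ^ ((n + 1) k) - X ^ (n k))`, `1 ≤ k ≤ n`. For `p = 2 n + 1` its value at
`ζ_p` is, up to an elementary sign, the product of the numbers `2 sin (π k / p)`. -/
noncomputable def sineProd (n : ℕ) : ℤ[X] :=
  ∏ k ∈ range n, (X ^ ((n + 1) * (k + 1)) - X ^ (n * (k + 1)))

/-- Modulo `p`, both `sineProd n` and the Gauss sum (`exists_sum_pow_mul_X_pow_eq` for `i = n`) are
divisible by `(X - 1) ^ n` when `p = 2 n + 1`. Comparing the cofactors at `1` decides the sign of
the Gauss sum. -/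
theorem sineProd_map_eq (n : ℕ) :
    ∃ S : (ZMod p)[X], (sineProd n).map (Int.castRingHom (ZMod p)) = (X - 1) ^ n * S ∧
      S.eval 1 = (n.factorial : ZMod p) := by
  refine ⟨∏ k ∈ range n, X ^ (n * (k + 1)) * ∑ i ∈ range (k + 1), X ^ i, ?_, ?_⟩
  · have : (X - 1 : (ZMod p)[X]) ^ n = ∏ k ∈ range n, (X - 1) := by simp
    rw [sineProd, Polynomial.map_prod, this, ← Finset.prod_mul_distrib]
    refine Finset.prod_congr rfl fun k _ => ?_
    have h := geom_sum_mul (X : (ZMod p)[X]) (k + 1)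
    simp only [Polynomial.map_sub, Polynomial.map_pow, map_X]
    rw [add_mul n 1, pow_add, one_mul]
    linear_combination -X ^ (n * (k + 1)) * h
  · rw [eval_prod, ← Finset.prod_range_add_one_eq_factorial, Nat.cast_prod]
    refine Finset.prod_congr rfl fun k _ => ?_
    simp [eval_finsetSum]

theorem aeval_sineProd (r : ℕ) (hr : p = 4 * r + 1) :
    aeval (ZMod.stdAddChar (1 : ZMod p)) (sineProd (2 * r)) =
      ((∏ k ∈ range (2 * r), 2 * Real.sin (Real.pi * (k + 1) / p) : ℝ) : ℂ) := by
  have hp0 : (p : ℂ) ≠ 0 := by exact_mod_cast (Fact.out : p.Prime).ne_zero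
  have hz : ∀ k : ℕ, ZMod.stdAddChar (1 : ZMod p) ^ k
      = Complex.exp (2 * Real.pi * Complex.I * k / p) := by
    intro k
    rw [stdAddChar_one_pow]
    simpa using ZMod.stdAddChar_coe (N := p) k
  have hI : ∀ r : ℕ, ∏ k ∈ range (2 * r), ((-1) ^ (k + 1) * Complex.I) = 1 := by
    intro r
    induction r with
    | zero => simp
    | succ r ih =>
      rw [show 2 * (r + 1) = 2 * r + 1 + 1 by ring, prod_range_succ, prod_range_succ, ih]
      simp only [pow_succ, pow_mul]
      norm_num
  rw [sineProd, map_prod, Complex.ofReal_prod, ← one_mul (∏ k ∈ range (2 * r), ((_ : ℝ) : ℂ)),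
    ← hI r, ← Finset.prod_mul_distrib]
  refine Finset.prod_congr rfl fun k _ => ?_
  set x : ℂ := Real.pi * (k + 1) / p with hx
  -- `(n + 1) (2 π / p) = π + π / p` and `n (2 π / p) = π - π / p` for `p = 2 n + 1`
  have e1 : ZMod.stdAddChar (1 : ZMod p) ^ ((2 * r + 1) * (k + 1))
      = (-1) ^ (k + 1) * Complex.exp (x * Complex.I) := by
    rw [hz, ← Complex.exp_pi_mul_I, ← Complex.exp_nat_mul, ← Complex.exp_add]
    congr 1
    rw [hx]
    field_simp
    rw [hr]
    push_cast
    ring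
  have e2 : ZMod.stdAddChar (1 : ZMod p) ^ (2 * r * (k + 1))
      = (-1) ^ (k + 1) * Complex.exp (-x * Complex.I) := by
    rw [hz, ← Complex.exp_pi_mul_I, ← Complex.exp_nat_mul, ← Complex.exp_add]
    congr 1
    rw [hx]
    field_simp
    rw [hr]
    push_cast
    ring
  have e3 : ((2 * Real.sin (Real.pi * (k + 1) / p) : ℝ) : ℂ) = 2 * Complex.sin x := by
    push_cast
    rfl
  rw [e3, Complex.two_sin]
  simp only [map_sub, map_pow, aeval_X, e1, e2]
  linear_combination (-(-1) ^ (k + 1) * (Complex.exp (-x * Complex.I)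
    - Complex.exp (x * Complex.I))) * Complex.I_sq

theorem prod_two_mul_sin_pos (r : ℕ) (hr : p = 4 * r + 1) :
    0 < ∏ k ∈ range (2 * r), 2 * Real.sin (Real.pi * (k + 1) / p) := by
  refine Finset.prod_pos fun k hk => ?_
  have hk := Finset.mem_range.1 hk
  have hp0 : (0 : ℝ) < p := by exact_mod_cast (Fact.out : p.Prime).pos
  have : Real.pi * (k + 1) / p < Real.pi := by
    rw [div_lt_iff₀ hp0]
    have : (k + 1 : ℝ) < p := by exact_mod_cast (by omega : k + 1 < p)
    exact mul_lt_mul_of_pos_left this Real.pi_pos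
  have := Real.sin_pos_of_pos_of_lt_pi (x := Real.pi * (k + 1) / p) (by positivity) this
  positivity

theorem aeval_sineProd_sq (r : ℕ) (hr : p = 4 * r + 1) :
    aeval (ZMod.stdAddChar (1 : ZMod p)) (sineProd (2 * r)) ^ 2 = (p : ℂ) := by
  set ζ := ZMod.stdAddChar (1 : ZMod p)
  have hp : p.Prime := Fact.out
  have hζ : IsPrimitiveRoot ζ p := stdAddChar_one_isPrimitiveRoot
  have hζp : ζ ^ p = 1 := hζ.pow_eq_one
  have h1 : ∏ k ∈ range (p - 1), (1 - ζ ^ (k + 1)) = (p : ℂ) := by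
    have h := IsPrimitiveRoot.prod_one_sub_pow_eq_order (n := p - 1)
      (by rwa [Nat.sub_add_cancel hp.one_le])
    rw [h, ← Nat.cast_add_one, Nat.sub_add_cancel hp.one_le]
  have h2 : p - 1 = 2 * r + 2 * r := by omega
  rw [← h1, h2, Finset.prod_range_add, sineProd, map_prod, ← Finset.prod_pow,
    ← Finset.prod_range_reflect (fun x => 1 - ζ ^ (2 * r + x + 1)), ← Finset.prod_mul_distrib]
  have h3 : ∏ k ∈ range (2 * r), (-1 : ℂ) = 1 := by
    simp [pow_mul]
  refine Eq.trans ?_ ((congrArg _ h3).trans (mul_one _))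
  rw [← Finset.prod_mul_distrib]
  refine Finset.prod_congr rfl fun k hk => ?_
  have hk := Finset.mem_range.1 hk
  have h4 : ζ ^ (2 * r + (2 * r - 1 - k) + 1) * ζ ^ (k + 1) = 1 := by
    rw [← pow_add, ← hζp]
    congr 1
    omega
  have h5 : (ζ ^ (2 * r * (k + 1))) ^ 2 * ζ ^ (k + 1) = 1 := by
    rw [← pow_mul, ← pow_add, show 2 * r * (k + 1) * 2 + (k + 1) = p * (k + 1) by rw [hr]; ring,
      pow_mul, hζp, one_pow]
  have h6 : ζ ^ (k + 1) ≠ 0 := pow_ne_zero _ (hζ.ne_zero hp.ne_zero)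
  simp only [map_sub, map_pow, aeval_X]
  rw [add_mul (2 * r) 1, pow_add, one_mul]
  apply mul_right_cancel₀ h6
  generalize ζ ^ (k + 1) = a at *
  generalize ζ ^ (2 * r * (k + 1)) = b at *
  generalize ζ ^ (2 * r + (2 * r - 1 - k) + 1) = c at *
  linear_combination (a - 1) ^ 2 * h5 - (1 - a) * h4

/-- **Gauss's determination of the sign of the quadratic Gauss sum**, for `p ≡ 1 (mod 4)`. -/
theorem sum_quadraticChar_mul_stdAddChar (hp4 : p % 4 = 1) :
    ∑ j : ZMod p, (quadraticChar (ZMod p) j : ℂ) * ZMod.stdAddChar j = (√(p : ℝ) : ℝ) := by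
  have hp : p.Prime := Fact.out
  obtain ⟨r, hr⟩ : ∃ r, p = 4 * r + 1 := ⟨p / 4, by omega⟩
  have hr0 : 0 < r := by have := hp.two_le; omega
  have hchar : ringChar (ZMod p) ≠ 2 := by rw [ZMod.ringChar_zmod_n]; omega
  set χ : MulChar (ZMod p) ℂ := (quadraticChar (ZMod p)).ringHomComp (Int.castRingHom ℂ) with hχ
  have hsq : (∑ j : ZMod p, (quadraticChar (ZMod p) j : ℂ) * ZMod.stdAddChar j) ^ 2 = (p : ℂ) := by
    have hq : χ.IsQuadratic := (quadraticChar_isQuadratic (ZMod p)).comp _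
    have hχ1 : χ ≠ 1 := by
      rw [hχ, MulChar.ringHomComp_ne_one_iff (RingHom.injective_int _)]
      exact quadraticChar_ne_one hchar
    have h := gaussSum_sq hχ1 hq (ZMod.isPrimitive_stdAddChar p)
    have hm1 : χ (-1) = 1 := by
      have : quadraticChar (ZMod p) (-1) = 1 := by
        rw [quadraticChar_one_iff_isSquare (by simp)]
        exact ZMod.exists_sq_eq_neg_one_iff.2 (by omega)
      simp [hχ, this]
    rw [hm1, one_mul, ZMod.card] at h
    exact h
  have hD := aeval_sineProd_sq r hr
  have hDr := aeval_sineProd r hr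
  have hpos := prod_two_mul_sin_pos r hr
  set D := ∏ k ∈ range (2 * r), 2 * Real.sin (Real.pi * (k + 1) / p)
  have hDp : D = √(p : ℝ) := by
    rw [hDr] at hD
    have : D ^ 2 = p := by exact_mod_cast hD
    rw [← this, Real.sqrt_sq hpos.le]
  rcases sq_eq_sq_iff_eq_or_eq_neg.1 (hsq.trans hD.symm) with h | h
  · rw [h, hDr, hDp]
  exfalso
  set G : ℤ[X] := ∑ j ∈ range p, C (quadraticChar (ZMod p) (j : ZMod p)) * X ^ j with hG
  have hroot : aeval (ZMod.stdAddChar (1 : ZMod p)) (G + sineProd (2 * r)) = 0 := by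
    rw [map_add, ← neg_eq_iff_add_eq_zero.1 h.symm, hG, sum_zmod_eq_sum_range, map_sum, add_comm]
    congr 1
    refine Finset.sum_congr rfl fun j _ => ?_
    simp [stdAddChar_one_pow]
  obtain ⟨Q, hQ⟩ := geomSum_dvd_of_aeval_eq_zero _ hroot
  have hmap := congrArg (Polynomial.map (Int.castRingHom (ZMod p))) hQ
  obtain ⟨S, hS, hS1⟩ := sineProd_map_eq (p := p) (2 * r)
  obtain ⟨R, hR, hR1⟩ := exists_sum_pow_mul_X_pow_eq (p := p) (2 * r) (by omega)
  obtain ⟨R0, hR0, hR01⟩ := exists_sum_pow_mul_X_pow_eq (p := p) 0 hp.pos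
  have hGm : G.map (Int.castRingHom (ZMod p)) = (X - 1) ^ (2 * r) * R := by
    rw [show p - 1 - 2 * r = 2 * r by omega] at hR
    rw [hG, Polynomial.map_sum, ← hR]
    refine Finset.sum_congr rfl fun j _ => ?_
    have := quadraticChar_eq_pow_of_char_ne_two' hchar (j : ZMod p)
    rw [ZMod.card, show p / 2 = 2 * r by omega] at this
    simp [← this]
  have hgeo : (∑ i ∈ range p, X ^ i : ℤ[X]).map (Int.castRingHom (ZMod p))
      = (X - 1) ^ (2 * r) * ((X - 1) ^ (2 * r) * R0) := by
    rw [← mul_assoc, ← pow_add, show 2 * r + 2 * r = p - 1 - 0 by omega, ← hR0,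
      Polynomial.map_sum]
    simp
  rw [Polynomial.map_add, Polynomial.map_mul, hGm, hS, hgeo, ← mul_add, mul_assoc] at hmap
  have hX : (X - 1 : (ZMod p)[X]) ^ (2 * r) ≠ 0 :=
    pow_ne_zero _ (by simpa using X_sub_C_ne_zero (1 : ZMod p))
  have h1 := congrArg (eval 1) (mul_left_cancel₀ hX hmap)
  simp only [eval_add, eval_mul, eval_pow, eval_sub, eval_X, eval_one, sub_self, hS1, hR1] at h1
  rw [zero_pow (by omega), zero_mul, zero_mul, pow_mul] at h1
  -- both contributions equal `(2 r)!`, so twice this factorial would vanish modulo `p`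
  have h2 : ((2 * (2 * r).factorial : ℕ) : ZMod p) = 0 := by
    push_cast
    linear_combination h1
  rw [ZMod.natCast_eq_zero_iff, hp.dvd_mul, hp.dvd_factorial] at h2
  rcases h2 with h2 | h2
  · have := Nat.le_of_dvd two_pos h2
    omega
  · omega

end GaussSum

/-! ### Cyclotomic integers whose absolute value is a power of `√p` -/

section RootsOfUnity

open Polynomial

variable {p : ℕ} [Fact p.Prime]

/-- If `a ∈ ℤ[ζ_p]` and `|a| ^ 2` is a power of `p`, then `a` and its conjugate are associated,
because `ζ_p - 1` is the only prime above `p` and is associated to its conjugate. Hence `a / ā` is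
a unit all of whose conjugates have absolute value `1`, so that it is a root of unity. -/
theorem exists_sq_eq_of_mul_conj_eq_pow {K : Type*} [Field K] [NumberField K]
    [IsCyclotomicExtension {p} ℚ K] [NumberField.IsCMField K] (hp2 : p ≠ 2)
    {ζ : K} (hζ : IsPrimitiveRoot ζ p) (a : NumberField.RingOfIntegers K) (M : ℕ)
    (ha : a * NumberField.IsCMField.ringOfIntegersComplexConj K a = (p : _) ^ M) :
    ∃ k : ℕ, (a : K) ^ 2 = (p : K) ^ M * ζ ^ k ∨ (a : K) ^ 2 = -((p : K) ^ M * ζ ^ k) := by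
  have hp : p.Prime := Fact.out
  set c := NumberField.IsCMField.ringOfIntegersComplexConj K with hc
  set z := hζ.toInteger
  have hz : IsPrimitiveRoot z p := hζ.toInteger_isPrimitiveRoot
  have hprime : Prime (z - 1) := hζ.zeta_sub_one_prime'
  have hpa : Associated ((z - 1) ^ (p - 1)) (p : NumberField.RingOfIntegers K) :=
    IsCyclotomicExtension.Rat.associated_zeta_sub_one_pow_prime p hζ
  have hdvd : a ∣ (z - 1) ^ ((p - 1) * M) := by
    rw [pow_mul]
    exact (Dvd.intro _ ha).trans (hpa.pow_pow (n := M)).symm.dvd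
  obtain ⟨i, -, hi⟩ := (dvd_prime_pow hprime _).1 hdvd
  have hzc : Associated (z - 1) (c (z - 1)) :=
    hz.associated_sub_one_map_sub_one c
  have hac : Associated (c a) a := by
    have h1 : Associated (c a) (c (z - 1) ^ i) := by
      rw [← map_pow]
      exact hi.map c
    exact (h1.trans (hzc.symm.pow_pow)).trans hi.symm
  obtain ⟨w, hw⟩ := hac
  have hpM : (p : NumberField.RingOfIntegers K) ^ M ≠ 0 :=
    pow_ne_zero _ (Nat.cast_ne_zero.2 hp.ne_zero)
  have ha0 : a ≠ 0 := by
    rintro rfl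
    rw [zero_mul] at ha
    exact hpM ha.symm
  have hfin : IsOfFinOrder ((w : NumberField.RingOfIntegers K) : K) := by
    obtain ⟨n, hn, hn1⟩ := NumberField.Embeddings.pow_eq_one_of_norm_eq_one K ℂ
      (NumberField.RingOfIntegers.isIntegral_coe (w : NumberField.RingOfIntegers K)) (by
        intro φ
        have h1 := congrArg (fun x : NumberField.RingOfIntegers K => φ (x : K)) hw
        simp only [map_mul] at h1
        have h2 : φ (c a : K) = (starRingEnd ℂ) (φ (a : K)) :=
          NumberField.IsCMField.complexEmbedding_complexConj K φ (a : K)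
        have h3 := congrArg norm h1
        rw [norm_mul, h2, RCLike.norm_conj] at h3
        have h4 : ‖φ (a : K)‖ ≠ 0 := by
          rw [norm_ne_zero_iff, _root_.map_ne_zero]
          simpa using ha0
        exact mul_left_cancel₀ h4 (h3.trans (mul_one _).symm))
    exact isOfFinOrder_iff_pow_eq_one.2 ⟨n, hn, hn1⟩
  have hsq : a ^ 2 = (p : NumberField.RingOfIntegers K) ^ M * w := by
    rw [← ha]
    nth_rewrite 1 [pow_two, ← hw]
    ring
  have hsq' : (a : K) ^ 2 = (p : K) ^ M * ((w : NumberField.RingOfIntegers K) : K) := by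
    have := congrArg (fun x : NumberField.RingOfIntegers K => (x : K)) hsq
    simpa using this
  obtain ⟨k, -, hk | hk⟩ :=
    hζ.exists_pow_or_neg_mul_pow_of_isOfFinOrder (hp.odd_of_ne_two hp2) hfin
  · exact ⟨k, Or.inl (by rw [hsq', hk])⟩
  · exact ⟨k, Or.inr (by rw [hsq', hk]; ring)⟩

/-- A primitive fourth root of unity does not lie in `ℚ(ζ_p)` for odd `p`. -/
theorem sq_ne_neg_one_of_isCyclotomicExtension {K : Type*} [Field K] [NumberField K]
    [IsCyclotomicExtension {p} ℚ K] (hp2 : p ≠ 2) (x : K) : x ^ 2 ≠ -1 := by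
  intro hx
  have hp : p.Prime := Fact.out
  have hζ := IsCyclotomicExtension.zeta_spec p ℚ K
  have hfin : IsOfFinOrder x := isOfFinOrder_iff_pow_eq_one.2 ⟨4, by norm_num, by
    rw [show (4 : ℕ) = 2 * 2 by rfl, pow_mul, hx]; norm_num⟩
  obtain ⟨r, hr⟩ := hζ.exists_neg_pow_of_isOfFinOrder (hp.odd_of_ne_two hp2) hfin
  have h1 : x ^ (2 * p) = 1 := by
    rw [hr, ← pow_mul, mul_comm, pow_mul, pow_mul, neg_sq, ← pow_mul, ← pow_mul,
      show 2 * (p * r) = p * (2 * r) by ring, pow_mul, hζ.pow_eq_one, one_pow]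
  rw [pow_mul, hx, (hp.odd_of_ne_two hp2).neg_one_pow] at h1
  norm_num at h1

/-- An integral combination of `p`-th roots of unity whose absolute value is the square root of a
power of `p` is, for `p ≡ 1 (mod 4)`, that square root times `±` a `p`-th root of unity. -/
theorem exists_eq_sign_mul_sqrt_pow_mul_stdAddChar (hp4 : p % 4 = 1) (n : ZMod p → ℤ) (M : ℕ)
    (hn : ‖∑ j, (n j : ℂ) * ZMod.stdAddChar j‖ ^ 2 = (p : ℝ) ^ M) :
    ∃ ε : ℤ, (ε = 1 ∨ ε = -1) ∧ ∃ k : ZMod p, ∑ j, (n j : ℂ) * ZMod.stdAddChar j =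
      (ε : ℂ) * ((√(p : ℝ) : ℝ) : ℂ) ^ M * ZMod.stdAddChar k := by
  have hp : p.Prime := Fact.out
  have hp2 : p ≠ 2 := by rintro rfl; omega
  have : NeZero ((p : ℕ) : ℚ) := ⟨by exact_mod_cast hp.ne_zero⟩
  let K := CyclotomicField p ℚ
  have : IsCyclotomicExtension {p} ℚ K := CyclotomicField.isCyclotomicExtension p ℚ
  have hζ := IsCyclotomicExtension.zeta_spec p ℚ K
  set ζ := IsCyclotomicExtension.zeta p ℚ K
  have : NumberField K := IsCyclotomicExtension.numberField {p} ℚ K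
  have : NumberField.IsCMField K := IsCyclotomicExtension.Rat.isCMField K (S := {p})
    ⟨p, rfl, by have := hp.two_le; omega⟩
  set e := hζ.embeddingsEquivPrimitiveRoots ℂ (cyclotomic.irreducible_rat hp.pos)
  set φ : K →ₐ[ℚ] ℂ := e.symm ⟨ZMod.stdAddChar (1 : ZMod p),
    (mem_primitiveRoots hp.pos).2 stdAddChar_one_isPrimitiveRoot⟩ with hφ
  have hinj : Function.Injective φ := (φ : K →+* ℂ).injective
  have hφζ : φ ζ = ZMod.stdAddChar (1 : ZMod p) := by
    have h := hζ.embeddingsEquivPrimitiveRoots_apply_coe ℂ (cyclotomic.irreducible_rat hp.pos) φ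
    rw [← h]
    change ((e φ : primitiveRoots p ℂ) : ℂ) = _
    rw [hφ, Equiv.apply_symm_apply]
  have hφj : ∀ j : ZMod p, φ (ζ ^ j.val) = ZMod.stdAddChar j := fun j => by
    rw [map_pow, hφζ, stdAddChar_one_pow_val]
  set z := hζ.toInteger
  set a : NumberField.RingOfIntegers K := ∑ j, (n j : NumberField.RingOfIntegers K) * z ^ j.val
  set A := ∑ j, (n j : ℂ) * ZMod.stdAddChar j with hA
  have haK : (a : K) = ∑ j, (n j : K) * ζ ^ j.val := by
    simp only [a, map_sum, map_mul, map_pow, map_intCast]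
    rfl
  have hφa : φ (a : K) = A := by
    rw [haK, map_sum, hA]
    refine Finset.sum_congr rfl fun j _ => ?_
    rw [map_mul, hφj, map_intCast]
  have hconj : a * NumberField.IsCMField.ringOfIntegersComplexConj K a = (p : _) ^ M := by
    apply NumberField.RingOfIntegers.ext
    apply hinj
    have h2 : φ (NumberField.IsCMField.complexConj K (a : K)) = (starRingEnd ℂ) (φ (a : K)) :=
      NumberField.IsCMField.complexEmbedding_complexConj K (φ : K →+* ℂ) (a : K)
    change φ ((a : K) * NumberField.IsCMField.complexConj K (a : K)) = φ (algebraMap _ K _)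
    rw [map_mul, h2, hφa, Complex.mul_conj', map_pow, map_natCast, map_pow, map_natCast]
    exact_mod_cast hn
  obtain ⟨k, hk⟩ := exists_sq_eq_of_mul_conj_eq_pow hp2 hζ a M hconj
  -- the Gauss sum, as an element of `ℚ(ζ_p)` whose square is `p`
  set G : K := ∑ j : ZMod p, (quadraticChar (ZMod p) j : K) * ζ ^ j.val
  have hφG : φ G = (√(p : ℝ) : ℝ) := by
    rw [← sum_quadraticChar_mul_stdAddChar hp4, map_sum]
    refine Finset.sum_congr rfl fun j _ => ?_
    rw [map_mul, hφj, map_intCast]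
  have hG2 : G ^ 2 = (p : K) := by
    apply hinj
    rw [map_pow, hφG, map_natCast, ← Complex.ofReal_pow, Real.sq_sqrt (Nat.cast_nonneg _)]
    simp
  have hG0 : G ≠ 0 := by
    intro h
    rw [h] at hG2
    exact (Nat.cast_ne_zero (R := K)).2 hp.ne_zero (by rw [← hG2]; ring)
  -- every `p`-th root of unity is a square
  set h : ℕ := k * ((p + 1) / 2)
  have hh : (ζ ^ h) ^ 2 = ζ ^ k := by
    rw [← pow_mul, mul_assoc, show (p + 1) / 2 * 2 = p + 1 by omega, mul_add, mul_one, pow_add,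
      mul_comm, mul_comm k, pow_mul, hζ.pow_eq_one, one_pow, mul_one]
  have hζ0 : ζ ≠ 0 := hζ.ne_zero hp.ne_zero
  have hden : G ^ M * ζ ^ h ≠ 0 := mul_ne_zero (pow_ne_zero _ hG0) (pow_ne_zero _ hζ0)
  have hden2 : (G ^ M * ζ ^ h) ^ 2 = (p : K) ^ M * ζ ^ k := by
    rw [mul_pow, hh, pow_right_comm, hG2]
  rw [← hden2] at hk
  have hφd : φ (G ^ M * ζ ^ h) = ((√(p : ℝ) : ℝ) : ℂ) ^ M * ZMod.stdAddChar (h : ZMod p) := by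
    rw [map_mul, map_pow, hφG, map_pow, hφζ, stdAddChar_one_pow]
  rcases hk with hk | hk
  · rcases sq_eq_sq_iff_eq_or_eq_neg.1 hk with h1 | h1
    · refine ⟨1, Or.inl rfl, h, ?_⟩
      rw [← hφa, h1, hφd]
      simp
    · refine ⟨-1, Or.inr rfl, h, ?_⟩
      rw [← hφa, h1, map_neg, hφd]
      simp
  · exfalso
    refine sq_ne_neg_one_of_isCyclotomicExtension (p := p) hp2 ((a : K) / (G ^ M * ζ ^ h)) ?_
    rw [div_pow, hk, neg_div, div_self (pow_ne_zero _ hden)]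

end RootsOfUnity

/-! ### Values of a function and its character sum -/

section Counting

variable {p : ℕ} [Fact p.Prime] {α : Type*}

theorem sum_stdAddChar_comp (T : Finset α) (φ : α → ZMod p) :
    ∑ x ∈ T, ZMod.stdAddChar (φ x) = ∑ j, ((#{x ∈ T | φ x = j} : ℤ) : ℂ) * ZMod.stdAddChar j := by
  rw [← Finset.sum_fiberwise T φ]
  refine Finset.sum_congr rfl fun j _ => ?_
  rw [Finset.sum_congr rfl (g := fun _ => ZMod.stdAddChar j)
    (fun x hx => by rw [(Finset.mem_filter.1 hx).2])]
  simp

theorem sum_card_fiber (T : Finset α) (φ : α → ZMod p) :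
    ∑ j, (#{x ∈ T | φ x = j} : ℤ) = #T := by
  exact_mod_cast (Finset.card_eq_sum_card_fiberwise (f := φ) (t := univ) (by simp)).symm

/-- The distribution of the values of `φ` is determined by its character sum. -/
theorem mul_card_fiber_eq_of_sum_eq (T : Finset α) (φ : α → ZMod p) (c : ℤ) (k : ZMod p)
    (h : ∑ x ∈ T, ZMod.stdAddChar (φ x) = (c : ℂ) * ZMod.stdAddChar k) (j : ZMod p) :
    (p : ℤ) * #{x ∈ T | φ x = j} = #T - c + if j = k then (p : ℤ) * c else 0 := by
  have key := eq_of_sum_mul_stdAddChar_eq_zero (p := p)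
    (fun j => (#{x ∈ T | φ x = j} : ℤ) - if j = k then c else 0) (by
      rw [sum_stdAddChar_comp] at h
      simp only [Int.cast_sub, sub_mul, Finset.sum_sub_distrib]
      rw [h]
      simp)
  have hsum : ∑ i, ((#{x ∈ T | φ x = i} : ℤ) - if i = k then c else 0)
      = p * ((#{x ∈ T | φ x = j} : ℤ) - if j = k then c else 0) := by
    rw [Finset.sum_congr rfl (fun i _ => key i j), Finset.sum_const, Finset.card_univ, ZMod.card,
      nsmul_eq_mul]
  rw [Finset.sum_sub_distrib, sum_card_fiber] at hsum
  simp only [Finset.sum_ite_eq', Finset.mem_univ, if_true] at hsum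
  split_ifs at hsum ⊢ <;> linarith

/-- The variant of `mul_card_fiber_eq_of_sum_eq` for a multiple of the quadratic Gauss sum. -/
theorem mul_card_fiber_eq_of_sum_eq_mul_sqrt (hp4 : p % 4 = 1) (T : Finset α) (φ : α → ZMod p)
    (c : ℤ) (h : ∑ x ∈ T, ZMod.stdAddChar (φ x) = (c : ℂ) * ((√(p : ℝ) : ℝ) : ℂ)) (j : ZMod p) :
    (p : ℤ) * #{x ∈ T | φ x = j} = #T + p * (quadraticChar (ZMod p) j * c) := by
  have hchar : ringChar (ZMod p) ≠ 2 := by rw [ZMod.ringChar_zmod_n]; omega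
  have key := eq_of_sum_mul_stdAddChar_eq_zero (p := p)
    (fun j => (#{x ∈ T | φ x = j} : ℤ) - quadraticChar (ZMod p) j * c) (by
      rw [sum_stdAddChar_comp, ← sum_quadraticChar_mul_stdAddChar hp4, Finset.mul_sum] at h
      simp only [Int.cast_sub, sub_mul, Finset.sum_sub_distrib]
      rw [h, sub_eq_zero]
      refine Finset.sum_congr rfl fun i _ => ?_
      push_cast
      ring)
  have hsum : ∑ i, ((#{x ∈ T | φ x = i} : ℤ) - quadraticChar (ZMod p) i * c)
      = p * ((#{x ∈ T | φ x = j} : ℤ) - quadraticChar (ZMod p) j * c) := by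
    rw [Finset.sum_congr rfl (fun i _ => key i j), Finset.sum_const, Finset.card_univ, ZMod.card,
      nsmul_eq_mul]
  rw [Finset.sum_sub_distrib, sum_card_fiber, ← Finset.sum_mul, quadraticChar_sum_zero hchar]
    at hsum
  linarith

end Counting

/-! ### The Walsh transform and the dual function -/

section Walsh

variable {p : ℕ} [Fact p.Prime] {F : Type*} [Field F] [Fintype F] [Algebra (ZMod p) F]

/-- The canonical additive character `x ↦ ζ_p ^ Tr x` of `F`. -/
noncomputable def traceChar (p : ℕ) [Fact p.Prime] (F : Type*) [Field F] [Fintype F]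
    [Algebra (ZMod p) F] : AddChar F ℂ :=
  ZMod.stdAddChar.compAddMonoidHom (Algebra.trace (ZMod p) F).toAddMonoidHom

theorem traceChar_apply (x : F) :
    traceChar p F x = ZMod.stdAddChar (Algebra.trace (ZMod p) F x) := rfl

theorem traceChar_isPrimitive : (traceChar p F).IsPrimitive := by
  apply AddChar.IsPrimitive.of_ne_one
  have : Module.Finite (ZMod p) F := Module.Finite.of_finite
  obtain ⟨x, hx⟩ := Algebra.trace_surjective (ZMod p) F 1
  intro h
  have h1 : traceChar p F x = 1 := by rw [h]; rfl
  rw [traceChar_apply, hx] at h1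
  exact (stdAddChar_one_isPrimitiveRoot (p := p)).ne_one (Fact.out : p.Prime).one_lt h1

theorem sum_traceChar_mul (x : F) [Decidable (x = 0)] :
    ∑ β : F, traceChar p F (β * x) = if x = 0 then (Fintype.card F : ℂ) else 0 := by
  classical
  have h := AddChar.sum_mulShift x (traceChar_isPrimitive (p := p) (F := F))
  rw [h]
  split_ifs <;> simp

theorem walsh_eq (f : F → ZMod p) (β : F) :
    walsh p f β = ∑ x, ZMod.stdAddChar (f x) * traceChar p F (-(β * x)) := by
  refine Finset.sum_congr rfl fun x _ => ?_
  rw [traceChar_apply, map_neg, ← AddChar.map_add_eq_mul, sub_eq_add_neg]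

theorem sum_walsh (f : F → ZMod p) :
    ∑ β, walsh p f β = (Fintype.card F : ℂ) * ZMod.stdAddChar (f 0) := by
  classical
  simp only [walsh_eq]
  rw [Finset.sum_comm]
  have : ∀ x : F, ∑ β, ZMod.stdAddChar (f x) * traceChar p F (-(β * x))
      = if x = 0 then (Fintype.card F : ℂ) * ZMod.stdAddChar (f 0) else 0 := by
    intro x
    rw [← Finset.mul_sum]
    simp only [← mul_neg]
    rw [sum_traceChar_mul]
    by_cases hx : x = 0
    · simp [hx, mul_comm]
    · simp [hx]
  simp [this]

/-- Parseval's identity. -/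
theorem sum_norm_walsh_sq (f : F → ZMod p) :
    ∑ β, ‖walsh p f β‖ ^ 2 = (Fintype.card F : ℝ) ^ 2 := by
  classical
  have hconj : ∀ a : ZMod p, (starRingEnd ℂ) (ZMod.stdAddChar a) = ZMod.stdAddChar (-a) := by
    intro a
    rw [AddChar.map_neg_eq_conj]
  have h : ∀ β, ((‖walsh p f β‖ ^ 2 : ℝ) : ℂ) = ∑ x, ∑ y,
      ZMod.stdAddChar (f x - f y) * traceChar p F (β * (y - x)) := by
    intro β
    push_cast
    rw [← Complex.mul_conj', walsh, map_sum, Finset.sum_mul_sum]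
    refine Finset.sum_congr rfl fun x _ => Finset.sum_congr rfl fun y _ => ?_
    rw [hconj, traceChar_apply, ← AddChar.map_add_eq_mul, ← AddChar.map_add_eq_mul, mul_sub,
      map_sub]
    congr 1
    ring
  have h2 : ((∑ β, ‖walsh p f β‖ ^ 2 : ℝ) : ℂ) = (((Fintype.card F : ℝ) ^ 2 : ℝ) : ℂ) := by
    rw [Complex.ofReal_sum]
    simp only [h]
    rw [Finset.sum_comm]
    have : ∀ x : F, ∑ β, ∑ y, ZMod.stdAddChar (f x - f y) * traceChar p F (β * (y - x))
        = (Fintype.card F : ℂ) := by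
      intro x
      rw [Finset.sum_comm]
      simp only [← Finset.mul_sum, sum_traceChar_mul, sub_eq_zero]
      simp
    simp [this, pow_two]
  exact_mod_cast h2

/-- The Walsh support as a `Finset`. -/
noncomputable def supp (p : ℕ) [Fact p.Prime] {F : Type*} [Field F] [Fintype F]
    [Algebra (ZMod p) F] (m s : ℕ) (f : F → ZMod p) : Finset F :=
  (Set.toFinite (walshSupport p m s f)).toFinset

theorem mem_supp {m s : ℕ} {f : F → ZMod p} {β : F} :
    β ∈ supp p m s f ↔ β ∈ walshSupport p m s f := by
  simp [supp]

theorem dualCount_eq (m s : ℕ) (f : F → ZMod p) (c : ZMod p) :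
    dualCount p m s f c = #{β ∈ supp p m s f | dual p m s f β = c} := by
  rw [dualCount, ← Set.ncard_coe_finset]
  congr 1
  ext β
  simp [mem_supp]

theorem mem_supp_iff_walsh_ne_zero {m s : ℕ} {f : F → ZMod p} (hf : IsPlateaued p m s f) {β : F} :
    β ∈ supp p m s f ↔ walsh p f β ≠ 0 := by
  have hp0 : (0 : ℝ) < p := by exact_mod_cast (Fact.out : p.Prime).pos
  rw [mem_supp]
  constructor
  · intro h h0
    have : ‖walsh p f β‖ ^ 2 = (p : ℝ) ^ (m + s) := h
    rw [h0] at this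
    have h1 : (0 : ℝ) < (p : ℝ) ^ (m + s) := by positivity
    simp at this
    linarith
  · intro h
    rcases hf.2 β with h1 | h1
    · exact absurd (by simpa using h1) h
    · exact h1

theorem card_supp {m s : ℕ} (hF : Fintype.card F = p ^ m) {f : F → ZMod p}
    (hf : IsPlateaued p m s f) : #(supp p m s f) = p ^ (m - s) := by
  classical
  have hp0 : (0 : ℝ) < p := by exact_mod_cast (Fact.out : p.Prime).pos
  have h := sum_norm_walsh_sq f
  have h1 : ∀ β, ‖walsh p f β‖ ^ 2 = if β ∈ supp p m s f then (p : ℝ) ^ (m + s) else 0 := by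
    intro β
    split_ifs with hβ
    · exact mem_supp.1 hβ
    · rw [mem_supp_iff_walsh_ne_zero hf, not_not] at hβ
      simp [hβ]
  simp only [h1] at h
  rw [Finset.sum_ite_mem, Finset.univ_inter, Finset.sum_const, nsmul_eq_mul, hF] at h
  have h2 : ((p ^ m : ℕ) : ℝ) ^ 2 = (p : ℝ) ^ (m - s) * (p : ℝ) ^ (m + s) := by
    rw [← pow_add]
    push_cast
    rw [← pow_mul]
    congr 1
    have := hf.1
    omega
  rw [h2] at h
  exact_mod_cast mul_right_cancel₀ (by positivity) h

/-- The constant `u` in the definition of weak regularity is `±` a `p`-th root of unity, by the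
shape of the Walsh transform at `0`; the root of unity is moved into the dual function. -/
theorem exists_isSignDual (hp4 : p % 4 = 1) {m s : ℕ} {f : F → ZMod p} (hf : IsWRP p m s f) :
    ∃ e : ℤ × (F → ZMod p), IsSignDual p m s f e.1 e.2 := by
  classical
  obtain ⟨u, hu, d, hd, hW⟩ := hf.weaklyRegular.2
  have h0 : (0 : F) ∈ walshSupport p m s f :=
    mem_supp.1 ((mem_supp_iff_walsh_ne_zero hf.weaklyRegular.1).2 hf.unbalanced)
  have hp0 : (0 : ℝ) < p := by exact_mod_cast (Fact.out : p.Prime).pos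
  have hs0 : ((√(p : ℝ) : ℝ) : ℂ) ^ (m + s) ≠ 0 := by
    apply pow_ne_zero
    exact_mod_cast (Real.sqrt_pos.2 hp0).ne'
  have hsum := sum_stdAddChar_comp univ (fun x : F => f x - Algebra.trace (ZMod p) F (0 * x))
  have hn : ‖walsh p f 0‖ ^ 2 = (p : ℝ) ^ (m + s) := h0
  obtain ⟨ε, hε, k, hk⟩ := exists_eq_sign_mul_sqrt_pow_mul_stdAddChar hp4
    (fun j => (#{x : F | f x - Algebra.trace (ZMod p) F (0 * x) = j} : ℤ)) (m + s)
    (by rw [← hsum]; exact hn)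
  rw [← hsum] at hk
  have hk' : walsh p f 0 = (ε : ℂ) * ((√(p : ℝ) : ℝ) : ℂ) ^ (m + s) * ZMod.stdAddChar k := hk
  have hu' : u * ZMod.stdAddChar (d 0) = ε * ZMod.stdAddChar k := by
    have h1 := (hW 0).resolve_left hf.unbalanced
    rw [hk'] at h1
    apply mul_right_cancel₀ hs0
    linear_combination -h1
  refine ⟨(ε, fun β => if β ∈ walshSupport p m s f then d β - d 0 + k else 0), hε, ?_, ?_⟩
  · intro β hβ
    have hβ0 : walsh p f β ≠ 0 := (mem_supp_iff_walsh_ne_zero hf.weaklyRegular.1).1 (mem_supp.2 hβ)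
    rw [(hW β).resolve_left hβ0]
    simp only [hβ, if_true]
    have h2 : ZMod.stdAddChar (d β) = ZMod.stdAddChar (d 0) * ZMod.stdAddChar (d β - d 0) := by
      rw [← AddChar.map_add_eq_mul]
      congr 1
      ring
    rw [h2, AddChar.map_add_eq_mul]
    linear_combination (((√(p : ℝ) : ℝ) : ℂ) ^ (m + s) * ZMod.stdAddChar (d β - d 0)) * hu'
  · intro β hβ
    simp [hβ]

theorem isSignDual_sign_dual (hp4 : p % 4 = 1) {m s : ℕ} {f : F → ZMod p} (hf : IsWRP p m s f) :
    IsSignDual p m s f (sign p m s f) (dual p m s f) :=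
  Classical.epsilon_spec (exists_isSignDual hp4 hf)

/-- Fourier inversion at `0`, where `f` vanishes. -/
theorem sum_stdAddChar_dual (hp4 : p % 4 = 1) {m s : ℕ} (hF : Fintype.card F = p ^ m)
    {f : F → ZMod p} (hf : IsWRP p m s f) :
    ∑ β ∈ supp p m s f, ZMod.stdAddChar (dual p m s f β)
      = (sign p m s f : ℂ) * ((√(p : ℝ) : ℝ) : ℂ) ^ (m - s) := by
  classical
  have hp0 : (0 : ℝ) < p := by exact_mod_cast (Fact.out : p.Prime).pos
  have hs0 : ((√(p : ℝ) : ℝ) : ℂ) ^ (m + s) ≠ 0 := by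
    apply pow_ne_zero
    exact_mod_cast (Real.sqrt_pos.2 hp0).ne'
  obtain ⟨hε, hW, -⟩ := isSignDual_sign_dual hp4 hf
  have hε2 : (sign p m s f : ℂ) * sign p m s f = 1 := by
    rcases hε with h | h <;> simp [h]
  have h := sum_walsh f
  rw [hf.map_zero, AddChar.map_zero_eq_one, mul_one, hF,
    ← Finset.sum_subset (Finset.subset_univ (supp p m s f)) (fun β _ hβ => by
      rwa [mem_supp_iff_walsh_ne_zero hf.weaklyRegular.1, not_not] at hβ),
    Finset.sum_congr rfl (fun β hβ => hW β (mem_supp.1 hβ)), ← Finset.mul_sum] at h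
  have h2 : ((p ^ m : ℕ) : ℂ)
      = ((√(p : ℝ) : ℝ) : ℂ) ^ (m - s) * ((√(p : ℝ) : ℝ) : ℂ) ^ (m + s) := by
    have := hf.weaklyRegular.1.1
    rw [← pow_add, show m - s + (m + s) = 2 * m by omega, pow_mul, ← Complex.ofReal_pow,
      Real.sq_sqrt hp0.le]
    push_cast
    rfl
  rw [h2] at h
  apply mul_right_cancel₀ hs0
  linear_combination (sign p m s f : ℂ) * h - (∑ β ∈ supp p m s f, ZMod.stdAddChar (dual p m s f β))
    * ((√(p : ℝ) : ℝ) : ℂ) ^ (m + s) * hε2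

theorem sqrt_pow_two_mul (n k : ℕ) : ((√(n : ℝ) : ℝ) : ℂ) ^ (2 * k) = ((n : ℤ) ^ k : ℤ) := by
  rw [pow_mul, ← Complex.ofReal_pow, Real.sq_sqrt (Nat.cast_nonneg _)]
  push_cast
  rfl

theorem mul_dualCount_of_even (hp4 : p % 4 = 1) {m s : ℕ} (hF : Fintype.card F = p ^ m)
    {f : F → ZMod p} (hf : IsWRP p m s f) {k : ℕ} (hk : m - s = 2 * k) (c : ZMod p) :
    (p : ℤ) * dualCount p m s f c = p ^ (2 * k) - sign p m s f * p ^ k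
      + if c = 0 then p * (sign p m s f * p ^ k) else 0 := by
  have h := mul_card_fiber_eq_of_sum_eq (supp p m s f) (dual p m s f) (sign p m s f * p ^ k) 0
    (by rw [sum_stdAddChar_dual hp4 hF hf, hk, sqrt_pow_two_mul]; simp) c
  rw [dualCount_eq, h, card_supp hF hf.weaklyRegular.1, hk]
  push_cast
  rfl

theorem mul_dualCount_of_odd (hp4 : p % 4 = 1) {m s : ℕ} (hF : Fintype.card F = p ^ m)
    {f : F → ZMod p} (hf : IsWRP p m s f) {k : ℕ} (hk : m - s = 2 * k + 1) (c : ZMod p) :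
    (p : ℤ) * dualCount p m s f c = p ^ (2 * k + 1)
      + p * (quadraticChar (ZMod p) c * (sign p m s f * p ^ k)) := by
  have h := mul_card_fiber_eq_of_sum_eq_mul_sqrt hp4 (supp p m s f) (dual p m s f)
    (sign p m s f * p ^ k)
    (by rw [sum_stdAddChar_dual hp4 hF hf, hk, pow_succ, sqrt_pow_two_mul]; push_cast; ring) c
  rw [dualCount_eq, h, card_supp hF hf.weaklyRegular.1, hk]
  push_cast
  rfl

end Walsh

/-! ### Multiplication by scalars -/

section Scaling

variable {p : ℕ} [Fact p.Prime] {F : Type*} [Field F] [Fintype F] [Algebra (ZMod p) F]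

/-- A set of nonzero vectors closed under multiplication by nonzero scalars is a union of punctured
lines, which have `p - 1` elements. -/
theorem sub_one_dvd_card_of_smul_mem (T : Finset F) (h0 : (0 : F) ∉ T)
    (hT : ∀ z : ZMod p, z ≠ 0 → ∀ x ∈ T, z • x ∈ T) : p - 1 ∣ #T := by
  let S : SubMulAction (ZMod p)ˣ F :=
    { carrier := T
      smul_mem' := fun u x hx => hT u u.ne_zero x hx }
  have hfree : ∀ x : S, MulAction.stabilizer (ZMod p)ˣ x = ⊥ := by
    intro x
    rw [eq_bot_iff]
    intro u hu
    have h1 : (u : ZMod p) • (x : F) = x := congrArg Subtype.val (MulAction.mem_stabilizer_iff.1 hu)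
    have hx : (x : F) ≠ 0 := fun h => h0 (h ▸ x.2)
    have h2 : ((u : ZMod p) - 1) • (x : F) = 0 := by rw [sub_smul, h1, one_smul, sub_self]
    rcases smul_eq_zero.1 h2 with h3 | h3
    · exact Subgroup.mem_bot.2 (Units.ext (sub_eq_zero.1 h3))
    · exact absurd h3 hx
  have e := MulAction.selfEquivOrbitsQuotientProd hfree
  have h1 := Nat.card_congr e
  rw [Nat.card_prod, Nat.card_eq_fintype_card (α := (ZMod p)ˣ), ZMod.card_units] at h1
  have h2 : Nat.card S = #T := by
    have : Nat.card S = Nat.card (T : Set F) := rfl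
    rw [this, Nat.card_coe_set_eq, Set.ncard_coe_finset]
  rw [← h2, h1]
  exact Dvd.intro_left _ rfl

theorem walsh_smul {h : ℕ} {f : F → ZMod p} (w : ZMod p) (hw : w ≠ 0)
    (hf : ∀ x, f (w • x) = w ^ (h + 1) * f x) (β : F) :
    walsh p f (w ^ h • β) =
      ∑ x, ZMod.stdAddChar (w ^ (h + 1) * (f x - Algebra.trace (ZMod p) F (β * x))) := by
  rw [walsh, ← Equiv.sum_comp (MulAction.toPerm (Units.mk0 w hw))]
  refine Finset.sum_congr rfl fun x _ => ?_
  have h1 : (MulAction.toPerm (Units.mk0 w hw)) x = w • x := rfl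
  rw [h1, hf, mul_sub]
  congr 2
  rw [smul_mul_smul_comm, ← pow_succ, map_smul, smul_eq_mul]

theorem exists_pow_eq_of_coprime {n : ℕ} (hn : Nat.gcd n (p - 1) = 1) (z : ZMod p) (hz : z ≠ 0) :
    ∃ w : ZMod p, w ≠ 0 ∧ w ^ n = z := by
  have hc : (Nat.card (ZMod p)ˣ).Coprime n := by
    rw [Nat.card_eq_fintype_card, ZMod.card_units]
    exact (Nat.coprime_comm.1 hn)
  obtain ⟨u, hu⟩ := (powCoprime hc).surjective (Units.mk0 z hz)
  refine ⟨u, u.ne_zero, ?_⟩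
  have := congrArg Units.val hu
  simpa using this

/-- The Walsh support of a homogeneous function is closed under multiplication by nonzero scalars:
substituting `w • x` for `x` in the Walsh transform at `w ^ (h - 1) • β` gives a Galois conjugate
of the Walsh transform at `β`. -/
theorem smul_mem_supp {m s : ℕ} {f : F → ZMod p} (hf : IsWRP p m s f) {z : ZMod p} (hz : z ≠ 0)
    {β : F} (hβ : β ∈ supp p m s f) : z • β ∈ supp p m s f := by
  obtain ⟨h, hh, -, hgcd, hhom⟩ := hf.homogeneous
  obtain ⟨k, rfl⟩ : ∃ k, h = k + 1 := ⟨h - 1, by omega⟩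
  rw [Nat.add_sub_cancel] at hgcd
  obtain ⟨w, hw, rfl⟩ := exists_pow_eq_of_coprime hgcd z hz
  have hpl := hf.weaklyRegular.1
  rw [mem_supp_iff_walsh_ne_zero hpl] at hβ ⊢
  rw [walsh_smul w hw (hhom w hw)]
  intro h0
  apply hβ
  have hv : w ^ (k + 1) ≠ 0 := pow_ne_zero _ hw
  have h1 := mul_card_fiber_eq_of_sum_eq univ
    (fun x => w ^ (k + 1) * (f x - Algebra.trace (ZMod p) F (β * x))) 0 0 (by simpa using h0)
  have h2 : ∀ j, #{x : F | f x - Algebra.trace (ZMod p) F (β * x) = j}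
      = #{x : F | w ^ (k + 1) * (f x - Algebra.trace (ZMod p) F (β * x)) = w ^ (k + 1) * j} := by
    intro j
    congr 1
    ext x
    simp [hw]
  have hp0 : (p : ℤ) ≠ 0 := by exact_mod_cast (Fact.out : p.Prime).ne_zero
  have h3 : ∀ j, (#{x : F | f x - Algebra.trace (ZMod p) F (β * x) = j} : ℤ)
      = #{x : F | f x - Algebra.trace (ZMod p) F (β * x) = 0} := by
    intro j
    apply mul_left_cancel₀ hp0
    rw [h2 j, h2 0, h1, h1]
    simp
  rw [walsh, sum_stdAddChar_comp univ (fun x => f x - Algebra.trace (ZMod p) F (β * x))]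
  rw [Finset.sum_congr rfl (fun j _ => by rw [h3 j]), ← Finset.mul_sum]
  rw [AddChar.sum_eq_zero_of_ne_one, mul_zero]
  intro h4
  have h5 := stdAddChar_one_isPrimitiveRoot (p := p)
  rw [h4] at h5
  exact h5.ne_one (Fact.out : p.Prime).one_lt rfl

theorem smul_mem_supp_iff {m s : ℕ} {f : F → ZMod p} (hf : IsWRP p m s f) {z : ZMod p} (hz : z ≠ 0)
    {β : F} : z • β ∈ supp p m s f ↔ β ∈ supp p m s f := by
  refine ⟨fun h => ?_, smul_mem_supp hf hz⟩
  have := smul_mem_supp hf (inv_ne_zero hz) h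
  rwa [smul_smul, inv_mul_cancel₀ hz, one_smul] at this

theorem zero_mem_supp {m s : ℕ} {f : F → ZMod p} (hf : IsWRP p m s f) :
    (0 : F) ∈ supp p m s f :=
  (mem_supp_iff_walsh_ne_zero hf.weaklyRegular.1).2 hf.unbalanced

theorem sub_one_dvd_pow_sub_one (n k : ℕ) : ((n : ℤ) - 1) ∣ (n : ℤ) ^ k - 1 := by
  simpa using sub_dvd_pow_sub_pow (n : ℤ) 1 k

/-- The number of zeros of the dual function in the Walsh support is `1` modulo `p - 1`, while
the nonzero ones come in punctured lines; so `0` is among them. -/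
theorem dual_zero (hp4 : p % 4 = 1) {m s : ℕ} (hF : Fintype.card F = p ^ m)
    {f : F → ZMod p} (hf : IsWRP p m s f) {l : ℕ} (hl : IsIndex p m s f l) :
    dual p m s f 0 = 0 := by
  classical
  by_contra h0
  have hp : p.Prime := Fact.out
  have hp5 : 5 ≤ p := by have := hp.two_le; omega
  have h1 : p - 1 ∣ dualCount p m s f 0 := by
    rw [dualCount_eq]
    refine sub_one_dvd_card_of_smul_mem (p := p) _ (by simp [h0]) ?_
    intro z hz x hx
    rw [Finset.mem_filter] at hx ⊢
    refine ⟨smul_mem_supp hf hz hx.1, ?_⟩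
    rw [hl.2.2.2 z hz x (mem_supp.1 hx.1), hx.2, mul_zero]
  have h2 : ((p : ℤ) - 1) ∣ dualCount p m s f 0 := by
    have := Int.natCast_dvd_natCast.2 h1
    rwa [Nat.cast_sub hp.one_le, Nat.cast_one] at this
  have h3 : ((p : ℤ) - 1) ∣ p * dualCount p m s f 0 - 1 := by
    rcases Nat.even_or_odd' (m - s) with ⟨k, hk | hk⟩
    · rw [mul_dualCount_of_even hp4 hF hf hk, if_pos rfl]
      have e : (p : ℤ) ^ (2 * k) - sign p m s f * p ^ k + p * (sign p m s f * p ^ k) - 1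
          = (p ^ (2 * k) - 1) + (p - 1) * (sign p m s f * p ^ k) := by ring
      rw [e]
      exact dvd_add (sub_one_dvd_pow_sub_one _ _) (Dvd.intro _ rfl)
    · rw [mul_dualCount_of_odd hp4 hF hf hk]
      simpa using sub_one_dvd_pow_sub_one p (2 * k + 1)
  have h4 : ((p : ℤ) - 1) ∣ 1 := by
    have := dvd_sub (h2.mul_left p) h3
    simpa using this
  have := Int.le_of_dvd one_pos h4
  omega

end Scaling

/-! ### Weights of codewords as numbers of scalars -/

section Weights

theorem card_univ_prod_self {α : Type*} [Fintype α] {p m : ℕ} (hF : Fintype.card α = p ^ m) :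
    #(univ : Finset (α × α)) = p ^ (2 * m) := by
  rw [Finset.card_univ, Fintype.card_prod, hF, ← pow_add, two_mul]

variable {p : ℕ} [Fact p.Prime] {F : Type*} [Field F] [Fintype F] [Algebra (ZMod p) F]

theorem sum_stdAddChar_pair (f g : F → ZMod p) (w : ZMod p) (a b : F) :
    ∑ x : F × F, ZMod.stdAddChar (f x.1 + g x.2
      - w * Algebra.trace (ZMod p) F (a * x.1 + b * x.2))
      = walsh p f (w • a) * walsh p g (w • b) := by
  rw [walsh, walsh, Finset.sum_mul_sum, Fintype.sum_prod_type]
  refine Finset.sum_congr rfl fun x _ => Finset.sum_congr rfl fun y _ => ?_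
  rw [← AddChar.map_add_eq_mul, smul_mul_assoc, smul_mul_assoc, map_smul, map_smul, map_add,
    smul_eq_mul, smul_eq_mul]
  congr 1
  ring

theorem walsh_mul_walsh (hp4 : p % 4 = 1) {m s t r : ℕ} (hr : s + t = 2 * r) {f g : F → ZMod p}
    (hf : IsWRP p m s f) (hg : IsWRP p m t g) {a b : F} (ha : a ∈ supp p m s f)
    (hb : b ∈ supp p m t g) :
    walsh p f a * walsh p g b = ((sign p m s f * sign p m t g * p ^ (m + r) : ℤ) : ℂ)
      * ZMod.stdAddChar (dual p m s f a + dual p m t g b) := by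
  have h := sqrt_pow_two_mul p (m + r)
  rw [show 2 * (m + r) = (m + s) + (m + t) by omega, pow_add] at h
  rw [(isSignDual_sign_dual hp4 hf).2.1 a (mem_supp.1 ha),
    (isSignDual_sign_dual hp4 hg).2.1 b (mem_supp.1 hb), AddChar.map_add_eq_mul, Int.cast_mul,
    ← h]
  push_cast
  ring

/-- The number of solutions of `f x₁ + g x₂ = w Tr (a x₁ + b x₂)` when `(w a, w b)` lies in the
product of the Walsh supports. -/
theorem mul_card_level_of_mem (hp4 : p % 4 = 1) {m s t r : ℕ} (hF : Fintype.card F = p ^ m)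
    (hr : s + t = 2 * r) {f g : F → ZMod p}
    (hf : IsWRP p m s f) (hg : IsWRP p m t g) (w : ZMod p) {a b : F} (ha : w • a ∈ supp p m s f)
    (hb : w • b ∈ supp p m t g) :
    (p : ℤ) * #{x : F × F | f x.1 + g x.2
      - w * Algebra.trace (ZMod p) F (a * x.1 + b * x.2) = 0}
      = p ^ (2 * m) - sign p m s f * sign p m t g * p ^ (m + r)
        + if 0 = dual p m s f (w • a) + dual p m t g (w • b) then
            p * (sign p m s f * sign p m t g * p ^ (m + r)) else 0 := by
  rw [mul_card_fiber_eq_of_sum_eq univ _ _ _ ((sum_stdAddChar_pair f g w a b).trans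
    (walsh_mul_walsh hp4 hr hf hg ha hb)) 0, card_univ_prod_self hF]
  push_cast
  rfl

theorem mul_card_level_of_not_mem {m s t : ℕ} (hF : Fintype.card F = p ^ m) {f g : F → ZMod p}
    (hf : IsWRP p m s f) (hg : IsWRP p m t g) (w : ZMod p) {a b : F}
    (hab : ¬ (w • a ∈ supp p m s f ∧ w • b ∈ supp p m t g)) :
    (p : ℤ) * #{x : F × F | f x.1 + g x.2
      - w * Algebra.trace (ZMod p) F (a * x.1 + b * x.2) = 0} = p ^ (2 * m) := by
  have h : walsh p f (w • a) * walsh p g (w • b)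
      = ((0 : ℤ) : ℂ) * ZMod.stdAddChar (0 : ZMod p) := by
    rw [mem_supp_iff_walsh_ne_zero hf.weaklyRegular.1,
      mem_supp_iff_walsh_ne_zero hg.weaklyRegular.1] at hab
    have : walsh p f (w • a) * walsh p g (w • b) = 0 := by
      by_contra h
      exact hab ⟨left_ne_zero_of_mul h, right_ne_zero_of_mul h⟩
    simp [this]
  rw [mul_card_fiber_eq_of_sum_eq univ _ _ _ ((sum_stdAddChar_pair f g w a b).trans h) 0,
    card_univ_prod_self hF]
  simp

theorem mul_card_trace_eq_zero {m : ℕ} (hF : Fintype.card F = p ^ m) {a b : F}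
    (hab : (a, b) ≠ (0, 0)) :
    (p : ℤ) * #{x : F × F | Algebra.trace (ZMod p) F (a * x.1 + b * x.2) = 0} = p ^ (2 * m) := by
  classical
  have h : ∑ x : F × F, ZMod.stdAddChar (Algebra.trace (ZMod p) F (a * x.1 + b * x.2))
      = ((0 : ℤ) : ℂ) * ZMod.stdAddChar (0 : ZMod p) := by
    simp only [map_add, AddChar.map_add_eq_mul]
    rw [Fintype.sum_prod_type]
    simp only [← Finset.mul_sum]
    rw [← Finset.sum_mul]
    have ha : ∀ c : F, ∑ x, ZMod.stdAddChar (Algebra.trace (ZMod p) F (c * x))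
        = if c = 0 then (Fintype.card F : ℂ) else 0 := by
      intro c
      rw [← sum_traceChar_mul (p := p)]
      refine Finset.sum_congr rfl fun x _ => ?_
      rw [traceChar_apply, mul_comm]
    rw [ha, ha]
    have : a ≠ 0 ∨ b ≠ 0 := by
      by_contra! h
      exact hab (by rw [h.1, h.2])
    rcases this with h | h <;> simp [h]
  rw [mul_card_fiber_eq_of_sum_eq univ _ _ _ h 0, card_univ_prod_self hF]
  simp

/-- Counting the pairs `(w, x)` with `f x₁ + g x₂ = w Tr (a x₁ + b x₂)` in two ways. -/
theorem sum_card_level (f g : F → ZMod p) (a b : F) :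
    (∑ w : ZMod p, #{x : F × F | f x.1 + g x.2
      - w * Algebra.trace (ZMod p) F (a * x.1 + b * x.2) = 0})
      + #{x : F × F | Algebra.trace (ZMod p) F (a * x.1 + b * x.2) = 0}
    = Fintype.card (F × F) + p * #{x : F × F | f x.1 + g x.2 = 0 ∧
        Algebra.trace (ZMod p) F (a * x.1 + b * x.2) = 0} := by
  classical
  have h : ∀ x : F × F, (∑ w : ZMod p, if f x.1 + g x.2
      - w * Algebra.trace (ZMod p) F (a * x.1 + b * x.2) = 0 then 1 else 0)
      + (if Algebra.trace (ZMod p) F (a * x.1 + b * x.2) = 0 then 1 else 0)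
      = 1 + p * (if f x.1 + g x.2 = 0 ∧
        Algebra.trace (ZMod p) F (a * x.1 + b * x.2) = 0 then 1 else 0) := by
    intro x
    generalize Algebra.trace (ZMod p) F (a * x.1 + b * x.2) = T
    generalize f x.1 + g x.2 = y
    by_cases hT : T = 0
    · by_cases hy : y = 0 <;> simp [hT, hy, ZMod.card]
      ring
    · have : ∀ w : ZMod p, (y - w * T = 0) ↔ (w = y / T) := by
        intro w
        rw [sub_eq_zero, eq_div_iff hT, eq_comm]
      simp [hT, this]
  have h2 := Finset.sum_congr (rfl : (univ : Finset (F × F)) = univ) (fun x _ => h x)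
  rw [Finset.sum_add_distrib, Finset.sum_comm, Finset.sum_add_distrib, ← Finset.mul_sum] at h2
  simp only [Finset.card_filter]
  simpa using h2

/-- The number of nonzero `w` with `w ^ k * A + w ^ l * B = 0`. For `A = f^⋆ a`, `B = g^⋆ b` it
determines the weight of the codeword `c(a, b)`. -/
def scalarCount (k l : ℕ) (A B : ZMod p) : ℕ :=
  #{w : ZMod p | w ≠ 0 ∧ w ^ k * A + w ^ l * B = 0}

theorem mul_card_zeros (hp4 : p % 4 = 1) {m s t r : ℕ} (hF : Fintype.card F = p ^ m)
    (hr : s + t = 2 * r) {f g : F → ZMod p} (hf : IsWRP p m s f) (hg : IsWRP p m t g)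
    (hf0 : dual p m s f 0 = 0) (hg0 : dual p m t g 0 = 0) :
    (p : ℤ) * #{x : F × F | f x.1 + g x.2 = 0}
      = p ^ (2 * m) + (p - 1) * (sign p m s f * sign p m t g * p ^ (m + r)) := by
  have h := mul_card_level_of_mem hp4 hF hr hf hg 0 (a := 0) (b := 0)
    (by simpa using zero_mem_supp hf) (by simpa using zero_mem_supp hg)
  simp only [zero_mul, sub_zero, smul_zero, hf0, hg0, add_zero, if_true] at h
  rw [h]
  ring

variable [DecidableEq F]

theorem card_definingSet_add_one {p : ℕ} [Fact p.Prime] {K : Type*} [Field K] [Fintype K]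
    [DecidableEq K] {f g : K → ZMod p} (hf : f 0 = 0) (hg : g 0 = 0) :
    (definingSet p f g).card + 1 = #{x : K × K | f x.1 + g x.2 = 0} := by
  have h : (univ.filter fun x : K × K => f x.1 + g x.2 = 0)
      = insert (0, 0) (definingSet p f g) := by
    ext x
    simp only [definingSet, Finset.mem_filter, Finset.mem_univ, true_and, Finset.mem_insert]
    constructor
    · intro h
      by_cases hx : x = (0, 0)
      · exact Or.inl hx
      · exact Or.inr ⟨hx, h⟩
    · rintro (rfl | h)
      · simp [hf, hg]
      · exact h.2
  rw [h, Finset.card_insert_of_notMem (by simp [definingSet])]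

theorem hammingNorm_encode_add (f g : F → ZMod p) (a b : F) :
    hammingNorm (encode p f g (a, b)) + #{x : F × F | f x.1 + g x.2 = 0 ∧
        Algebra.trace (ZMod p) F (a * x.1 + b * x.2) = 0}
      = #{x : F × F | f x.1 + g x.2 = 0} := by
  have h : hammingNorm (encode p f g (a, b)) = #{x : F × F | f x.1 + g x.2 = 0 ∧
      ¬ Algebra.trace (ZMod p) F (a * x.1 + b * x.2) = 0} := by
    rw [hammingNorm]
    refine Finset.card_bij (fun x _ => x.1) ?_ ?_ ?_
    · intro x hx
      have h1 := (Finset.mem_filter.1 x.2).2.2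
      have h2 := (Finset.mem_filter.1 hx).2
      exact Finset.mem_filter.2 ⟨Finset.mem_univ _, h1, h2⟩
    · intro x _ y _ h
      exact Subtype.ext h
    · intro x hx
      obtain ⟨-, h1, h2⟩ := Finset.mem_filter.1 hx
      have hx0 : x ≠ (0, 0) := by
        rintro rfl
        simp at h2
      exact ⟨⟨x, Finset.mem_filter.2 ⟨Finset.mem_univ _, hx0, h1⟩⟩,
        Finset.mem_filter.2 ⟨Finset.mem_univ _, h2⟩, rfl⟩
  rw [h, add_comm, ← Finset.filter_filter, ← Finset.filter_filter]
  exact Finset.card_filter_add_card_filter_not _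

/-- The relation between the weight of `c(a, b)` and the level sets of `sum_card_level`. -/
theorem sq_mul_hammingNorm {m s t r : ℕ} (hp4 : p % 4 = 1) (hF : Fintype.card F = p ^ m)
    (hr : s + t = 2 * r) {f g : F → ZMod p} (hf : IsWRP p m s f) (hg : IsWRP p m t g)
    (hf0 : dual p m s f 0 = 0) (hg0 : dual p m t g 0 = 0) {a b : F} (hab : (a, b) ≠ (0, 0))
    (c : ℤ) (hc : ∑ w ∈ univ.erase (0 : ZMod p), (p : ℤ) * #{x : F × F | f x.1 + g x.2
      - w * Algebra.trace (ZMod p) F (a * x.1 + b * x.2) = 0} = (p - 1) * p ^ (2 * m) + c) :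
    (p : ℤ) ^ 2 * hammingNorm (encode p f g (a, b)) = (p - 1) * p ^ (2 * m)
      + (p - 1) * ((p - 1) * (sign p m s f * sign p m t g * p ^ (m + r))) - c := by
  have h1 := congrArg (Nat.cast (R := ℤ)) (hammingNorm_encode_add f g a b)
  have h2 := congrArg (Nat.cast (R := ℤ)) (sum_card_level f g a b)
  have h3 := mul_card_trace_eq_zero (p := p) hF hab
  have h4 := mul_card_zeros hp4 hF hr hf hg hf0 hg0
  rw [← Finset.card_univ (α := F × F), card_univ_prod_self hF] at h2
  push_cast at h1 h2
  rw [← Finset.add_sum_erase _ _ (Finset.mem_univ (0 : ZMod p))] at h2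
  simp only [zero_mul, sub_zero] at h2
  rw [← Finset.mul_sum] at hc
  linear_combination (p : ℤ) ^ 2 * h1 + (p : ℤ) * h2 - hc - h3 + ((p : ℤ) - 1) * h4

theorem sq_mul_hammingNorm_of_not_mem (hp4 : p % 4 = 1) {m s t r : ℕ}
    (hF : Fintype.card F = p ^ m)
    (hr : s + t = 2 * r) {f g : F → ZMod p} (hf : IsWRP p m s f) (hg : IsWRP p m t g)
    (hf0 : dual p m s f 0 = 0) (hg0 : dual p m t g 0 = 0) {a b : F}
    (hab : ¬ (a ∈ supp p m s f ∧ b ∈ supp p m t g)) :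
    (p : ℤ) ^ 2 * hammingNorm (encode p f g (a, b)) = (p - 1) * p ^ (2 * m)
      + (p - 1) * ((p - 1) * (sign p m s f * sign p m t g * p ^ (m + r))) := by
  have hab0 : (a, b) ≠ (0, 0) := by
    intro h
    obtain ⟨rfl, rfl⟩ := Prod.mk.inj h
    exact hab ⟨zero_mem_supp hf, zero_mem_supp hg⟩
  rw [sq_mul_hammingNorm hp4 hF hr hf hg hf0 hg0 hab0 0, sub_zero]
  rw [Finset.sum_congr rfl (fun w hw => mul_card_level_of_not_mem hF hf hg w (by
    have hw0 := Finset.ne_of_mem_erase hw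
    rwa [smul_mem_supp_iff hf hw0, smul_mem_supp_iff hg hw0])), Finset.sum_const,
    Finset.card_erase_of_mem (Finset.mem_univ _), Finset.card_univ, ZMod.card, nsmul_eq_mul,
    Nat.cast_sub (Fact.out : p.Prime).one_le]
  simp

theorem sq_mul_hammingNorm_of_mem (hp4 : p % 4 = 1) {m s t r : ℕ} (hF : Fintype.card F = p ^ m)
    (hr : s + t = 2 * r) {f g : F → ZMod p} (hf : IsWRP p m s f) (hg : IsWRP p m t g)
    (hf0 : dual p m s f 0 = 0) (hg0 : dual p m t g 0 = 0) {k l : ℕ} (hk : IsIndex p m s f k)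
    (hl : IsIndex p m t g l) {a b : F} (ha : a ∈ supp p m s f) (hb : b ∈ supp p m t g)
    (hab : (a, b) ≠ (0, 0)) :
    (p : ℤ) ^ 2 * hammingNorm (encode p f g (a, b)) = (p - 1) * p ^ (2 * m)
      + p * (sign p m s f * sign p m t g * p ^ (m + r))
        * (p - 1 - scalarCount k l (dual p m s f a) (dual p m t g b)) := by
  set P := sign p m s f * sign p m t g * (p : ℤ) ^ (m + r) with hP
  have hw : ∀ w ∈ univ.erase (0 : ZMod p), (p : ℤ) * #{x : F × F | f x.1 + g x.2
      - w * Algebra.trace (ZMod p) F (a * x.1 + b * x.2) = 0} = p ^ (2 * m) - P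
        + p * P * if w ^ k * dual p m s f a + w ^ l * dual p m t g b = 0 then 1 else 0 := by
    intro w hw
    have hw0 := Finset.ne_of_mem_erase hw
    rw [mul_card_level_of_mem hp4 hF hr hf hg w (smul_mem_supp hf hw0 ha) (smul_mem_supp hg hw0 hb),
      hk.2.2.2 w hw0 a (mem_supp.1 ha), hl.2.2.2 w hw0 b (mem_supp.1 hb)]
    simp only [eq_comm (a := (0 : ZMod p)), mul_ite, mul_one, mul_zero]
    rfl
  have hcount : ∑ w ∈ univ.erase (0 : ZMod p),
      (if w ^ k * dual p m s f a + w ^ l * dual p m t g b = 0 then (1 : ℤ) else 0)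
        = scalarCount k l (dual p m s f a) (dual p m t g b) := by
    rw [scalarCount, Finset.sum_boole]
    congr 2
    ext w
    simp
  rw [sq_mul_hammingNorm hp4 hF hr hf hg hf0 hg0 hab
    (p * P * scalarCount k l (dual p m s f a) (dual p m t g b) - (p - 1) * P), ← hP]
  · ring
  · rw [Finset.sum_congr rfl hw, Finset.sum_add_distrib, ← Finset.mul_sum, hcount, Finset.sum_const,
      Finset.card_erase_of_mem (Finset.mem_univ _), Finset.card_univ, ZMod.card, nsmul_eq_mul,
      Nat.cast_sub (Fact.out : p.Prime).one_le]
    push_cast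
    ring

end Weights

/-! ### The number of scalars for the four pairs of indices -/

section ScalarCount

variable {p : ℕ} [Fact p.Prime]

theorem pow_half_eq_one_or_neg_one (hp4 : p % 4 = 1) {w : ZMod p} (hw : w ≠ 0) :
    w ^ ((p - 1) / 2) = 1 ∨ w ^ ((p - 1) / 2) = -1 := by
  have := ZMod.pow_div_two_eq_neg_one_or_one p hw
  rwa [show p / 2 = (p - 1) / 2 by omega] at this

theorem isSquare_iff_pow_half (hp4 : p % 4 = 1) {w : ZMod p} (hw : w ≠ 0) :
    IsSquare w ↔ w ^ ((p - 1) / 2) = 1 := by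
  have := ZMod.euler_criterion p hw
  rwa [show p / 2 = (p - 1) / 2 by omega] at this

theorem neg_one_ne_one (hp4 : p % 4 = 1) : (-1 : ZMod p) ≠ 1 := by
  have : Fact (2 < p) := ⟨by have := (Fact.out : p.Prime).two_le; omega⟩
  exact ZMod.neg_one_ne_one

theorem two_ne_zero_of_mod_four (hp4 : p % 4 = 1) : (2 : ZMod p) ≠ 0 := by
  intro h
  apply neg_one_ne_one hp4
  linear_combination -h

theorem neg_ne_self (hp4 : p % 4 = 1) {c : ZMod p} (hc : c ≠ 0) : -c ≠ c := by
  intro h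
  have h2 : 2 * c = 0 := by linear_combination -h
  rcases mul_eq_zero.1 h2 with h3 | h3
  · exact two_ne_zero_of_mod_four hp4 h3
  · exact hc h3

theorem isSquare_neg_one (hp4 : p % 4 = 1) : IsSquare (-1 : ZMod p) :=
  ZMod.exists_sq_eq_neg_one_iff.2 (by omega)

theorem card_pow_half_eq (hp4 : p % 4 = 1) {c : ZMod p} (hc : c = 1 ∨ c = -1) :
    #{w : ZMod p | w ≠ 0 ∧ w ^ ((p - 1) / 2) = c} = (p - 1) / 2 := by
  have hp : p.Prime := Fact.out
  have hn : 0 < (p - 1) / 2 := by have := hp.two_le; omega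
  have hle : ∀ c : ZMod p, #{w : ZMod p | w ≠ 0 ∧ w ^ ((p - 1) / 2) = c} ≤ (p - 1) / 2 := by
    intro c
    refine le_trans (Finset.card_le_card (t := (Polynomial.nthRoots ((p - 1) / 2) c).toFinset) ?_)
      ((Multiset.toFinset_card_le _).trans (Polynomial.card_nthRoots _ c))
    intro w hw
    rw [Multiset.mem_toFinset, Polynomial.mem_nthRoots hn]
    exact (Finset.mem_filter.1 hw).2.2
  have hsum : #{w : ZMod p | w ≠ 0 ∧ w ^ ((p - 1) / 2) = 1}
      + #{w : ZMod p | w ≠ 0 ∧ w ^ ((p - 1) / 2) = -1} = p - 1 := by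
    rw [← Finset.card_union_of_disjoint]
    · have : (univ.filter fun w : ZMod p => w ≠ 0 ∧ w ^ ((p - 1) / 2) = 1)
          ∪ (univ.filter fun w : ZMod p => w ≠ 0 ∧ w ^ ((p - 1) / 2) = -1) = univ.erase 0 := by
        ext w
        have := @pow_half_eq_one_or_neg_one p _ hp4 w
        simp only [Finset.mem_union, Finset.mem_filter, Finset.mem_univ, true_and,
          Finset.mem_erase, and_true]
        tauto
      rw [this, Finset.card_erase_of_mem (Finset.mem_univ _), Finset.card_univ, ZMod.card]
    · rw [Finset.disjoint_filter]
      rintro w - ⟨-, h1⟩ ⟨-, h2⟩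
      exact neg_one_ne_one hp4 (h2.symm.trans h1)
  have h1 := hle 1
  have h2 := hle (-1)
  rcases hc with rfl | rfl <;> omega

theorem card_sq_eq (hp4 : p % 4 = 1) {c : ZMod p} (hc : c ≠ 0) (hsq : IsSquare c) :
    #{w : ZMod p | w ^ 2 = c} = 2 := by
  obtain ⟨v, rfl⟩ := hsq
  have hv : v ≠ 0 := left_ne_zero_of_mul hc
  rw [show (univ.filter fun w : ZMod p => w ^ 2 = v * v) = {v, -v} by
    ext w
    simp [← pow_two, sq_eq_sq_iff_eq_or_eq_neg]]
  exact Finset.card_pair (neg_ne_self hp4 hv).symm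

theorem card_ne_zero : #{w : ZMod p | w ≠ 0} = p - 1 := by
  rw [Finset.filter_ne', Finset.card_erase_of_mem (Finset.mem_univ _), Finset.card_univ, ZMod.card]

theorem scalarCount_zero_zero (k l : ℕ) : scalarCount k l (0 : ZMod p) 0 = p - 1 := by
  simp [scalarCount, card_ne_zero]

theorem scalarCount_eq_zero_of_left {k l : ℕ} {B : ZMod p} (hB : B ≠ 0) :
    scalarCount k l (0 : ZMod p) B = 0 := by
  rw [scalarCount, Finset.card_eq_zero, Finset.filter_eq_empty_iff]
  rintro w - ⟨hw, h⟩
  simp [hB, hw] at h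

theorem scalarCount_eq_zero_of_right {k l : ℕ} {A : ZMod p} (hA : A ≠ 0) :
    scalarCount k l A (0 : ZMod p) = 0 := by
  rw [scalarCount, Finset.card_eq_zero, Finset.filter_eq_empty_iff]
  rintro w - ⟨hw, h⟩
  simp [hA, hw] at h

theorem scalarCount_self {k : ℕ} {A B : ZMod p} :
    scalarCount k k A B = if A + B = 0 then p - 1 else 0 := by
  have h : ∀ w : ZMod p, (w ≠ 0 ∧ w ^ k * A + w ^ k * B = 0) ↔ (w ≠ 0 ∧ A + B = 0) := by
    intro w
    refine and_congr_right fun hw => ?_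
    rw [← mul_add, mul_eq_zero, or_iff_right (pow_ne_zero _ hw)]
  simp only [scalarCount, h]
  split_ifs with hAB
  · simp [hAB, card_ne_zero]
  · simp [hAB]

theorem scalarCount_sub_one_half (hp4 : p % 4 = 1) {A B : ZMod p} (hA : A ≠ 0) :
    scalarCount (p - 1) ((p - 1) / 2) A B = if B = A ∨ B = -A then (p - 1) / 2 else 0 := by
  have h : ∀ w : ZMod p, (w ≠ 0 ∧ w ^ (p - 1) * A + w ^ ((p - 1) / 2) * B = 0)
      ↔ (w ≠ 0 ∧ A + w ^ ((p - 1) / 2) * B = 0) := by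
    intro w
    refine and_congr_right fun hw => ?_
    rw [ZMod.pow_card_sub_one_eq_one hw, one_mul]
  simp only [scalarCount, h]
  split_ifs with hAB
  · rcases hAB with rfl | rfl
    · refine Eq.trans (congrArg Finset.card ?_) (card_pow_half_eq hp4 (Or.inr rfl))
      ext w
      simp only [Finset.mem_filter, Finset.mem_univ, true_and]
      refine and_congr_right fun hw => ?_
      constructor
      · intro h
        apply mul_right_cancel₀ hA
        linear_combination h
      · intro h
        rw [h]
        ring
    · refine Eq.trans (congrArg Finset.card ?_) (card_pow_half_eq hp4 (Or.inl rfl))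
      ext w
      simp only [Finset.mem_filter, Finset.mem_univ, true_and]
      refine and_congr_right fun hw => ?_
      constructor
      · intro h
        apply mul_right_cancel₀ hA
        linear_combination -h
      · intro h
        rw [h]
        ring
  · rw [Finset.card_eq_zero, Finset.filter_eq_empty_iff]
    rintro w - ⟨hw, h⟩
    apply hAB
    rcases pow_half_eq_one_or_neg_one hp4 hw with h1 | h1 <;> rw [h1] at h
    · right
      linear_combination h
    · left
      linear_combination -h

theorem scalarCount_two_half_eq_zero (hp4 : p % 4 = 1) {A B : ZMod p}
    (hAB : ¬ IsSquare (A * B)) : scalarCount 2 ((p - 1) / 2) A B = 0 := by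
  rw [scalarCount, Finset.card_eq_zero, Finset.filter_eq_empty_iff]
  rintro w - ⟨hw, h⟩
  apply hAB
  obtain ⟨i, hi⟩ := isSquare_neg_one hp4
  rcases pow_half_eq_one_or_neg_one hp4 hw with h1 | h1 <;> rw [h1] at h
  · exact ⟨i * w * A, by linear_combination A * h + (w * A) ^ 2 * hi⟩
  · exact ⟨w * A, by linear_combination -A * h⟩

/-- The two equations `w ^ 2 * A = w ^ ((p - 1) / 2) * (± B)` together say that
`w ^ 2 = B / A` or `w ^ 2 = -B / A`. -/
theorem scalarCount_add_scalarCount_neg (hp4 : p % 4 = 1) {A B : ZMod p} (hAB0 : A * B ≠ 0)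
    (hAB : IsSquare (A * B)) :
    scalarCount 2 ((p - 1) / 2) A B + scalarCount 2 ((p - 1) / 2) A (-B) = 4 := by
  have hA := left_ne_zero_of_mul hAB0
  have hB := right_ne_zero_of_mul hAB0
  have hc : B / A ≠ 0 := div_ne_zero hB hA
  have hsq : IsSquare (B / A) := by
    have : B / A = A * B / (A * A) := by field_simp
    rw [this]
    exact hAB.div ⟨A, rfl⟩
  have h1 := card_sq_eq hp4 hc hsq
  have h2 : #{w : ZMod p | w ^ 2 = -(B / A)} = 2 := by
    refine card_sq_eq hp4 (neg_ne_zero.2 hc) ?_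
    rw [← neg_one_mul]
    exact (isSquare_neg_one hp4).mul hsq
  have key : ∀ w : ZMod p, w ≠ 0 →
      ((w ^ 2 * A + w ^ ((p - 1) / 2) * B = 0 ∨ w ^ 2 * A + w ^ ((p - 1) / 2) * -B = 0)
        ↔ (w ^ 2 = B / A ∨ w ^ 2 = -(B / A))) := by
    intro w hw
    rw [eq_div_iff hA, ← neg_div, eq_div_iff hA]
    rcases pow_half_eq_one_or_neg_one hp4 hw with h1 | h1 <;> rw [h1]
    · constructor <;> rintro (h | h)
      · exact Or.inr (by linear_combination h)
      · exact Or.inl (by linear_combination h)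
      · exact Or.inr (by linear_combination h)
      · exact Or.inl (by linear_combination h)
    · constructor <;> rintro (h | h)
      · exact Or.inl (by linear_combination h)
      · exact Or.inr (by linear_combination h)
      · exact Or.inl (by linear_combination h)
      · exact Or.inr (by linear_combination h)
  rw [scalarCount, scalarCount, ← Finset.card_union_of_disjoint, ← Finset.filter_or]
  · have : (univ.filter fun w : ZMod p => (w ≠ 0 ∧ w ^ 2 * A + w ^ ((p - 1) / 2) * B = 0) ∨
        (w ≠ 0 ∧ w ^ 2 * A + w ^ ((p - 1) / 2) * -B = 0))
        = (univ.filter fun w : ZMod p => w ^ 2 = B / A ∨ w ^ 2 = -(B / A)) := by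
      ext w
      simp only [Finset.mem_filter, Finset.mem_univ, true_and]
      rw [← and_or_left]
      constructor
      · rintro ⟨hw, h⟩
        exact (key w hw).1 h
      · intro h
        have hw : w ≠ 0 := by
          rintro rfl
          rcases h with h | h
          · exact hc (by rw [← h]; ring)
          · exact hc (by linear_combination h)
        exact ⟨hw, (key w hw).2 h⟩
    rw [this, Finset.filter_or, Finset.card_union_of_disjoint, h1, h2]
    rw [Finset.disjoint_filter]
    intro w _ h3 h4
    exact neg_ne_self hp4 hc (h4.symm.trans h3)
  · rw [Finset.disjoint_filter]
    rintro w - ⟨hw, h3⟩ ⟨-, h4⟩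
    have : 2 * (w ^ 2 * A) = 0 := by linear_combination h3 + h4
    exact mul_ne_zero (two_ne_zero_of_mod_four hp4) (mul_ne_zero (pow_ne_zero _ hw) hA) this

theorem exists_sq_eq_neg_one_of_mod_eight_eq_one (h8 : p % 8 = 1) :
    ∃ i : ZMod p, i ^ 2 = -1 ∧ i ^ ((p - 1) / 2) = 1 := by
  obtain ⟨i, hi⟩ := isSquare_neg_one (p := p) (by omega)
  have hi2 : i ^ 2 = -1 := by rw [hi, pow_two]
  refine ⟨i, hi2, ?_⟩
  rw [show (p - 1) / 2 = 2 * (2 * ((p - 1) / 8)) by omega, pow_mul, hi2, pow_mul]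
  simp

theorem exists_sq_eq_neg_one_of_mod_eight_eq_five (h8 : p % 8 = 5) :
    ∃ i : ZMod p, i ^ 2 = -1 ∧ i ^ ((p - 1) / 2) = -1 := by
  obtain ⟨i, hi⟩ := isSquare_neg_one (p := p) (by omega)
  have hi2 : i ^ 2 = -1 := by rw [hi, pow_two]
  refine ⟨i, hi2, ?_⟩
  rw [show (p - 1) / 2 = 2 * (2 * ((p - 1) / 8) + 1) by omega, pow_mul, hi2, pow_succ, pow_mul]
  simp

/-- For `p ≡ 1 (mod 8)`, multiplication by a square root of `-1`, which is a square, exchanges the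
solutions for `B` and for `-B`. -/
theorem scalarCount_two_half_of_mod_eight_eq_one (h8 : p % 8 = 1) {A B : ZMod p}
    (hAB0 : A * B ≠ 0) (hAB : IsSquare (A * B)) : scalarCount 2 ((p - 1) / 2) A B = 2 := by
  have h := scalarCount_add_scalarCount_neg (by omega) hAB0 hAB
  obtain ⟨i, hi2, hin⟩ := exists_sq_eq_neg_one_of_mod_eight_eq_one h8
  have hi : i ≠ 0 := by
    rintro rfl
    rw [zero_pow two_ne_zero] at hi2
    exact one_ne_zero (neg_eq_zero.1 hi2.symm)
  have hle : ∀ B : ZMod p, scalarCount 2 ((p - 1) / 2) A B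
      ≤ scalarCount 2 ((p - 1) / 2) A (-B) := by
    intro B
    refine Finset.card_le_card_of_injOn (fun w => i * w) ?_ ?_
    · intro w hw
      obtain ⟨-, hw, h1⟩ := Finset.mem_filter.1 hw
      refine Finset.mem_coe.2 (Finset.mem_filter.2 ⟨Finset.mem_univ _, mul_ne_zero hi hw, ?_⟩)
      rw [mul_pow, mul_pow, hi2, hin]
      linear_combination -h1
    · intro w _ v _ h1
      exact mul_left_cancel₀ hi h1
  have h1 := hle B
  have h2 := hle (-B)
  rw [neg_neg] at h2
  omega

/-- For `p ≡ 5 (mod 8)`, a solution `w` comes with the solutions `-w` and `± i w`, `i ^ 2 = -1`,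
because `i` is not a square. -/
theorem scalarCount_two_half_of_mod_eight_eq_five (h8 : p % 8 = 5) {A B : ZMod p}
    (hAB0 : A * B ≠ 0) (hAB : IsSquare (A * B)) :
    scalarCount 2 ((p - 1) / 2) A B = 0 ∨ scalarCount 2 ((p - 1) / 2) A B = 4 := by
  have hp4 : p % 4 = 1 := by omega
  have h := scalarCount_add_scalarCount_neg hp4 hAB0 hAB
  obtain ⟨i, hi2, hin⟩ := exists_sq_eq_neg_one_of_mod_eight_eq_five h8
  have hi : i ≠ 0 := by
    rintro rfl
    rw [zero_pow two_ne_zero] at hi2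
    exact one_ne_zero (neg_eq_zero.1 hi2.symm)
  rcases Nat.eq_zero_or_pos (scalarCount 2 ((p - 1) / 2) A B) with h0 | h0
  · exact Or.inl h0
  right
  obtain ⟨w, hw⟩ := Finset.card_pos.1 h0
  obtain ⟨-, hw, h1⟩ := Finset.mem_filter.1 hw
  have hneg : ∀ v : ZMod p, (-v) ^ ((p - 1) / 2) = v ^ ((p - 1) / 2) := fun v =>
    Even.neg_pow ⟨(p - 1) / 4, by omega⟩ v
  have hii : i ≠ 1 := by
    rintro rfl
    rw [one_pow] at hi2
    exact neg_one_ne_one hp4 hi2.symm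
  have hii' : i ≠ -1 := by
    rintro rfl
    rw [neg_one_sq] at hi2
    exact neg_one_ne_one hp4 hi2.symm
  have hsub : ({w, -w, i * w, -(i * w)} : Finset (ZMod p))
      ⊆ univ.filter fun w : ZMod p => w ≠ 0 ∧ w ^ 2 * A + w ^ ((p - 1) / 2) * B = 0 := by
    have h2 : (i * w) ^ 2 * A + (i * w) ^ ((p - 1) / 2) * B = 0 := by
      rw [mul_pow, mul_pow, hi2, hin]
      linear_combination -h1
    intro v hv
    simp only [Finset.mem_insert, Finset.mem_singleton] at hv
    rw [Finset.mem_filter]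
    refine ⟨Finset.mem_univ _, ?_⟩
    rcases hv with rfl | rfl | rfl | rfl
    · exact ⟨hw, h1⟩
    · exact ⟨neg_ne_zero.2 hw, by rwa [hneg, neg_sq]⟩
    · exact ⟨mul_ne_zero hi hw, h2⟩
    · exact ⟨neg_ne_zero.2 (mul_ne_zero hi hw), by rwa [hneg, neg_sq]⟩
  have hcard : #({w, -w, i * w, -(i * w)} : Finset (ZMod p)) = 4 := by
    have e1 : w ≠ -w := (neg_ne_self hp4 hw).symm
    have e2 : w ≠ i * w := fun h => hii (mul_right_cancel₀ hw (by rw [one_mul]; exact h.symm))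
    have e3 : w ≠ -(i * w) := fun h =>
      hii' (mul_right_cancel₀ hw (by linear_combination h))
    have e4 : -w ≠ i * w := fun h =>
      hii' (mul_right_cancel₀ hw (by linear_combination -h))
    have e5 : -w ≠ -(i * w) := fun h => e2 (neg_injective h)
    have e6 : i * w ≠ -(i * w) := (neg_ne_self hp4 (mul_ne_zero hi hw)).symm
    rw [Finset.card_insert_of_notMem (by simp [e1, e2, e3]),
      Finset.card_insert_of_notMem (by simp [e4, e5]), Finset.card_pair e6]
  have h4 := Finset.card_le_card hsub
  rw [hcard] at h4
  have h5 : 4 ≤ scalarCount 2 ((p - 1) / 2) A B := h4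
  omega

/-- Replacing `A` by `z ^ 2 A` with a nonsquare `z` has the same effect as replacing `B` by `-B`. -/
theorem scalarCount_sq_mul {A B z : ZMod p} (hz : z ≠ 0) (hzn : z ^ ((p - 1) / 2) = -1) :
    scalarCount 2 ((p - 1) / 2) (z ^ 2 * A) B = scalarCount 2 ((p - 1) / 2) A (-B) := by
  refine Finset.card_bij (fun w _ => z * w) ?_ ?_ ?_
  · intro w hw
    obtain ⟨-, hw, h1⟩ := Finset.mem_filter.1 hw
    refine Finset.mem_filter.2 ⟨Finset.mem_univ _, mul_ne_zero hz hw, ?_⟩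
    rw [mul_pow, mul_pow, hzn]
    linear_combination h1
  · intro w _ v _ h1
    exact mul_left_cancel₀ hz h1
  · intro v hv
    obtain ⟨-, hv, h1⟩ := Finset.mem_filter.1 hv
    have e : z * (v / z) = v := mul_div_cancel₀ v hz
    refine ⟨v / z, Finset.mem_filter.2 ⟨Finset.mem_univ _, div_ne_zero hv hz, ?_⟩, e⟩
    rw [← e, mul_pow z, mul_pow z, hzn] at h1
    linear_combination h1

end ScalarCount

/-! ### Weight tables -/

section WeightTables

variable {p : ℕ} {ι : Type*} [Fintype ι] {α : Type*} [Fintype α]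

theorem weightCount_eq_card {C : Submodule (ZMod p) (ι → ZMod p)} {enc : α → ι → ZMod p}
    (hinj : Function.Injective enc) (hC : ∀ c, c ∈ C ↔ ∃ x, enc x = c) (w : ℕ) :
    weightCount C w = #{x | hammingNorm (enc x) = w} := by
  have : {c : ι → ZMod p | c ∈ C ∧ hammingNorm c = w}
      = enc '' ((univ.filter fun x => hammingNorm (enc x) = w : Finset α) : Set α) := by
    ext c
    simp only [Set.mem_ofPred_eq, hC, Set.mem_image, Finset.mem_coe, Finset.mem_filter,
      Finset.mem_univ, true_and]
    constructor
    · rintro ⟨⟨x, rfl⟩, h⟩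
      exact ⟨x, h, rfl⟩
    · rintro ⟨x, h, rfl⟩
      exact ⟨⟨x, rfl⟩, h⟩
  rw [weightCount, this, Set.ncard_image_of_injective _ hinj, Set.ncard_coe_finset]

/-- The weight table of an injectively parametrized code whose weight is constant on the five
parts `{x₀}`, `Z \ {x₀}`, `M`, `Q \ (Z ∪ M)` and the complement of `Q` of the parameter set. -/
theorem hasWeightTable_of_partition [DecidableEq α] {C : Submodule (ZMod p) (ι → ZMod p)}
    {enc : α → ι → ZMod p}
    (hinj : Function.Injective enc) (hC : ∀ c, c ∈ C ↔ ∃ x, enc x = c)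
    {Q Z M : Finset α} {x₀ : α} (hx₀ : x₀ ∈ Z) (hZ : Z ⊆ Q) (hM : M ⊆ Q) (hZM : Disjoint Z M)
    {w₁ w₂ w₃ w₄ : ℝ} (h₀ : hammingNorm (enc x₀) = 0)
    (h₁ : ∀ x ∈ Z, x ≠ x₀ → (hammingNorm (enc x) : ℝ) = w₁)
    (h₂ : ∀ x ∈ M, (hammingNorm (enc x) : ℝ) = w₂)
    (h₃ : ∀ x ∈ Q, x ∉ Z → x ∉ M → (hammingNorm (enc x) : ℝ) = w₃)
    (h₄ : ∀ x, x ∉ Q → (hammingNorm (enc x) : ℝ) = w₄) :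
    HasWeightTable C [(0, 1), (w₁, (#Z : ℝ) - 1), (w₂, (#M : ℝ)), (w₃, (#Q : ℝ) - #Z - #M),
      (w₄, (Fintype.card α : ℝ) - #Q)] := by
  have hMQ : M ⊆ Q \ Z := fun x hx =>
    Finset.mem_sdiff.2 ⟨hM hx, fun h => Finset.disjoint_left.1 hZM h hx⟩
  have c₁ : (#(Z.erase x₀) : ℝ) = #Z - 1 := by
    rw [Finset.card_erase_of_mem hx₀, Nat.cast_sub (Finset.card_pos.2 ⟨x₀, hx₀⟩), Nat.cast_one]
  have c₃ : (#((Q \ Z) \ M) : ℝ) = #Q - #Z - #M := by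
    rw [Finset.cast_card_sdiff hMQ, Finset.cast_card_sdiff hZ]
  have c₄ : (#Qᶜ : ℝ) = Fintype.card α - #Q := by
    rw [Finset.card_compl, Nat.cast_sub (Finset.card_le_univ Q)]
  have h₁' : ∀ x ∈ Z.erase x₀, (hammingNorm (enc x) : ℝ) = w₁ := fun x hx =>
    h₁ x (Finset.mem_of_mem_erase hx) (Finset.ne_of_mem_erase hx)
  have h₃' : ∀ x ∈ (Q \ Z) \ M, (hammingNorm (enc x) : ℝ) = w₃ := fun x hx => by
    simp only [Finset.mem_sdiff] at hx
    exact h₃ x hx.1.1 hx.1.2 hx.2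
  have h₄' : ∀ x ∈ Qᶜ, (hammingNorm (enc x) : ℝ) = w₄ := fun x hx =>
    h₄ x (Finset.mem_compl.1 hx)
  rw [← c₁, ← c₃, ← c₄]
  constructor
  · have ne : ∀ (T : Finset α) (v : ℝ), (∀ x ∈ T, (hammingNorm (enc x) : ℝ) = v) →
        (#T : ℝ) ≠ 0 → ∃ w : ℕ, v = w := by
      intro T v hT h
      obtain ⟨x, hx⟩ := Finset.card_ne_zero.1 (Nat.cast_ne_zero.1 h)
      exact ⟨_, (hT x hx).symm⟩
    intro r hr
    simp only [List.mem_cons, List.not_mem_nil, or_false] at hr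
    rcases hr with rfl | rfl | rfl | rfl | rfl
    · exact fun _ => ⟨0, by simp⟩
    · exact ne _ _ h₁'
    · exact ne _ _ h₂
    · exact ne _ _ h₃'
    · exact ne _ _ h₄'
  · intro w
    classical
    have const : ∀ (T : Finset α) (v : ℝ), (∀ x ∈ T, (hammingNorm (enc x) : ℝ) = v) →
        ∑ x ∈ T, (if hammingNorm (enc x) = w then (1 : ℝ) else 0)
          = if v = w then (#T : ℝ) else 0 := by
      intro T v hT
      rw [Finset.sum_congr rfl (g := fun _ => if v = w then (1 : ℝ) else 0)]
      · split_ifs <;> simp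
      · intro x hx
        simp only [← hT x hx, Nat.cast_inj]
    rw [weightCount_eq_card hinj hC, ← Finset.sum_boole, ← Finset.sum_add_sum_compl Q,
      ← Finset.sum_sdiff hZ, ← Finset.sum_sdiff hMQ, ← Finset.add_sum_erase Z _ hx₀, const _ _ h₁',
      const _ _ h₂, const _ _ h₃', const _ _ h₄', h₀]
    simp only [List.map_cons, List.map_nil, List.sum_cons, List.sum_nil, eq_comm (a := (0 : ℕ)),
      eq_comm (a := (0 : ℝ)), Nat.cast_eq_zero]
    have e : ∀ (P : Prop) (i₁ i₂ : Decidable P) (x y : ℝ),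
      @ite _ P i₁ x y = @ite _ P i₂ x y := by intros; congr
    rw [e (w = 0) _ (Classical.propDecidable _), e (w₁ = w) _ (Classical.propDecidable _),
      e (w₂ = w) _ (Classical.propDecidable _), e (w₃ = w) _ (Classical.propDecidable _),
      e (w₄ = w) _ (Classical.propDecidable _)]
    ring

theorem numWeights_eq_length {C : Submodule (ZMod p) (ι → ZMod p)} {T : List (ℝ × ℝ)}
    (h : HasWeightTable C ((0, 1) :: T)) (hpos : ∀ r ∈ T, 0 < r.2)
    (hnodup : (T.map Prod.fst).Nodup) : numWeights C = T.length := by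
  classical
  have hnn : ∀ w : ℕ, ∀ x ∈ T.map (fun r => if r.1 = (w : ℝ) then r.2 else 0), 0 ≤ x := by
    intro w x hx
    obtain ⟨r, hr, rfl⟩ := List.mem_map.1 hx
    split_ifs
    · exact (hpos r hr).le
    · exact le_rfl
  have hsum_pos : ∀ w : ℕ, ∀ r ∈ T, r.1 = (w : ℝ) →
      0 < (T.map (fun r => if r.1 = (w : ℝ) then r.2 else 0)).sum := by
    intro w r hr hrw
    have h3 := List.single_le_sum (hnn w) (if r.1 = (w : ℝ) then r.2 else 0)
      (List.mem_map.2 ⟨r, hr, rfl⟩)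
    rw [if_pos hrw] at h3
    linarith [hpos r hr]
  have h2 : ∀ w : ℕ, (weightCount C w : ℝ) = (if (0 : ℝ) = w then 1 else 0)
      + (T.map (fun r => if r.1 = (w : ℝ) then r.2 else 0)).sum := by
    intro w
    rw [h.2 w, List.map_cons, List.sum_cons]
  -- the zero codeword is the only one of weight `0`, and the first row accounts for it
  have hne : ∀ r ∈ T, r.1 ≠ 0 := by
    intro r hr h0
    have hw : weightCount C 0 = 1 := by
      rw [weightCount, Set.ncard_eq_one]
      refine ⟨0, Set.ext fun c => ?_⟩
      simp only [Set.mem_ofPred_eq, hammingNorm_eq_zero, Set.mem_singleton_iff]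
      exact ⟨fun h => h.2, fun h => ⟨h ▸ C.zero_mem, h⟩⟩
    have h3 := h2 0
    have h4 := hsum_pos 0 r hr (by simpa using h0)
    rw [hw, Nat.cast_one, if_pos (by simp)] at h3
    linarith
  have hcount : ∀ w : ℕ, 1 ≤ w → (weightCount C w ≠ 0 ↔ (w : ℝ) ∈ T.map Prod.fst) := by
    intro w hw
    have hw0 : (0 : ℝ) ≠ w := by
      intro h
      have : w = 0 := by exact_mod_cast h.symm
      omega
    have h2 := h2 w
    rw [if_neg hw0, zero_add] at h2
    constructor
    · intro hwc
      by_contra hmem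
      apply hwc
      rw [List.sum_eq_zero] at h2
      · exact_mod_cast h2
      · intro x hx
        obtain ⟨r, hr, rfl⟩ := List.mem_map.1 hx
        exact if_neg fun h => hmem (List.mem_map.2 ⟨r, hr, h⟩)
    · intro hmem hwc
      obtain ⟨r, hr, hrw⟩ := List.mem_map.1 hmem
      rw [hwc, Nat.cast_zero] at h2
      have := hsum_pos w r hr hrw
      linarith
  have himg : ((Finset.Icc 1 (Fintype.card ι)).filter (fun w => weightCount C w ≠ 0)).image
      (Nat.cast : ℕ → ℝ) = (T.map Prod.fst).toFinset := by
    ext x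
    rw [Finset.mem_image, List.mem_toFinset]
    constructor
    · rintro ⟨w, hw, rfl⟩
      rw [Finset.mem_filter, Finset.mem_Icc] at hw
      exact (hcount w hw.1.1).1 hw.2
    · intro hx
      obtain ⟨r, hr, rfl⟩ := List.mem_map.1 hx
      obtain ⟨w, hw⟩ := h.1 r (List.mem_cons_of_mem _ hr) (hpos r hr).ne'
      have hw1 : 1 ≤ w := by
        rcases Nat.eq_zero_or_pos w with h0 | h0
        · exact absurd (by rw [hw, h0]; simp) (hne r hr)
        · exact h0
      rw [hw] at hx
      have hwc := (hcount w hw1).2 hx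
      refine ⟨w, Finset.mem_filter.2 ⟨Finset.mem_Icc.2 ⟨hw1, ?_⟩, hwc⟩, hw.symm⟩
      obtain ⟨c, hc⟩ : {c : ι → ZMod p | c ∈ C ∧ hammingNorm c = w}.Nonempty := by
        rw [Set.nonempty_iff_ne_empty]
        intro h
        rw [weightCount, h, Set.ncard_empty] at hwc
        exact hwc rfl
      rw [← hc.2]
      exact hammingNorm_le_card_fintype
  rw [numWeights, ← Finset.card_image_of_injective _ (Nat.cast_injective (R := ℝ)), himg,
    List.toFinset_card_of_nodup hnodup, List.length_map]

end WeightTables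

/-! ### Pairs of values of the dual functions -/

section PairCounts

variable {p : ℕ} [Fact p.Prime] {F : Type*} [Field F] [Fintype F] [Algebra (ZMod p) F]

theorem card_filter_dual_pair (m s t : ℕ) (f g : F → ZMod p) (R : ZMod p → ZMod p → Prop)
    [∀ c d, Decidable (R c d)] :
    #{x ∈ supp p m s f ×ˢ supp p m t g | R (dual p m s f x.1) (dual p m t g x.2)}
      = ∑ c, ∑ d, if R c d then dualCount p m s f c * dualCount p m t g d else 0 := by
  rw [← Fintype.sum_prod_type' (f := fun c d =>
      if R c d then dualCount p m s f c * dualCount p m t g d else 0), ← Finset.sum_filter,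
    Finset.card_eq_sum_card_fiberwise
      (f := fun x : F × F => (dual p m s f x.1, dual p m t g x.2))
      (t := univ.filter fun y : ZMod p × ZMod p => R y.1 y.2)]
  · refine Finset.sum_congr rfl fun y hy => ?_
    rw [dualCount_eq, dualCount_eq, ← Finset.card_product]
    congr 1
    ext x
    have hy := (Finset.mem_filter.1 hy).2
    simp only [Finset.mem_filter, Finset.mem_product, Prod.ext_iff]
    constructor
    · rintro ⟨⟨h1, -⟩, h2⟩
      exact ⟨⟨h1.1, h2.1⟩, h1.2, h2.2⟩
    · rintro ⟨⟨h1, h2⟩, h3, h4⟩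
      exact ⟨⟨⟨h1, h3⟩, by rw [h2, h4]; exact hy⟩, h2, h4⟩
  · intro x hx
    have := (Finset.mem_filter.1 (Finset.mem_coe.1 hx)).2
    exact Finset.mem_coe.2 (Finset.mem_filter.2 ⟨Finset.mem_univ _, this⟩)

theorem F₁_eq_card (m s t : ℕ) (f g : F → ZMod p) :
    F₁ p m s t f g = #{x ∈ supp p m s f ×ˢ supp p m t g | dual p m s f x.1 ≠ 0 ∧
      (dual p m t g x.2 = dual p m s f x.1 ∨ dual p m t g x.2 = -dual p m s f x.1)} := by
  rw [F₁, ← Set.ncard_coe_finset]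
  congr 1
  ext x
  simp only [Set.mem_ofPred_eq, Finset.coe_filter, Finset.mem_product, mem_supp, and_assoc]

open Classical in
theorem F₃_eq_card (m s t : ℕ) (f g : F → ZMod p) :
    F₃ p m s t f g = #{x ∈ supp p m s f ×ˢ supp p m t g |
      dual p m s f x.1 * dual p m t g x.2 ≠ 0 ∧
        IsSquare (dual p m s f x.1 * dual p m t g x.2)} := by
  rw [F₃, ← Set.ncard_coe_finset]
  congr 1
  ext x
  simp only [Set.mem_ofPred_eq, Finset.coe_filter, Finset.mem_product, mem_supp, and_assoc]

theorem dualCount_eq_of_quadraticChar_eq (hp4 : p % 4 = 1) {m s : ℕ} (hF : Fintype.card F = p ^ m)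
    {f : F → ZMod p} (hf : IsWRP p m s f) {c d : ZMod p} (hc : c ≠ 0) (hd : d ≠ 0)
    (h : quadraticChar (ZMod p) c = quadraticChar (ZMod p) d) :
    dualCount p m s f c = dualCount p m s f d := by
  have hp0 : (p : ℤ) ≠ 0 := by exact_mod_cast (Fact.out : p.Prime).ne_zero
  have : (p : ℤ) * dualCount p m s f c = p * dualCount p m s f d := by
    rcases Nat.even_or_odd' (m - s) with ⟨k, hk | hk⟩
    · rw [mul_dualCount_of_even hp4 hF hf hk, mul_dualCount_of_even hp4 hF hf hk, if_neg hc,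
        if_neg hd]
    · rw [mul_dualCount_of_odd hp4 hF hf hk, mul_dualCount_of_odd hp4 hF hf hk, h]
  exact_mod_cast mul_left_cancel₀ hp0 this

theorem dualCount_neg (hp4 : p % 4 = 1) {m s : ℕ} (hF : Fintype.card F = p ^ m)
    {f : F → ZMod p} (hf : IsWRP p m s f) {c : ZMod p} (hc : c ≠ 0) :
    dualCount p m s f (-c) = dualCount p m s f c := by
  apply dualCount_eq_of_quadraticChar_eq hp4 hF hf (neg_ne_zero.2 hc) hc
  have : quadraticChar (ZMod p) (-1) = 1 :=
    (quadraticChar_one_iff_isSquare (by simp)).2 (isSquare_neg_one hp4)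
  rw [← neg_one_mul, map_mul, this, one_mul]

theorem F₁_eq_sum (hp4 : p % 4 = 1) {m s t : ℕ} (hF : Fintype.card F = p ^ m)
    {f g : F → ZMod p} (hg : IsWRP p m t g) :
    F₁ p m s t f g = 2 * ∑ c ∈ univ.filter (fun c : ZMod p => c ≠ 0),
      dualCount p m s f c * dualCount p m t g c := by
  rw [F₁_eq_card, card_filter_dual_pair m s t f g (fun c d => c ≠ 0 ∧ (d = c ∨ d = -c)),
    Finset.mul_sum, Finset.sum_filter]
  refine Finset.sum_congr rfl fun c _ => ?_
  split_ifs with hc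
  · simp only [hc, ne_eq, not_false_eq_true, true_and]
    rw [← Finset.sum_filter, show (univ.filter fun d : ZMod p => d = c ∨ d = -c) = {c, -c} by
      ext d; simp, Finset.sum_pair (neg_ne_self hp4 hc).symm, dualCount_neg hp4 hF hg hc]
    ring
  · simp [hc]

theorem F₃_eq (hp4 : p % 4 = 1) {m s t : ℕ} (hF : Fintype.card F = p ^ m)
    {f g : F → ZMod p} (hf : IsWRP p m s f) (hg : IsWRP p m t g) {i j : ZMod p} (hi0 : i ≠ 0)
    (hi : IsSquare i) (hj : ¬ IsSquare j) :
    F₃ p m s t f g = ((p - 1) / 2) ^ 2 * (dualCount p m s f i * dualCount p m t g i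
      + dualCount p m s f j * dualCount p m t g j) := by
  classical
  have hj0 : j ≠ 0 := by
    rintro rfl
    exact hj IsSquare.zero
  set A := univ.filter fun c : ZMod p => c ≠ 0 ∧ c ^ ((p - 1) / 2) = 1 with hA
  set B := univ.filter fun c : ZMod p => c ≠ 0 ∧ c ^ ((p - 1) / 2) = -1 with hB
  have hχ1 : ∀ c ∈ A, c ≠ 0 ∧ quadraticChar (ZMod p) c = quadraticChar (ZMod p) i := by
    intro c hc
    obtain ⟨-, hc0, hc⟩ := Finset.mem_filter.1 hc
    rw [(quadraticChar_one_iff_isSquare hi0).2 hi,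
      (quadraticChar_one_iff_isSquare hc0).2 ((isSquare_iff_pow_half hp4 hc0).2 hc)]
    exact ⟨hc0, rfl⟩
  have hχ2 : ∀ c ∈ B, c ≠ 0 ∧ quadraticChar (ZMod p) c = quadraticChar (ZMod p) j := by
    intro c hc
    obtain ⟨-, hc0, hc⟩ := Finset.mem_filter.1 hc
    rw [quadraticChar_neg_one_iff_not_isSquare.2 hj, quadraticChar_neg_one_iff_not_isSquare.2]
    · exact ⟨hc0, rfl⟩
    · rw [isSquare_iff_pow_half hp4 hc0, hc]
      exact neg_one_ne_one hp4
  have hset : (univ.filter fun y : ZMod p × ZMod p => y.1 * y.2 ≠ 0 ∧ IsSquare (y.1 * y.2))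
      = (A ×ˢ A) ∪ (B ×ˢ B) := by
    ext ⟨c, d⟩
    simp only [Finset.mem_filter, Finset.mem_univ, true_and, Finset.mem_union, Finset.mem_product,
      hA, hB]
    constructor
    · rintro ⟨h0, h⟩
      have hc := left_ne_zero_of_mul h0
      have hd := right_ne_zero_of_mul h0
      rw [isSquare_iff_pow_half hp4 h0, mul_pow] at h
      rcases pow_half_eq_one_or_neg_one hp4 hc with h1 | h1 <;> rw [h1] at h ⊢
      · left
        exact ⟨⟨hc, rfl⟩, hd, by linear_combination h⟩
      · right
        exact ⟨⟨hc, rfl⟩, hd, by linear_combination -h⟩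
    · rintro (⟨⟨hc, h1⟩, hd, h2⟩ | ⟨⟨hc, h1⟩, hd, h2⟩)
      all_goals
        refine ⟨mul_ne_zero hc hd, ?_⟩
        rw [isSquare_iff_pow_half hp4 (mul_ne_zero hc hd), mul_pow, h1, h2]
        ring
  have hdisj : Disjoint (A ×ˢ A) (B ×ˢ B) := by
    rw [Finset.disjoint_left]
    rintro ⟨c, d⟩ h1 h2
    have h3 := (Finset.mem_filter.1 (Finset.mem_product.1 h1).1).2.2
    have h4 := (Finset.mem_filter.1 (Finset.mem_product.1 h2).1).2.2
    exact neg_one_ne_one hp4 (h4.symm.trans h3)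
  have cA : #A = (p - 1) / 2 := card_pow_half_eq hp4 (Or.inl rfl)
  have cB : #B = (p - 1) / 2 := card_pow_half_eq hp4 (Or.inr rfl)
  rw [F₃_eq_card, card_filter_dual_pair m s t f g (fun c d => c * d ≠ 0 ∧ IsSquare (c * d)),
    ← Fintype.sum_prod_type' (f := fun c d =>
      if c * d ≠ 0 ∧ IsSquare (c * d) then dualCount p m s f c * dualCount p m t g d else 0),
    ← Finset.sum_filter, hset, Finset.sum_union hdisj,
    Finset.sum_congr (s₁ := A ×ˢ A) rfl (g := fun _ => dualCount p m s f i * dualCount p m t g i),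
    Finset.sum_congr (s₁ := B ×ˢ B) rfl (g := fun _ => dualCount p m s f j * dualCount p m t g j)]
  · simp only [Finset.sum_const, Finset.card_product, cA, cB, smul_eq_mul]
    ring
  · intro y hy
    obtain ⟨h1, h2⟩ := Finset.mem_product.1 hy
    rw [dualCount_eq_of_quadraticChar_eq hp4 hF hf (hχ2 _ h1).1 hj0 (hχ2 _ h1).2,
      dualCount_eq_of_quadraticChar_eq hp4 hF hg (hχ2 _ h2).1 hj0 (hχ2 _ h2).2]
  · intro y hy
    obtain ⟨h1, h2⟩ := Finset.mem_product.1 hy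
    rw [dualCount_eq_of_quadraticChar_eq hp4 hF hf (hχ1 _ h1).1 hi0 (hχ1 _ h1).2,
      dualCount_eq_of_quadraticChar_eq hp4 hF hg (hχ1 _ h2).1 hi0 (hχ1 _ h2).2]

theorem dualCount_pos_of_even (hp4 : p % 4 = 1) {m s : ℕ} (hF : Fintype.card F = p ^ m)
    {f : F → ZMod p} (hf : IsWRP p m s f) {k : ℕ} (hk0 : 0 < k) (hk : m - s = 2 * k) (c : ZMod p) :
    0 < dualCount p m s f c := by
  have hp : p.Prime := Fact.out
  have hp2 : (2 : ℤ) ≤ p := by exact_mod_cast hp.two_le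
  have h := mul_dualCount_of_even hp4 hF hf hk c
  have hpk : (p : ℤ) ≤ p ^ k := le_self_pow₀ (by omega) (by omega)
  have e : (p : ℤ) ^ (2 * k) = p ^ k * p ^ k := by rw [two_mul, pow_add]
  have hpos : (0 : ℤ) < p * dualCount p m s f c := by
    rw [h, e]
    rcases (isSignDual_sign_dual hp4 hf).1 with h1 | h1 <;> rw [h1] <;> split_ifs <;> nlinarith
  exact_mod_cast pos_of_mul_pos_right hpos (by omega)

theorem one_lt_dualCount_zero (hp4 : p % 4 = 1) {m s : ℕ} (hF : Fintype.card F = p ^ m)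
    {f : F → ZMod p} (hf : IsWRP p m s f) {k : ℕ} (hk0 : 0 < k) (hk : m - s = 2 * k)
    (hε : sign p m s f = 1) : 1 < dualCount p m s f 0 := by
  have hp : p.Prime := Fact.out
  have hp2 : (2 : ℤ) ≤ p := by exact_mod_cast hp.two_le
  have h := mul_dualCount_of_even hp4 hF hf hk 0
  have hpk : (p : ℤ) ≤ p ^ k := le_self_pow₀ (by omega) (by omega)
  have e : (p : ℤ) ^ (2 * k) = p ^ k * p ^ k := by rw [two_mul, pow_add]
  have hlt : (p : ℤ) * 1 < p * dualCount p m s f 0 := by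
    rw [h, e, hε, if_pos rfl]
    nlinarith
  exact_mod_cast lt_of_mul_lt_mul_left hlt (by omega)

/-- If `p - 1` divides `q 𝒩_f(c)` for all `c ≠ 0`, but not `2 q`, then `m - s` is even and
`ε_f = 1`: modulo `p - 1`, `𝒩_f(c)` is `1 - ε_f` for even `m - s` and `1 + η(c) ε_f` for odd
`m - s`, where the values for a square and for a nonsquare add up to `2`. -/
theorem even_and_sign_eq_one_of_dvd (hp4 : p % 4 = 1) {m s : ℕ} (hF : Fintype.card F = p ^ m)
    {f : F → ZMod p} (hf : IsWRP p m s f) {q : ℤ} (hq : ¬ ((p : ℤ) - 1) ∣ q * 2)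
    (h : ∀ c, c ≠ 0 → ((p : ℤ) - 1) ∣ q * dualCount p m s f c) :
    (∃ k, m - s = 2 * k) ∧ sign p m s f = 1 := by
  have hε := (isSignDual_sign_dual hp4 hf).1
  have h' : ∀ c, c ≠ 0 → ((p : ℤ) - 1) ∣ q * (p * dualCount p m s f c) := fun c hc => by
    rw [mul_left_comm]
    exact (h c hc).mul_left (p : ℤ)
  rcases Nat.even_or_odd' (m - s) with ⟨k, hk | hk⟩
  · refine ⟨⟨k, hk⟩, hε.resolve_right fun h1 => hq ?_⟩
    have h2 := h' 1 one_ne_zero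
    rw [mul_dualCount_of_even hp4 hF hf hk, if_neg one_ne_zero, h1] at h2
    have h3 := dvd_add (sub_one_dvd_pow_sub_one p (2 * k)) (sub_one_dvd_pow_sub_one p k)
    obtain ⟨x, hx⟩ := dvd_sub h2 (h3.mul_left q)
    exact ⟨x, by linear_combination hx⟩
  · exfalso
    obtain ⟨j, hj⟩ := FiniteField.exists_nonsquare (F := ZMod p)
      (by rw [ZMod.ringChar_zmod_n]; omega)
    have hj0 : j ≠ 0 := by
      rintro rfl
      exact hj IsSquare.zero
    have h1 := h' 1 one_ne_zero
    have h2 := h' j hj0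
    rw [mul_dualCount_of_odd hp4 hF hf hk] at h1 h2
    rw [map_one] at h1
    rw [quadraticChar_neg_one_iff_not_isSquare.2 hj] at h2
    apply hq
    have h3 := sub_one_dvd_pow_sub_one p (2 * k + 1)
    have h4 := dvd_add h1 h2
    obtain ⟨x, hx⟩ := dvd_sub h4 (h3.mul_left (q * 2))
    exact ⟨x, by linear_combination hx⟩

theorem sub_one_dvd_card_filter_dual {m s : ℕ} {f : F → ZMod p} (hf : IsWRP p m s f)
    (hf0 : dual p m s f 0 = 0) (V : Finset (ZMod p)) (hV : 0 ∉ V)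
    (h : ∀ z : ZMod p, z ≠ 0 → ∀ β ∈ supp p m s f, dual p m s f β ∈ V →
      dual p m s f (z • β) ∈ V) :
    p - 1 ∣ #{β ∈ supp p m s f | dual p m s f β ∈ V} := by
  refine sub_one_dvd_card_of_smul_mem (p := p) _ (by simp [hf0, hV]) ?_
  intro z hz x hx
  rw [Finset.mem_filter] at hx ⊢
  exact ⟨smul_mem_supp hf hz hx.1, h z hz x hx.1 hx.2⟩

theorem even_and_sign_eq_one_of_index_sub_one (hp4 : p % 4 = 1) {m s : ℕ}
    (hF : Fintype.card F = p ^ m) {f : F → ZMod p} (hf : IsWRP p m s f)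
    (hl : IsIndex p m s f (p - 1)) : (∃ k, m - s = 2 * k) ∧ sign p m s f = 1 := by
  have hp : p.Prime := Fact.out
  refine even_and_sign_eq_one_of_dvd hp4 hF hf (q := 1) ?_ ?_
  · intro h
    have := Int.le_of_dvd (by norm_num) h
    have := hp.two_le
    omega
  · intro c hc
    have h := sub_one_dvd_card_filter_dual hf (dual_zero hp4 hF hf hl) {c} (by simpa using hc.symm)
      (fun z hz β hβ h => by
        rwa [hl.2.2.2 z hz β (mem_supp.1 hβ), ZMod.pow_card_sub_one_eq_one hz, one_mul])
    simp only [Finset.mem_singleton] at h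
    rw [← dualCount_eq] at h
    have := Int.natCast_dvd_natCast.2 h
    rwa [Nat.cast_sub hp.one_le, Nat.cast_one, ← one_mul (dualCount p m s f c : ℤ)] at this

theorem even_and_sign_eq_one_of_index_half (hp4 : p % 4 = 1) (hp5 : p ≠ 5) {m s : ℕ}
    (hF : Fintype.card F = p ^ m) {f : F → ZMod p} (hf : IsWRP p m s f)
    (hl : IsIndex p m s f ((p - 1) / 2)) : (∃ k, m - s = 2 * k) ∧ sign p m s f = 1 := by
  classical
  have hp : p.Prime := Fact.out
  refine even_and_sign_eq_one_of_dvd hp4 hF hf (q := 2) ?_ ?_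
  · intro h
    have := Int.le_of_dvd (by norm_num) h
    have := hp.two_le
    omega
  · intro c hc
    have h := sub_one_dvd_card_filter_dual hf (dual_zero hp4 hF hf hl) {c, -c}
      (by simp [hc, hc.symm])
      (fun z hz β hβ h => by
        rw [hl.2.2.2 z hz β (mem_supp.1 hβ)]
        simp only [Finset.mem_insert, Finset.mem_singleton] at h ⊢
        rcases pow_half_eq_one_or_neg_one hp4 hz with h1 | h1 <;> rw [h1]
        · simpa using h
        · rcases h with h | h <;> simp [h])
    simp only [Finset.mem_insert, Finset.mem_singleton] at h
    rw [Finset.filter_or, Finset.card_union_of_disjoint, ← dualCount_eq, ← dualCount_eq,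
      dualCount_neg hp4 hF hf hc] at h
    · have := Int.natCast_dvd_natCast.2 h
      rw [Nat.cast_sub hp.one_le, Nat.cast_one, Nat.cast_add] at this
      rwa [two_mul]
    · rw [Finset.disjoint_filter]
      intro β _ h1 h2
      exact neg_ne_self hp4 hc (h2.symm.trans h1)

end PairCounts

/-! ### The frequencies as real numbers -/

section RealForms

theorem sqrt_zpow_eq {p : ℕ} (hp : 0 < p) (k j : ℕ) :
    √(p : ℝ) ^ (2 * (k : ℤ) - 2 * (j : ℤ)) = (p : ℝ) ^ k / (p : ℝ) ^ j := by
  have hp0 : (0 : ℝ) < p := by exact_mod_cast hp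
  have hs : √(p : ℝ) ≠ 0 := (Real.sqrt_pos.2 hp0).ne'
  have h2 : √(p : ℝ) ^ (2 : ℤ) = p := by
    rw [zpow_ofNat, Real.sq_sqrt hp0.le]
  rw [zpow_sub₀ hs, zpow_mul, zpow_mul, h2, zpow_natCast, zpow_natCast]

theorem zpow_sub_one_eq {p : ℕ} (hp : 0 < p) (k : ℕ) :
    (p : ℝ) ^ ((k : ℤ) - 1) = (p : ℝ) ^ k / p := by
  have hp0 : (0 : ℝ) < p := by exact_mod_cast hp
  rw [zpow_sub₀ hp0.ne', zpow_natCast, zpow_one]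

variable {p : ℕ} [Fact p.Prime] {F : Type*} [Field F] [Fintype F] [Algebra (ZMod p) F]

theorem dualCount_eq_dualCountValue (hp4 : p % 4 = 1) {m s : ℕ} (hF : Fintype.card F = p ^ m)
    {f : F → ZMod p} (hf : IsWRP p m s f) (c : ZMod p) :
    (dualCount p m s f c : ℝ) = dualCountValue p m s (sign p m s f) c := by
  have hp : 0 < p := (Fact.out : p.Prime).pos
  have hp0 : (0 : ℝ) < p := by exact_mod_cast hp
  have hsm := hf.weaklyRegular.1.1
  apply mul_left_cancel₀ hp0.ne'
  rcases Nat.even_or_odd' (m - s) with ⟨k, hk | hk⟩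
  · have h := congrArg (Int.cast (R := ℝ)) (mul_dualCount_of_even hp4 hF hf hk c)
    have e1 : (m : ℤ) - s - 1 = ((2 * k : ℕ) : ℤ) - 1 := by omega
    have e2 : (m : ℤ) - s - 2 = 2 * (k : ℤ) - 2 * ((1 : ℕ) : ℤ) := by omega
    rw [dualCountValue, if_pos (by rw [hk]; exact even_two_mul k), e1, e2, zpow_sub_one_eq hp,
      sqrt_zpow_eq hp]
    push_cast at h
    rw [h]
    split_ifs <;> field_simp <;> ring
  · have h := congrArg (Int.cast (R := ℝ)) (mul_dualCount_of_odd hp4 hF hf hk c)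
    have e1 : (m : ℤ) - s - 1 = 2 * (k : ℤ) - 2 * ((0 : ℕ) : ℤ) := by omega
    have e2 : (p : ℝ) ^ (2 * (k : ℤ) - 2 * ((0 : ℕ) : ℤ)) = (p : ℝ) ^ (2 * k) := by
      rw [← zpow_natCast]
      congr 1
    rw [dualCountValue, if_neg (by rw [hk, Nat.not_even_iff_odd]; exact odd_two_mul_add_one k), e1,
      e2, sqrt_zpow_eq hp]
    push_cast at h
    rw [h]
    split_ifs with hc
    · rw [hc]
      simp
      ring
    · ring

/-- For `s = m`, the sign `-1` would make `𝒩_f(0)` negative. -/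
theorem sign_eq_one_of_eq (hp4 : p % 4 = 1) {m s : ℕ} (hF : Fintype.card F = p ^ m)
    {f : F → ZMod p} (hf : IsWRP p m s f) (hs : s = m) : sign p m s f = 1 := by
  refine (isSignDual_sign_dual hp4 hf).1.resolve_right fun h1 => ?_
  have h := mul_dualCount_of_even hp4 hF hf (k := 0) (by omega) 0
  rw [h1, if_pos rfl] at h
  have hp2 := (Fact.out : p.Prime).two_le
  have : (0 : ℤ) ≤ p * dualCount p m s f 0 := by positivity
  rw [h] at this
  norm_num at this
  omega

end RealForms

/-! ### Weight tables of the code `C_{D_{f,g}}` -/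

section Tables

variable {p : ℕ} [Fact p.Prime] {F : Type*} [Field F] [Fintype F] [Algebra (ZMod p) F]

theorem scalarCount_le (k l : ℕ) (A B : ZMod p) : scalarCount k l A B ≤ p - 1 := by
  rw [← card_ne_zero (p := p)]
  exact Finset.card_le_card fun w hw => by
    rw [Finset.mem_filter] at hw ⊢
    exact ⟨hw.1, hw.2.1⟩

/-- The weight of `c(a, b)` is positive for `(a, b) ≠ 0`, unless `ε_f ε_g = -1` and
`s + t ≥ 2 m - 2`. -/
theorem encode_injective [DecidableEq F] (hp4 : p % 4 = 1) {m s t r : ℕ}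
    (hF : Fintype.card F = p ^ m) (hr : s + t = 2 * r) {f g : F → ZMod p} (hf : IsWRP p m s f)
    (hg : IsWRP p m t g) {k l : ℕ} (hk : IsIndex p m s f k) (hl : IsIndex p m t g l)
    (he : sign p m s f * sign p m t g = 1 ∨ r + 2 ≤ m) :
    Function.Injective (encode p f g) := by
  have hf0 := dual_zero hp4 hF hf hk
  have hg0 := dual_zero hp4 hF hg hl
  have hp2 := (Fact.out : p.Prime).two_le
  have hpz : (2 : ℤ) ≤ p := by exact_mod_cast hp2
  rw [injective_iff_map_eq_zero]
  rintro ⟨a, b⟩ hab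
  by_contra hne
  have hw : hammingNorm (encode p f g (a, b)) = 0 := by rw [hab, hammingNorm_zero]
  have hP : 0 < (p : ℤ) ^ (m + r) := by positivity
  have hQ : 0 < (p : ℤ) ^ (2 * m) := by positivity
  have hκ : ∀ κ : ℕ, κ ≤ p - 1 → 0 ≤ (p : ℤ) - 1 - κ ∧ (p : ℤ) - 1 - κ ≤ p - 1 := by
    intro κ hκ
    omega
  have hPQ : sign p m s f * sign p m t g ≠ 1 → (p : ℤ) * p * p ^ (m + r) ≤ p ^ (2 * m) := by
    intro h
    have := he.resolve_left h
    rw [← pow_two, ← pow_add]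
    exact pow_le_pow_right₀ (by omega) (by omega)
  have hsgn : sign p m s f * sign p m t g = 1 ∨ sign p m s f * sign p m t g = -1 := by
    rcases (isSignDual_sign_dual hp4 hf).1 with h1 | h1 <;>
      rcases (isSignDual_sign_dual hp4 hg).1 with h2 | h2 <;> simp [h1, h2]
  by_cases hmem : a ∈ supp p m s f ∧ b ∈ supp p m t g
  · have h := sq_mul_hammingNorm_of_mem hp4 hF hr hf hg hf0 hg0 hk hl hmem.1 hmem.2 hne
    have hκ' := hκ _ (scalarCount_le k l (dual p m s f a) (dual p m t g b))
    rw [hw, Nat.cast_zero, mul_zero] at h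
    generalize (p : ℤ) - 1 - scalarCount k l (dual p m s f a) (dual p m t g b) = x at *
    have h1 : 0 < ((p : ℤ) - 1) * p ^ (2 * m) := mul_pos (by omega) hQ
    rcases hsgn with h2 | h2 <;> rw [h2] at h
    · have : 0 ≤ (p : ℤ) * (1 * p ^ (m + r)) * x := by
        have := hκ'.1
        positivity
      linarith
    · have h3 := hPQ (by rw [h2]; norm_num)
      have h4 : (p : ℤ) * p ^ (m + r) * x ≤ p * p ^ (m + r) * (p - 1) :=
        mul_le_mul_of_nonneg_left hκ'.2 (by positivity)
      have h5 : ((p : ℤ) - 1) * (p * p * p ^ (m + r)) ≤ (p - 1) * p ^ (2 * m) :=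
        mul_le_mul_of_nonneg_left h3 (by omega)
      have h6 : 0 < (p : ℤ) * p ^ (m + r) * ((p - 1) * (p - 1)) :=
        mul_pos (by positivity) (mul_pos (by omega) (by omega))
      nlinarith
  · have h := sq_mul_hammingNorm_of_not_mem hp4 hF hr hf hg hf0 hg0 hmem
    rw [hw, Nat.cast_zero, mul_zero] at h
    have h1 : 0 < ((p : ℤ) - 1) * p ^ (2 * m) := mul_pos (by omega) hQ
    rcases hsgn with h2 | h2 <;> rw [h2] at h
    · have : 0 < ((p : ℤ) - 1) * ((p - 1) * (1 * p ^ (m + r))) :=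
        mul_pos (by omega) (mul_pos (by omega) (by simpa using hP))
      linarith
    · have h3 := hPQ (by rw [h2]; norm_num)
      have h5 : ((p : ℤ) - 1) * (p * p * p ^ (m + r)) ≤ (p - 1) * p ^ (2 * m) :=
        mul_le_mul_of_nonneg_left h3 (by omega)
      have h6 : 0 < ((p : ℤ) - 1) * p ^ (m + r) * (p * p - (p - 1)) :=
        mul_pos (mul_pos (by omega) hP) (by nlinarith)
      nlinarith

theorem finrank_code [DecidableEq F] {m : ℕ} (hF : Fintype.card F = p ^ m) {f g : F → ZMod p}
    (hinj : Function.Injective (encode p f g)) :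
    Module.finrank (ZMod p) (code p f g) = 2 * m := by
  have hfin : Module.finrank (ZMod p) F = m := by
    have h := Module.card_eq_pow_finrank (K := ZMod p) (V := F)
    rw [hF, ZMod.card] at h
    exact (Nat.pow_right_injective (Fact.out : p.Prime).two_le h).symm
  rw [code, LinearMap.finrank_range_of_inj hinj, Module.finrank_prod, hfin, two_mul]

theorem hammingNorm_encode_of_mem [DecidableEq F] (hp4 : p % 4 = 1) {m s t r : ℕ} (hm : 1 ≤ m)
    (hF : Fintype.card F = p ^ m) (hr : s + t = 2 * r) {f g : F → ZMod p} (hf : IsWRP p m s f)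
    (hg : IsWRP p m t g) {k l : ℕ} (hk : IsIndex p m s f k) (hl : IsIndex p m t g l) {a b : F}
    (ha : a ∈ supp p m s f) (hb : b ∈ supp p m t g) (hab : (a, b) ≠ (0, 0)) {κ : ℕ}
    (hκ : scalarCount k l (dual p m s f a) (dual p m t g b) = κ) :
    (hammingNorm (encode p f g (a, b)) : ℝ) = (p - 1) * p ^ (2 * m - 2)
      + (p - 1 - κ) * (sign p m s f * sign p m t g) * ((p : ℝ) ^ (m + r) / p) := by
  have h := congrArg (Int.cast (R := ℝ)) (sq_mul_hammingNorm_of_mem hp4 hF hr hf hg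
    (dual_zero hp4 hF hf hk) (dual_zero hp4 hF hg hl) hk hl ha hb hab)
  have hp0 : (p : ℝ) ≠ 0 := by exact_mod_cast (Fact.out : p.Prime).ne_zero
  rw [hκ] at h
  push_cast at h
  apply mul_left_cancel₀ (pow_ne_zero 2 hp0)
  rw [h, show 2 * m = 2 * m - 2 + 2 by omega, pow_add, Nat.add_sub_cancel]
  field_simp

theorem hammingNorm_encode_of_not_mem [DecidableEq F] (hp4 : p % 4 = 1) {m s t r : ℕ} (hm : 1 ≤ m)
    (hF : Fintype.card F = p ^ m) (hr : s + t = 2 * r) {f g : F → ZMod p} (hf : IsWRP p m s f)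
    (hg : IsWRP p m t g) {k l : ℕ} (hk : IsIndex p m s f k) (hl : IsIndex p m t g l) {a b : F}
    (hab : ¬ (a ∈ supp p m s f ∧ b ∈ supp p m t g)) :
    (hammingNorm (encode p f g (a, b)) : ℝ) = (p - 1) * (p ^ (2 * m - 2)
      + (p - 1) * (sign p m s f * sign p m t g) * ((p : ℝ) ^ (m + r) / p ^ 2)) := by
  have h := congrArg (Int.cast (R := ℝ)) (sq_mul_hammingNorm_of_not_mem hp4 hF hr hf hg
    (dual_zero hp4 hF hf hk) (dual_zero hp4 hF hg hl) hab)
  have hp0 : (p : ℝ) ≠ 0 := by exact_mod_cast (Fact.out : p.Prime).ne_zero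
  push_cast at h
  apply mul_left_cancel₀ (pow_ne_zero 2 hp0)
  rw [h, show 2 * m = 2 * m - 2 + 2 by omega, pow_add, Nat.add_sub_cancel]
  field_simp

theorem card_supp_prod {m s t r : ℕ} (hF : Fintype.card F = p ^ m) (hr : s + t = 2 * r)
    {f g : F → ZMod p} (hf : IsWRP p m s f) (hg : IsWRP p m t g) :
    #(supp p m s f ×ˢ supp p m t g) = p ^ (2 * (m - r)) := by
  have h1 := hf.weaklyRegular.1.1
  have h2 := hg.weaklyRegular.1.1
  rw [Finset.card_product, card_supp hF hf.weaklyRegular.1, card_supp hF hg.weaklyRegular.1,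
    ← pow_add]
  congr 1
  omega

/-- The weight table for a subset `Z` of the product of the Walsh supports on which the number of
scalars is `p - 1` and a subset `M` on which it is `κ`, if it is `0` on the rest. -/
theorem hasWeightTable_code [DecidableEq F] (hp4 : p % 4 = 1) {m s t r : ℕ} (hm : 1 ≤ m)
    (hF : Fintype.card F = p ^ m) (hr : s + t = 2 * r) {f g : F → ZMod p} (hf : IsWRP p m s f)
    (hg : IsWRP p m t g) {k l : ℕ} (hk : IsIndex p m s f k) (hl : IsIndex p m t g l)
    (hinj : Function.Injective (encode p f g)) {Z M : Finset (F × F)} {κ : ℕ}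
    (h0 : (0, 0) ∈ Z) (hZ : Z ⊆ supp p m s f ×ˢ supp p m t g)
    (hM : M ⊆ supp p m s f ×ˢ supp p m t g) (hZM : Disjoint Z M)
    (hZκ : ∀ x ∈ Z, scalarCount k l (dual p m s f x.1) (dual p m t g x.2) = p - 1)
    (hMκ : ∀ x ∈ M, scalarCount k l (dual p m s f x.1) (dual p m t g x.2) = κ)
    (hrest : ∀ x ∈ supp p m s f ×ˢ supp p m t g, x ∉ Z → x ∉ M →
      scalarCount k l (dual p m s f x.1) (dual p m t g x.2) = 0) :
    HasWeightTable (code p f g) [(0, 1), ((p - 1) * p ^ (2 * m - 2), (#Z : ℝ) - 1),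
      ((p - 1) * p ^ (2 * m - 2)
        + (p - 1 - κ) * (sign p m s f * sign p m t g) * ((p : ℝ) ^ (m + r) / p), (#M : ℝ)),
      ((p - 1) * (p ^ (2 * m - 2) + (sign p m s f * sign p m t g) * ((p : ℝ) ^ (m + r) / p)),
        (p : ℝ) ^ (2 * (m - r)) - #Z - #M),
      ((p - 1) * (p ^ (2 * m - 2)
        + (p - 1) * (sign p m s f * sign p m t g) * ((p : ℝ) ^ (m + r) / p ^ 2)),
        (p : ℝ) ^ (2 * m) - p ^ (2 * (m - r)))] := by
  have hone : 1 ≤ p := (Fact.out : p.Prime).one_le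
  have hcast : ((p - 1 : ℕ) : ℝ) = p - 1 := by rw [Nat.cast_sub hone, Nat.cast_one]
  have c1 : ((p : ℝ) ^ (2 * (m - r))) = #(supp p m s f ×ˢ supp p m t g) := by
    rw [card_supp_prod hF hr hf hg, Nat.cast_pow]
  have c2 : ((p : ℝ) ^ (2 * m)) = Fintype.card (F × F) := by
    rw [← Finset.card_univ, card_univ_prod_self hF, Nat.cast_pow]
  have hM0 : ∀ x ∈ M, x ≠ (0, 0) := fun x hx h =>
    Finset.disjoint_left.1 hZM h0 (h ▸ hx)
  rw [c1, c2]
  refine hasWeightTable_of_partition (x₀ := (0, 0)) hinj (fun c => LinearMap.mem_range) h0 hZ hM hZM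
    ?_ ?_ ?_ ?_ ?_
  · rw [show ((0 : F), (0 : F)) = 0 from rfl, map_zero, hammingNorm_zero]
  · intro x hx hx0
    have hxm := Finset.mem_product.1 (hZ hx)
    have h := hammingNorm_encode_of_mem hp4 hm hF hr hf hg hk hl hxm.1 hxm.2 hx0 (hZκ x hx)
    rw [h, hcast]
    ring
  · intro x hx
    have hxm := Finset.mem_product.1 (hM hx)
    exact hammingNorm_encode_of_mem hp4 hm hF hr hf hg hk hl hxm.1 hxm.2 (hM0 x hx) (hMκ x hx)
  · intro x hx hxZ hxM
    have hxm := Finset.mem_product.1 hx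
    have h := hammingNorm_encode_of_mem hp4 hm hF hr hf hg hk hl hxm.1 hxm.2
      (fun h => hxZ (by rw [show x = (0, 0) from h]; exact h0)) (hrest x hx hxZ hxM)
    rw [h]
    push_cast
    ring
  · intro x hx
    rw [Finset.mem_product] at hx
    exact hammingNorm_encode_of_not_mem hp4 hm hF hr hf hg hk hl hx

theorem exists_dual_eq {m s : ℕ} {f : F → ZMod p} {c : ZMod p} (h : 0 < dualCount p m s f c) :
    ∃ a ∈ supp p m s f, dual p m s f a = c := by
  rw [dualCount_eq] at h
  obtain ⟨a, ha⟩ := Finset.card_pos.1 h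
  exact ⟨a, (Finset.mem_filter.1 ha).1, (Finset.mem_filter.1 ha).2⟩

end Tables

/-! ### Numbers of weights and the four cases -/

section Cases

variable {p : ℕ} [Fact p.Prime] {F : Type*} [Field F] [Fintype F] [Algebra (ZMod p) F]

/-- The weights in the tables are `x` plus the multiples of `E = ε_f ε_g p ^ (m + r - 1)` by `0`,
`p - 1 - κ`, `p - 1` and `(p - 1) ^ 2 / p`, where the row of frequency `b` belongs to
the pairs with `κ` scalars. -/
theorem numWeights_eq_four {ι : Type*} [Fintype ι] {C : Submodule (ZMod p) (ι → ZMod p)}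
    {x E κ a b c d : ℝ}
    (h : HasWeightTable C [(0, 1), (x, a), (x + (p - 1 - κ) * E, b), (x + (p - 1) * E, c),
      (x + (p - 1) ^ 2 / p * E, d)]) (ha : 0 < a) (hb : 0 < b) (hc : 0 < c) (hd : 0 < d)
    (hE : E ≠ 0) (hκ : κ ≠ 0) (hκ1 : p - 1 - κ ≠ 0) (hκp : p * (p - 1 - κ) ≠ (p - 1) ^ 2) :
    numWeights C = 4 := by
  have hp : p.Prime := Fact.out
  have hp0 : (p : ℝ) ≠ 0 := by exact_mod_cast hp.ne_zero
  have hp1 : (p : ℝ) - 1 ≠ 0 := by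
    rw [sub_ne_zero]
    exact_mod_cast hp.ne_one
  have hlt : ((p : ℝ) - 1) ^ 2 / p ≠ 0 := div_ne_zero (pow_ne_zero 2 hp1) hp0
  have h3 : (p - 1 : ℝ) ≠ (p - 1) ^ 2 / p := by
    intro h
    rw [eq_div_iff hp0, pow_two] at h
    have := mul_left_cancel₀ hp1 h
    linarith
  have h4 : (p - 1 - κ : ℝ) ≠ (p - 1) ^ 2 / p := by
    intro h
    rw [eq_div_iff hp0] at h
    exact hκp (by rw [← h]; ring)
  refine numWeights_eq_length h ?_ ?_
  · intro r hr
    simp only [List.mem_cons, List.not_mem_nil, or_false] at hr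
    rcases hr with rfl | rfl | rfl | rfl <;> assumption
  · have h5 : (p - 1 - κ : ℝ) ≠ p - 1 := by
      intro h
      exact hκ (by linarith)
    simp [hE, hκ1, hp1, hp0, h5, h4, h3]

theorem numWeights_eq_three {ι : Type*} [Fintype ι] {C : Submodule (ZMod p) (ι → ZMod p)}
    {x E a c d : ℝ} (h : HasWeightTable C [(0, 1), (x, a), (x + (p - 1) * E, c),
      (x + (p - 1) ^ 2 / p * E, d)]) (ha : 0 < a) (hc : 0 < c) (hd : 0 < d) (hE : E ≠ 0) :
    numWeights C = 3 := by
  have hp : p.Prime := Fact.out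
  have hp0 : (p : ℝ) ≠ 0 := by exact_mod_cast hp.ne_zero
  have hp1 : (p : ℝ) - 1 ≠ 0 := by
    rw [sub_ne_zero]
    exact_mod_cast hp.ne_one
  have h3 : (p - 1 : ℝ) ≠ (p - 1) ^ 2 / p := by
    intro h
    rw [eq_div_iff hp0, pow_two] at h
    have := mul_left_cancel₀ hp1 h
    linarith
  refine numWeights_eq_length h ?_ ?_
  · intro r hr
    simp only [List.mem_cons, List.not_mem_nil, or_false] at hr
    rcases hr with rfl | rfl | rfl <;> assumption
  · simp [hE, hp1, hp0, h3]

theorem hasWeightTable_of_zero_row {ι : Type*} [Fintype ι] {C : Submodule (ZMod p) (ι → ZMod p)}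
    {r₀ r₁ : ℝ × ℝ} {w : ℝ} {T : List (ℝ × ℝ)} (h : HasWeightTable C (r₀ :: r₁ :: (w, 0) :: T)) :
    HasWeightTable C (r₀ :: r₁ :: T) := by
  refine ⟨fun r hr => h.1 r ?_, fun v => ?_⟩
  · simp only [List.mem_cons] at hr ⊢
    tauto
  · rw [h.2 v]
    simp

theorem mul_card_dual_add_dual_eq_zero (hp4 : p % 4 = 1) {m s t r : ℕ}
    (hF : Fintype.card F = p ^ m) (hr : s + t = 2 * r) {f g : F → ZMod p} (hf : IsWRP p m s f)
    (hg : IsWRP p m t g) :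
    (p : ℤ) * #{x ∈ supp p m s f ×ˢ supp p m t g | dual p m s f x.1 + dual p m t g x.2 = 0}
      = p ^ (2 * (m - r)) + (p - 1) * (sign p m s f * sign p m t g * p ^ (m - r)) := by
  have h1 := hf.weaklyRegular.1.1
  have h2 := hg.weaklyRegular.1.1
  have h := mul_card_fiber_eq_of_sum_eq (supp p m s f ×ˢ supp p m t g)
    (fun x => dual p m s f x.1 + dual p m t g x.2)
    (sign p m s f * sign p m t g * p ^ (m - r)) 0 (by
      have e := sqrt_pow_two_mul p (m - r)
      rw [show 2 * (m - r) = (m - s) + (m - t) by omega, pow_add] at e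
      rw [Int.cast_mul, ← e, Finset.sum_product]
      simp only [AddChar.map_add_eq_mul]
      rw [← Finset.sum_mul_sum, sum_stdAddChar_dual hp4 hF hf, sum_stdAddChar_dual hp4 hF hg,
        AddChar.map_zero_eq_one]
      push_cast
      ring) 0
  rw [h, card_supp_prod hF hr hf hg, if_pos rfl]
  push_cast
  ring

theorem card_dual_eq_zero_and (m s t : ℕ) (f g : F → ZMod p) :
    #{x ∈ supp p m s f ×ˢ supp p m t g | dual p m s f x.1 = 0 ∧ dual p m t g x.2 = 0}
      = dualCount p m s f 0 * dualCount p m t g 0 := by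
  rw [dualCount_eq, dualCount_eq, ← Finset.card_product]
  congr 1
  ext x
  simp only [Finset.mem_filter, Finset.mem_product]
  tauto

/-- Multiplication of the first coordinate by a nonsquare exchanges the two kinds of pairs `(a, b)`
for which `f^⋆ a * g^⋆ b` is a nonzero square. -/
theorem two_mul_card_scalarCount_eq_four (h8 : p % 8 = 5) {m s t : ℕ} {f g : F → ZMod p}
    (hf : IsWRP p m s f) (hk : IsIndex p m s f 2) :
    2 * #{x ∈ supp p m s f ×ˢ supp p m t g | (dual p m s f x.1 * dual p m t g x.2 ≠ 0 ∧
      IsSquare (dual p m s f x.1 * dual p m t g x.2)) ∧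
      scalarCount 2 ((p - 1) / 2) (dual p m s f x.1) (dual p m t g x.2) = 4}
    = F₃ p m s t f g := by
  classical
  have hp4 : p % 4 = 1 := by omega
  obtain ⟨z, hzs⟩ := FiniteField.exists_nonsquare (F := ZMod p)
    (by rw [ZMod.ringChar_zmod_n]; omega)
  have hz : z ≠ 0 := by
    rintro rfl
    exact hzs IsSquare.zero
  have hzn : z ^ ((p - 1) / 2) = -1 := by
    rcases pow_half_eq_one_or_neg_one hp4 hz with h | h
    · exact absurd ((isSquare_iff_pow_half hp4 hz).2 h) hzs
    · exact h
  rw [F₃_eq_card]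
  set S := (supp p m s f ×ˢ supp p m t g).filter fun x => dual p m s f x.1 * dual p m t g x.2 ≠ 0 ∧
    IsSquare (dual p m s f x.1 * dual p m t g x.2) with hS
  have hsplit := Finset.card_filter_add_card_filter_not (s := S) (fun x =>
    scalarCount 2 ((p - 1) / 2) (dual p m s f x.1) (dual p m t g x.2) = 4)
  have hmem : ∀ x ∈ S, ((z • x.1, x.2) : F × F) ∈ S ∧
      scalarCount 2 ((p - 1) / 2) (dual p m s f x.1) (dual p m t g x.2)
        + scalarCount 2 ((p - 1) / 2) (dual p m s f (z • x.1)) (dual p m t g x.2) = 4 := by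
    intro x hx
    obtain ⟨hx, h0, hsq⟩ := Finset.mem_filter.1 hx
    obtain ⟨h1, h2⟩ := Finset.mem_product.1 hx
    have hd := hk.2.2.2 z hz x.1 (mem_supp.1 h1)
    refine ⟨Finset.mem_filter.2 ⟨Finset.mem_product.2 ⟨smul_mem_supp hf hz h1, h2⟩, ?_⟩, ?_⟩
    · simp only [hd, mul_assoc]
      exact ⟨mul_ne_zero (pow_ne_zero 2 hz) h0, (IsSquare.sq z).mul hsq⟩
    · rw [hd, scalarCount_sq_mul hz hzn]
      exact scalarCount_add_scalarCount_neg hp4 h0 hsq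
  have hinj : ∀ T : Set (F × F), Set.InjOn (fun x : F × F => (z • x.1, x.2)) T := by
    intro T x _ y _ h
    obtain ⟨h1, h2⟩ := Prod.mk.inj h
    exact Prod.ext (smul_right_injective F hz h1) h2
  have hval : ∀ x ∈ S, scalarCount 2 ((p - 1) / 2) (dual p m s f x.1) (dual p m t g x.2) = 0 ∨
      scalarCount 2 ((p - 1) / 2) (dual p m s f x.1) (dual p m t g x.2) = 4 := fun x hx =>
    scalarCount_two_half_of_mod_eight_eq_five h8 (Finset.mem_filter.1 hx).2.1
      (Finset.mem_filter.1 hx).2.2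
  have hle1 := Finset.card_le_card_of_injOn (s := S.filter fun x =>
      scalarCount 2 ((p - 1) / 2) (dual p m s f x.1) (dual p m t g x.2) = 4)
    (t := S.filter fun x =>
      ¬ scalarCount 2 ((p - 1) / 2) (dual p m s f x.1) (dual p m t g x.2) = 4)
    (fun x => (z • x.1, x.2)) (by
      intro x hx
      obtain ⟨hx, h4⟩ := Finset.mem_filter.1 (Finset.mem_coe.1 hx)
      obtain ⟨h1, h2⟩ := hmem x hx
      refine Finset.mem_coe.2 (Finset.mem_filter.2 ⟨h1, ?_⟩)
      dsimp only
      omega) (hinj _)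
  have hle2 := Finset.card_le_card_of_injOn (s := S.filter fun x =>
      ¬ scalarCount 2 ((p - 1) / 2) (dual p m s f x.1) (dual p m t g x.2) = 4)
    (t := S.filter fun x =>
      scalarCount 2 ((p - 1) / 2) (dual p m s f x.1) (dual p m t g x.2) = 4)
    (fun x => (z • x.1, x.2)) (by
      intro x hx
      obtain ⟨hx, h4⟩ := Finset.mem_filter.1 (Finset.mem_coe.1 hx)
      obtain ⟨h1, h2⟩ := hmem x hx
      have h3 := hval x hx
      refine Finset.mem_coe.2 (Finset.mem_filter.2 ⟨h1, ?_⟩)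
      dsimp only
      omega) (hinj _)
  rw [← Finset.filter_filter (fun x : F × F => dual p m s f x.1 * dual p m t g x.2 ≠ 0 ∧
    IsSquare (dual p m s f x.1 * dual p m t g x.2))]
  rw [← hS]
  omega

/-- The weight table and the number of weights when the number of scalars is `p - 1` for
`f^⋆ a = g^⋆ b = 0`, `κ` on a set `M` of pairs `(a, b)` with `f^⋆ a`, `g^⋆ b` not both zero,
and `0` for the other pairs. -/
theorem hasWeightTable_and_numWeights [DecidableEq F] (hp4 : p % 4 = 1) {m s t r : ℕ} (hm : 1 ≤ m)
    (hF : Fintype.card F = p ^ m) (hr : s + t = 2 * r) {f g : F → ZMod p} (hf : IsWRP p m s f)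
    (hg : IsWRP p m t g) {k l : ℕ} (hk : IsIndex p m s f k) (hl : IsIndex p m t g l)
    (hinj : Function.Injective (encode p f g)) {M : Finset (F × F)} {κ : ℕ}
    (hM : M ⊆ supp p m s f ×ˢ supp p m t g)
    (hM0 : ∀ x ∈ M, ¬ (dual p m s f x.1 = 0 ∧ dual p m t g x.2 = 0))
    (hMκ : ∀ x ∈ M, scalarCount k l (dual p m s f x.1) (dual p m t g x.2) = κ)
    (hrest : ∀ x ∈ supp p m s f ×ˢ supp p m t g,
      ¬ (dual p m s f x.1 = 0 ∧ dual p m t g x.2 = 0) → x ∉ M →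
      scalarCount k l (dual p m s f x.1) (dual p m t g x.2) = 0) :
    HasWeightTable (code p f g) [(0, 1),
      ((p - 1) * p ^ (2 * m - 2), (dualCount p m s f 0 : ℝ) * dualCount p m t g 0 - 1),
      ((p - 1) * p ^ (2 * m - 2)
        + (p - 1 - κ) * (sign p m s f * sign p m t g) * ((p : ℝ) ^ (m + r) / p), (#M : ℝ)),
      ((p - 1) * (p ^ (2 * m - 2) + (sign p m s f * sign p m t g) * ((p : ℝ) ^ (m + r) / p)),
        (p : ℝ) ^ (2 * (m - r)) - (dualCount p m s f 0 : ℝ) * dualCount p m t g 0 - #M),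
      ((p - 1) * (p ^ (2 * m - 2)
        + (p - 1) * (sign p m s f * sign p m t g) * ((p : ℝ) ^ (m + r) / p ^ 2)),
        (p : ℝ) ^ (2 * m) - p ^ (2 * (m - r)))] ∧
    (0 < κ → κ < p - 1 → 0 < r → 1 < dualCount p m s f 0 * dualCount p m t g 0 →
      M.Nonempty → (∃ x ∈ supp p m s f ×ˢ supp p m t g,
        ¬ (dual p m s f x.1 = 0 ∧ dual p m t g x.2 = 0) ∧ x ∉ M) →
      numWeights (code p f g) = 4) := by
  have hf0 := dual_zero hp4 hF hf hk
  have hg0 := dual_zero hp4 hF hg hl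
  have hp : p.Prime := Fact.out
  have hp1 : (1 : ℝ) < p := by exact_mod_cast hp.one_lt
  set Z := (supp p m s f ×ˢ supp p m t g).filter
    (fun x => dual p m s f x.1 = 0 ∧ dual p m t g x.2 = 0) with hZdef
  have hZ : Z ⊆ supp p m s f ×ˢ supp p m t g := Finset.filter_subset _ _
  have hZM : Disjoint Z M := by
    rw [Finset.disjoint_left]
    intro x hx hxM
    exact hM0 x hxM (Finset.mem_filter.1 hx).2
  have hZcard : (#Z : ℝ) = (dualCount p m s f 0 : ℝ) * dualCount p m t g 0 := by
    rw [hZdef, card_dual_eq_zero_and, Nat.cast_mul]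
  have h := hasWeightTable_code hp4 hm hF hr hf hg hk hl hinj (Z := Z) (M := M) (κ := κ)
    (Finset.mem_filter.2 ⟨Finset.mem_product.2 ⟨zero_mem_supp hf, zero_mem_supp hg⟩, hf0, hg0⟩)
    hZ hM hZM
    (fun x hx => by
      obtain ⟨-, h1, h2⟩ := Finset.mem_filter.1 hx
      rw [h1, h2, scalarCount_zero_zero]) hMκ
    (fun x hx hxZ hxM => hrest x hx (fun h0 => hxZ (Finset.mem_filter.2 ⟨hx, h0⟩)) hxM)
  rw [hZcard] at h
  refine ⟨h, fun hκ hκ1 hr0 hN hMne ⟨x, hx, hx0, hxM⟩ => ?_⟩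
  have hκR : (κ : ℝ) < p - 1 := by
    have : (κ : ℝ) < ((p - 1 : ℕ) : ℝ) := by exact_mod_cast hκ1
    rwa [Nat.cast_sub hp.one_le, Nat.cast_one] at this
  have hE : (sign p m s f * sign p m t g : ℝ) * ((p : ℝ) ^ (m + r) / p) ≠ 0 := by
    have h1 : (sign p m s f : ℝ) ≠ 0 := by
      rcases (isSignDual_sign_dual hp4 hf).1 with h | h <;> simp [h]
    have h2 : (sign p m t g : ℝ) ≠ 0 := by
      rcases (isSignDual_sign_dual hp4 hg).1 with h | h <;> simp [h]
    exact mul_ne_zero (mul_ne_zero h1 h2) (by positivity)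
  have hlt : #Z + #M < #(supp p m s f ×ˢ supp p m t g) := by
    rw [← Finset.card_union_of_disjoint hZM]
    refine Finset.card_lt_card (Finset.ssubset_iff_subset_ne.2 ⟨Finset.union_subset hZ hM, ?_⟩)
    intro he
    rw [← he, Finset.mem_union] at hx
    rcases hx with hx | hx
    · exact hx0 (Finset.mem_filter.1 hx).2
    · exact hxM hx
  refine numWeights_eq_four (x := (p - 1) * (p : ℝ) ^ (2 * m - 2))
    (E := (sign p m s f * sign p m t g : ℝ) * ((p : ℝ) ^ (m + r) / p)) (κ := κ)
    (a := (dualCount p m s f 0 : ℝ) * dualCount p m t g 0 - 1) (b := #M)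
    (c := (p : ℝ) ^ (2 * (m - r)) - (dualCount p m s f 0 : ℝ) * dualCount p m t g 0 - #M)
    (d := (p : ℝ) ^ (2 * m) - p ^ (2 * (m - r))) ?_ ?_ ?_ ?_ ?_ hE ?_ ?_ ?_
  · have hp0 : (p : ℝ) ≠ 0 := by positivity
    have e1 : (p - 1) * (p : ℝ) ^ (2 * m - 2)
        + (p - 1 - κ) * ((sign p m s f * sign p m t g : ℝ) * ((p : ℝ) ^ (m + r) / p))
        = (p - 1) * p ^ (2 * m - 2)
          + (p - 1 - κ) * (sign p m s f * sign p m t g) * ((p : ℝ) ^ (m + r) / p) := by ring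
    have e2 : (p - 1) * (p : ℝ) ^ (2 * m - 2)
        + (p - 1) * ((sign p m s f * sign p m t g : ℝ) * ((p : ℝ) ^ (m + r) / p))
        = (p - 1) * (p ^ (2 * m - 2)
          + (sign p m s f * sign p m t g) * ((p : ℝ) ^ (m + r) / p)) := by ring
    have e3 : (p - 1) * (p : ℝ) ^ (2 * m - 2)
        + (p - 1) ^ 2 / p * ((sign p m s f * sign p m t g : ℝ) * ((p : ℝ) ^ (m + r) / p))
        = (p - 1) * (p ^ (2 * m - 2)
          + (p - 1) * (sign p m s f * sign p m t g) * ((p : ℝ) ^ (m + r) / p ^ 2)) := by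
      field_simp
    rw [e1, e2, e3]
    exact h
  · rw [sub_pos]
    exact_mod_cast hN
  · exact_mod_cast Finset.card_pos.2 hMne
  · rw [← hZcard]
    have := card_supp_prod hF hr hf hg
    rw [this] at hlt
    have : ((#Z + #M : ℕ) : ℝ) < ((p ^ (2 * (m - r)) : ℕ) : ℝ) := by exact_mod_cast hlt
    push_cast at this
    linarith
  · rw [sub_pos]
    exact pow_lt_pow_right₀ hp1 (by omega)
  · exact_mod_cast hκ.ne'
  · linarith
  · intro h0
    -- `(p - 1) ^ 2` is `1` modulo `p`
    have h1 : (p : ℤ) * (p - 1 - κ) = (p - 1) ^ 2 := by exact_mod_cast h0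
    have h2 : (p : ℤ) ∣ 1 := ⟨1 - κ, by linear_combination -h1⟩
    have := Int.le_of_dvd one_pos h2
    have := hp.two_le
    omega

/-- The case `l_f = l_g`: the number of scalars is `p - 1` if `f^⋆ a + g^⋆ b = 0` and `0` otherwise,
so that the frequencies follow from the character sum of `f^⋆ a + g^⋆ b`. -/
theorem hasWeightTable_and_numWeights_half [DecidableEq F] (hp4 : p % 4 = 1) {m s t r : ℕ}
    (hm : 1 ≤ m) (hF : Fintype.card F = p ^ m) (hr : s + t = 2 * r) {f g : F → ZMod p}
    (hf : IsWRP p m s f) (hg : IsWRP p m t g) {k : ℕ} (hk : IsIndex p m s f k)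
    (hl : IsIndex p m t g k) (he : sign p m s f * sign p m t g = 1 ∨ r + 2 ≤ m) :
    HasWeightTable (code p f g) [(0, 1),
      ((p - 1) * p ^ (2 * m - 2),
        (p : ℝ) ^ (2 * (m - r)) / p
          + (p - 1) * (sign p m s f * sign p m t g) * ((p : ℝ) ^ (m - r) / p) - 1),
      ((p - 1) * (p ^ (2 * m - 2) + (sign p m s f * sign p m t g) * ((p : ℝ) ^ (m + r) / p)),
        (p - 1) * ((p : ℝ) ^ (2 * (m - r)) / p
          - (sign p m s f * sign p m t g) * ((p : ℝ) ^ (m - r) / p))),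
      ((p - 1) * (p ^ (2 * m - 2)
        + (p - 1) * (sign p m s f * sign p m t g) * ((p : ℝ) ^ (m + r) / p ^ 2)),
        (p : ℝ) ^ (2 * m) - p ^ (2 * (m - r)))] ∧
    (0 < r → r < m → numWeights (code p f g) = 3) := by
  have hf0 := dual_zero hp4 hF hf hk
  have hg0 := dual_zero hp4 hF hg hl
  have hp : p.Prime := Fact.out
  have hpz : (2 : ℤ) ≤ p := by exact_mod_cast hp.two_le
  have hp0 : (p : ℝ) ≠ 0 := by exact_mod_cast hp.ne_zero
  have hp1 : (1 : ℝ) < p := by exact_mod_cast hp.one_lt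
  have hcard := mul_card_dual_add_dual_eq_zero hp4 hF hr hf hg
  set Z := (supp p m s f ×ˢ supp p m t g).filter
    (fun x => dual p m s f x.1 + dual p m t g x.2 = 0) with hZ
  have h := hasWeightTable_of_zero_row (by
    simpa using hasWeightTable_code hp4 hm hF hr hf hg hk hl
      (encode_injective hp4 hF hr hf hg hk hl he)
      (Z := Z) (M := ∅) (κ := 0)
      (Finset.mem_filter.2 ⟨Finset.mem_product.2 ⟨zero_mem_supp hf, zero_mem_supp hg⟩, by
        rw [hf0, hg0, add_zero]⟩)
      (Finset.filter_subset _ _) (Finset.empty_subset _) (Finset.disjoint_empty_right _)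
      (fun x hx => by rw [scalarCount_self, if_pos (Finset.mem_filter.1 hx).2])
      (fun x hx => absurd hx (Finset.notMem_empty x))
      (fun x hx hxZ _ => by
        rw [scalarCount_self, if_neg fun h0 => hxZ (Finset.mem_filter.2 ⟨hx, h0⟩)]))
  have hZR : (p : ℝ) * #Z = p ^ (2 * (m - r))
      + (p - 1) * (sign p m s f * sign p m t g * p ^ (m - r)) := by exact_mod_cast hcard
  have hZR' : (#Z : ℝ) = (p : ℝ) ^ (2 * (m - r)) / p
      + (p - 1) * (sign p m s f * sign p m t g) * ((p : ℝ) ^ (m - r) / p) := by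
    apply mul_left_cancel₀ hp0
    rw [hZR]
    field_simp
  have e1 : (p - 1) * ((p : ℝ) ^ (2 * (m - r)) / p
      - (sign p m s f * sign p m t g) * ((p : ℝ) ^ (m - r) / p))
      = (p : ℝ) ^ (2 * (m - r)) - #Z := by
    rw [hZR']
    field_simp
    ring
  rw [e1, ← hZR']
  refine ⟨h, fun hr0 hrm => ?_⟩
  have hsgn : sign p m s f * sign p m t g = 1 ∨ sign p m s f * sign p m t g = -1 := by
    rcases (isSignDual_sign_dual hp4 hf).1 with h1 | h1 <;>
      rcases (isSignDual_sign_dual hp4 hg).1 with h2 | h2 <;> simp [h1, h2]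
  have hE : (sign p m s f * sign p m t g : ℝ) * ((p : ℝ) ^ (m + r) / p) ≠ 0 := by
    refine mul_ne_zero ?_ (by positivity)
    rcases hsgn with h | h <;> rw [← Int.cast_mul, h] <;> norm_num
  have hP1 : (p : ℤ) ≤ p ^ (m - r) := le_self_pow₀ (by omega) (by omega)
  have hP2 : sign p m s f * sign p m t g ≠ 1 → (p : ℤ) * p ≤ p ^ (m - r) := by
    intro h
    have := he.resolve_left h
    rw [← pow_two]
    exact pow_le_pow_right₀ (by omega) (by omega)
  rw [show 2 * (m - r) = (m - r) + (m - r) by omega, pow_add] at hcard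
  have hZ1 : 1 < (#Z : ℤ) := by
    refine lt_of_mul_lt_mul_left (a := (p : ℤ)) ?_ (by omega)
    rw [hcard]
    rcases hsgn with h | h
    · rw [h]
      nlinarith
    · rw [h]
      have := hP2 (by rw [h]; norm_num)
      nlinarith
  have hZ2 : (#Z : ℤ) < p ^ (m - r) * p ^ (m - r) := by
    refine lt_of_mul_lt_mul_left (a := (p : ℤ)) ?_ (by omega)
    rw [hcard]
    have h3 : 0 < ((p : ℤ) - 1) * p ^ (m - r) := mul_pos (by omega) (by omega)
    rcases hsgn with h | h
    · rw [h]
      nlinarith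
    · rw [h]
      nlinarith
  refine numWeights_eq_three (x := (p - 1) * (p : ℝ) ^ (2 * m - 2))
    (E := (sign p m s f * sign p m t g : ℝ) * ((p : ℝ) ^ (m + r) / p))
    (a := #Z - 1) (c := (p : ℝ) ^ (2 * (m - r)) - #Z)
    (d := (p : ℝ) ^ (2 * m) - p ^ (2 * (m - r))) ?_ ?_ ?_ ?_ hE
  · have e2 : (p - 1) * (p : ℝ) ^ (2 * m - 2)
        + (p - 1) * ((sign p m s f * sign p m t g : ℝ) * ((p : ℝ) ^ (m + r) / p))
        = (p - 1) * (p ^ (2 * m - 2)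
          + (sign p m s f * sign p m t g) * ((p : ℝ) ^ (m + r) / p)) := by ring
    have e3 : (p - 1) * (p : ℝ) ^ (2 * m - 2)
        + (p - 1) ^ 2 / p * ((sign p m s f * sign p m t g : ℝ) * ((p : ℝ) ^ (m + r) / p))
        = (p - 1) * (p ^ (2 * m - 2)
          + (p - 1) * (sign p m s f * sign p m t g) * ((p : ℝ) ^ (m + r) / p ^ 2)) := by
      field_simp
    rw [e2, e3]
    exact h
  · rw [sub_pos]
    exact_mod_cast hZ1
  · rw [sub_pos, show 2 * (m - r) = (m - r) + (m - r) by omega, pow_add]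
    exact_mod_cast hZ2
  · rw [sub_pos]
    exact pow_lt_pow_right₀ hp1 (by omega)

theorem hasWeightTable_and_numWeights_sub_one [DecidableEq F] (hp4 : p % 4 = 1) {m s t r : ℕ}
    (hm : 1 ≤ m) (hF : Fintype.card F = p ^ m) (hr : s + t = 2 * r) {f g : F → ZMod p}
    (hf : IsWRP p m s f) (hg : IsWRP p m t g) (hk : IsIndex p m s f (p - 1))
    (hl : IsIndex p m t g ((p - 1) / 2))
    (he : sign p m s f * sign p m t g = 1 ∨ r + 2 ≤ m) :
    HasWeightTable (code p f g) [(0, 1),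
      ((p - 1) * p ^ (2 * m - 2), (dualCount p m s f 0 : ℝ) * dualCount p m t g 0 - 1),
      ((p - 1) * (p ^ (2 * m - 2)
        + 1 / 2 * (sign p m s f * sign p m t g) * ((p : ℝ) ^ (m + r) / p)),
        (F₁ p m s t f g : ℝ)),
      ((p - 1) * (p ^ (2 * m - 2) + (sign p m s f * sign p m t g) * ((p : ℝ) ^ (m + r) / p)),
        (p : ℝ) ^ (2 * (m - r)) - (dualCount p m s f 0 : ℝ) * dualCount p m t g 0
          - F₁ p m s t f g),
      ((p - 1) * (p ^ (2 * m - 2)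
        + (p - 1) * (sign p m s f * sign p m t g) * ((p : ℝ) ^ (m + r) / p ^ 2)),
        (p : ℝ) ^ (2 * m) - p ^ (2 * (m - r)))] ∧
    (0 < r → s < m → t < m → numWeights (code p f g) = 4) := by
  have hp : p.Prime := Fact.out
  have hp5 : 5 ≤ p := by
    have := hp.two_le
    omega
  have h := hasWeightTable_and_numWeights hp4 hm hF hr hf hg hk hl
    (encode_injective hp4 hF hr hf hg hk hl he) (κ := (p - 1) / 2)
    (M := {x ∈ supp p m s f ×ˢ supp p m t g | dual p m s f x.1 ≠ 0 ∧
      (dual p m t g x.2 = dual p m s f x.1 ∨ dual p m t g x.2 = -dual p m s f x.1)})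
    (Finset.filter_subset _ _) (fun x hx h => (Finset.mem_filter.1 hx).2.1 h.1)
    (fun x hx => by
      obtain ⟨-, h1, h2⟩ := Finset.mem_filter.1 hx
      rw [scalarCount_sub_one_half hp4 h1, if_pos h2])
    (fun x hx h0 hxM => by
      by_cases h1 : dual p m s f x.1 = 0
      · rw [h1]
        exact scalarCount_eq_zero_of_left fun h2 => h0 ⟨h1, h2⟩
      · rw [scalarCount_sub_one_half hp4 h1,
          if_neg fun h2 => hxM (Finset.mem_filter.2 ⟨hx, h1, h2⟩)])
  rw [← F₁_eq_card] at h
  have hhalf : (((p - 1) / 2 : ℕ) : ℝ) = (p - 1) / 2 := by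
    have h2 : p = 2 * ((p - 1) / 2) + 1 := by omega
    have h3 : (p : ℝ) = 2 * (((p - 1) / 2 : ℕ) : ℝ) + 1 := by exact_mod_cast h2
    linarith
  refine ⟨?_, fun hr0 hs ht => ?_⟩
  · have e1 : (p - 1) * ((p : ℝ) ^ (2 * m - 2)
        + 1 / 2 * (sign p m s f * sign p m t g) * ((p : ℝ) ^ (m + r) / p))
        = (p - 1) * p ^ (2 * m - 2) + (p - 1 - (((p - 1) / 2 : ℕ) : ℝ))
          * (sign p m s f * sign p m t g) * ((p : ℝ) ^ (m + r) / p) := by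
      rw [hhalf]
      ring
    rw [e1]
    exact h.1
  · -- the index forces `m - s` to be even and `ε_f = 1`
    obtain ⟨⟨u, hu⟩, hε⟩ := even_and_sign_eq_one_of_index_sub_one hp4 hF hf hk
    have hv : m - t = 2 * (m - r - u) := by omega
    have hN0 := one_lt_dualCount_zero hp4 hF hf (by omega) hu hε
    have hf' := fun c => dualCount_pos_of_even hp4 hF hf (k := u) (by omega) hu c
    have hg' := fun c => dualCount_pos_of_even hp4 hF hg (by omega) hv c
    obtain ⟨a, ha, hda⟩ := exists_dual_eq (hf' 1)
    obtain ⟨a₀, ha₀, hda₀⟩ := exists_dual_eq (hf' 0)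
    obtain ⟨b, hb, hdb⟩ := exists_dual_eq (hg' 1)
    refine h.2 (by omega) (by omega) hr0 (hN0.trans_le (Nat.le_mul_of_pos_right _ (hg' 0)))
      ⟨(a, b), ?_⟩ ⟨(a₀, b), Finset.mem_product.2 ⟨ha₀, hb⟩, ?_, ?_⟩
    · refine Finset.mem_filter.2 ⟨Finset.mem_product.2 ⟨ha, hb⟩, ?_⟩
      simp [hda, hdb]
    · simp [hdb]
    · simp [hda₀]

/-- For `p ≠ 5`, the index `(p - 1) / 2` of `g` forces `m - t`, and with it `m - s`, to be even. -/
theorem one_lt_mul_dualCount_of_index_half (hp4 : p % 4 = 1) (hp5 : p ≠ 5) {m s t r : ℕ}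
    (hF : Fintype.card F = p ^ m) (hr : s + t = 2 * r) {f g : F → ZMod p} (hf : IsWRP p m s f)
    (hg : IsWRP p m t g) (hl : IsIndex p m t g ((p - 1) / 2)) (hs : s < m) (ht : t < m) :
    1 < dualCount p m s f 0 * dualCount p m t g 0 ∧ (∀ c, 0 < dualCount p m s f c) ∧
      ∀ c, 0 < dualCount p m t g c := by
  obtain ⟨⟨u, hu⟩, hε⟩ := even_and_sign_eq_one_of_index_half hp4 hp5 hF hg hl
  have hv : m - s = 2 * (m - r - u) := by omega
  have hf' := fun c => dualCount_pos_of_even hp4 hF hf (by omega) hv c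
  exact ⟨(one_lt_dualCount_zero hp4 hF hg (by omega) hu hε).trans_le
    (Nat.le_mul_of_pos_left _ (hf' 0)), hf',
    fun c => dualCount_pos_of_even hp4 hF hg (k := u) (by omega) hu c⟩

theorem exists_dual_mul_not_isSquare (hp4 : p % 4 = 1) {m s t : ℕ} {f g : F → ZMod p}
    (hf : ∀ c, 0 < dualCount p m s f c) (hg : ∀ c, 0 < dualCount p m t g c) :
    ∃ x ∈ supp p m s f ×ˢ supp p m t g, ¬ IsSquare (dual p m s f x.1 * dual p m t g x.2) := by
  obtain ⟨z, hz⟩ := FiniteField.exists_nonsquare (F := ZMod p)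
    (by rw [ZMod.ringChar_zmod_n]; omega)
  obtain ⟨a, ha, hda⟩ := exists_dual_eq (hf z)
  obtain ⟨b, hb, hdb⟩ := exists_dual_eq (hg 1)
  refine ⟨(a, b), Finset.mem_product.2 ⟨ha, hb⟩, ?_⟩
  simpa only [hda, hdb, mul_one] using hz

open Classical in
theorem hasWeightTable_and_numWeights_two_of_mod_eight_eq_one [DecidableEq F] (h8 : p % 8 = 1)
    {m s t r : ℕ} (hm : 1 ≤ m) (hF : Fintype.card F = p ^ m) (hr : s + t = 2 * r)
    {f g : F → ZMod p} (hf : IsWRP p m s f) (hg : IsWRP p m t g) (hk : IsIndex p m s f 2)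
    (hl : IsIndex p m t g ((p - 1) / 2))
    (he : sign p m s f * sign p m t g = 1 ∨ r + 2 ≤ m) :
    HasWeightTable (code p f g) [(0, 1),
      ((p - 1) * p ^ (2 * m - 2), (dualCount p m s f 0 : ℝ) * dualCount p m t g 0 - 1),
      ((p - 1) * p ^ (2 * m - 2)
        + (p - 3) * (sign p m s f * sign p m t g) * ((p : ℝ) ^ (m + r) / p),
        (F₃ p m s t f g : ℝ)),
      ((p - 1) * (p ^ (2 * m - 2) + (sign p m s f * sign p m t g) * ((p : ℝ) ^ (m + r) / p)),
        (p : ℝ) ^ (2 * (m - r)) - (dualCount p m s f 0 : ℝ) * dualCount p m t g 0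
          - F₃ p m s t f g),
      ((p - 1) * (p ^ (2 * m - 2)
        + (p - 1) * (sign p m s f * sign p m t g) * ((p : ℝ) ^ (m + r) / p ^ 2)),
        (p : ℝ) ^ (2 * m) - p ^ (2 * (m - r)))] ∧
    (0 < r → s < m → t < m → numWeights (code p f g) = 4) := by
  have hp4 : p % 4 = 1 := by omega
  have hp : p.Prime := Fact.out
  have h := hasWeightTable_and_numWeights hp4 hm hF hr hf hg hk hl
    (encode_injective hp4 hF hr hf hg hk hl he) (κ := 2)
    (M := {x ∈ supp p m s f ×ˢ supp p m t g | dual p m s f x.1 * dual p m t g x.2 ≠ 0 ∧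
      IsSquare (dual p m s f x.1 * dual p m t g x.2)})
    (Finset.filter_subset _ _)
    (fun x hx h => (Finset.mem_filter.1 hx).2.1 (by rw [h.1, zero_mul]))
    (fun x hx => by
      obtain ⟨-, h1, h2⟩ := Finset.mem_filter.1 hx
      exact scalarCount_two_half_of_mod_eight_eq_one h8 h1 h2)
    (fun x hx h0 hxM => by
      by_cases h1 : dual p m s f x.1 = 0
      · rw [h1]
        exact scalarCount_eq_zero_of_left fun h2 => h0 ⟨h1, h2⟩
      by_cases h2 : dual p m t g x.2 = 0
      · rw [h2]
        exact scalarCount_eq_zero_of_right h1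
      exact scalarCount_two_half_eq_zero hp4 fun h3 =>
        hxM (Finset.mem_filter.2 ⟨hx, mul_ne_zero h1 h2, h3⟩))
  rw [← F₃_eq_card] at h
  refine ⟨?_, fun hr0 hs ht => ?_⟩
  · have e1 : (p - 3 : ℝ) = p - 1 - ((2 : ℕ) : ℝ) := by
      push_cast
      ring
    rw [e1]
    exact h.1
  · obtain ⟨hN, hf', hg'⟩ :=
      one_lt_mul_dualCount_of_index_half hp4 (by omega) hF hr hf hg hl hs ht
    obtain ⟨x, hx, hxs⟩ := exists_dual_mul_not_isSquare hp4 hf' hg'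
    obtain ⟨a, ha, hda⟩ := exists_dual_eq (hf' 1)
    obtain ⟨b, hb, hdb⟩ := exists_dual_eq (hg' 1)
    have := hp.two_le
    refine h.2 (by omega) (by omega) hr0 hN ⟨(a, b), ?_⟩ ⟨x, hx, ?_, ?_⟩
    · refine Finset.mem_filter.2 ⟨Finset.mem_product.2 ⟨ha, hb⟩, ?_⟩
      simp [hda, hdb]
    · rintro ⟨h1, -⟩
      exact hxs (by simp [h1])
    · exact fun hxM => hxs (Finset.mem_filter.1 hxM).2.2

open Classical in
theorem hasWeightTable_and_numWeights_two_of_mod_eight_eq_five [DecidableEq F] (h8 : p % 8 = 5)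
    {m s t r : ℕ} (hm : 1 ≤ m) (hF : Fintype.card F = p ^ m) (hr : s + t = 2 * r)
    {f g : F → ZMod p} (hf : IsWRP p m s f) (hg : IsWRP p m t g) (hk : IsIndex p m s f 2)
    (hl : IsIndex p m t g ((p - 1) / 2))
    (he : sign p m s f * sign p m t g = 1 ∨ r + 2 ≤ m) :
    HasWeightTable (code p f g) [(0, 1),
      ((p - 1) * p ^ (2 * m - 2), (dualCount p m s f 0 : ℝ) * dualCount p m t g 0 - 1),
      ((p - 1) * p ^ (2 * m - 2)
        + (p - 5) * (sign p m s f * sign p m t g) * ((p : ℝ) ^ (m + r) / p),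
        1 / 2 * (F₃ p m s t f g : ℝ)),
      ((p - 1) * (p ^ (2 * m - 2) + (sign p m s f * sign p m t g) * ((p : ℝ) ^ (m + r) / p)),
        (p : ℝ) ^ (2 * (m - r)) - (dualCount p m s f 0 : ℝ) * dualCount p m t g 0
          - 1 / 2 * F₃ p m s t f g),
      ((p - 1) * (p ^ (2 * m - 2)
        + (p - 1) * (sign p m s f * sign p m t g) * ((p : ℝ) ^ (m + r) / p ^ 2)),
        (p : ℝ) ^ (2 * m) - p ^ (2 * (m - r)))] ∧
    (p ≠ 5 → 0 < r → s < m → t < m → numWeights (code p f g) = 4) := by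
  have hp4 : p % 4 = 1 := by omega
  have hp : p.Prime := Fact.out
  have hM := two_mul_card_scalarCount_eq_four (t := t) (g := g) h8 hf hk
  set M := (supp p m s f ×ˢ supp p m t g).filter fun x =>
    (dual p m s f x.1 * dual p m t g x.2 ≠ 0 ∧ IsSquare (dual p m s f x.1 * dual p m t g x.2)) ∧
      scalarCount 2 ((p - 1) / 2) (dual p m s f x.1) (dual p m t g x.2) = 4 with hMdef
  have h := hasWeightTable_and_numWeights hp4 hm hF hr hf hg hk hl
    (encode_injective hp4 hF hr hf hg hk hl he) (κ := 4) (M := M)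
    (Finset.filter_subset _ _)
    (fun x hx h => (Finset.mem_filter.1 hx).2.1.1 (by rw [h.1, zero_mul]))
    (fun x hx => (Finset.mem_filter.1 hx).2.2)
    (fun x hx h0 hxM => by
      by_cases h1 : dual p m s f x.1 = 0
      · rw [h1]
        exact scalarCount_eq_zero_of_left fun h2 => h0 ⟨h1, h2⟩
      by_cases h2 : dual p m t g x.2 = 0
      · rw [h2]
        exact scalarCount_eq_zero_of_right h1
      by_cases h3 : IsSquare (dual p m s f x.1 * dual p m t g x.2)
      · exact (scalarCount_two_half_of_mod_eight_eq_five h8 (mul_ne_zero h1 h2) h3).resolve_right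
          fun h4 => hxM (Finset.mem_filter.2 ⟨hx, ⟨mul_ne_zero h1 h2, h3⟩, h4⟩)
      · exact scalarCount_two_half_eq_zero hp4 h3)
  have hMR : 1 / 2 * (F₃ p m s t f g : ℝ) = #M := by
    rw [← hM]
    push_cast
    ring
  rw [hMR]
  refine ⟨?_, fun hp5 hr0 hs ht => ?_⟩
  · have e1 : (p - 5 : ℝ) = p - 1 - ((4 : ℕ) : ℝ) := by
      push_cast
      ring
    rw [e1]
    exact h.1
  · obtain ⟨hN, hf', hg'⟩ :=
      one_lt_mul_dualCount_of_index_half hp4 hp5 hF hr hf hg hl hs ht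
    obtain ⟨x, hx, hxs⟩ := exists_dual_mul_not_isSquare hp4 hf' hg'
    obtain ⟨a, ha, hda⟩ := exists_dual_eq (hf' 1)
    obtain ⟨b, hb, hdb⟩ := exists_dual_eq (hg' 1)
    have hF₃ : 0 < F₃ p m s t f g := by
      rw [F₃_eq_card]
      refine Finset.card_pos.2 ⟨(a, b), Finset.mem_filter.2 ⟨Finset.mem_product.2 ⟨ha, hb⟩, ?_⟩⟩
      simp [hda, hdb]
    have := hp.two_le
    refine h.2 (by omega) (by omega) hr0 hN (Finset.card_pos.1 (by omega)) ⟨x, hx, ?_, ?_⟩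
    · rintro ⟨h1, -⟩
      exact hxs (by simp [h1])
    · exact fun hxM => hxs (Finset.mem_filter.1 hxM).2.1.2

end Cases

end PlateauedCode

theorem mainTheorem2 (p : ℕ) [Fact p.Prime] (hp : p % 4 = 1)
    (m : ℕ) (hm : 2 ≤ m)
    {F : Type*} [Field F] [Fintype F] [DecidableEq F] [Algebra (ZMod p) F]
    (hF : Fintype.card F = p ^ m)
    (s t : ℕ) (f g : F → ZMod p) (hf : IsWRP p m s f) (hg : IsWRP p m t g)
    (hst : Even (s + t))
    (lf lg : ℕ) (hlf : IsIndex p m s f lf) (hlg : IsIndex p m t g lg)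
    (hlg_eq : lg = (p - 1) / 2)
    (τ γ : ℤ) (hτ : τ = 2 * m + s + t) (hγ : γ = 2 * m - s - t)
    (e : ℝ) (he : e = sign p m s f * sign p m t g)
    (N : ℝ) (hN : N = dualCount p m s f 0 * dualCount p m t g 0) :
    -- the length
    ((definingSet p f g).card : ℝ) =
      p ^ (2 * m - 1) - 1 + (p - 1) * e * √(p : ℝ) ^ (τ - 2) ∧
    -- the values of the quantities that occur in the tables
    (∀ c, (dualCount p m s f c : ℝ) = dualCountValue p m s (sign p m s f) c) ∧
    (∀ c, (dualCount p m t g c : ℝ) = dualCountValue p m t (sign p m t g) c) ∧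
    F₁ p m s t f g =
      2 * ∑ c ∈ Finset.univ.filter (fun c : ZMod p => c ≠ 0),
        dualCount p m s f c * dualCount p m t g c ∧
    (∀ i j : ZMod p, i ≠ 0 → IsSquare i → ¬ IsSquare j →
      (F₃ p m s t f g : ℝ) = ((p : ℝ) - 1) ^ 2 / 4 *
        (dualCount p m s f i * dualCount p m t g i
          + dualCount p m s f j * dualCount p m t g j)) ∧
    -- the dimension and the weights
    (¬ (γ = 2 ∧ e = -1) →
      Module.finrank (ZMod p) (code p f g) = 2 * m ∧
      (lf = (p - 1) / 2 →
        HasWeightTable (code p f g) (tableHalf p m τ γ e) ∧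
        (0 < s + t → s + t < 2 * m → numWeights (code p f g) = 3)) ∧
      (lf = p - 1 →
        HasWeightTable (code p f g) (tableFull p m τ γ e N (F₁ p m s t f g)) ∧
        (0 < s + t → s < m → t < m → numWeights (code p f g) = 4)) ∧
      (lf = 2 → p % 8 = 1 →
        HasWeightTable (code p f g) (tableTwoOne p m τ γ e N (F₃ p m s t f g)) ∧
        (0 < s + t → s < m → t < m → numWeights (code p f g) = 4)) ∧
      (lf = 2 → p % 8 = 5 →
        HasWeightTable (code p f g) (tableTwoFive p m τ γ e N (F₃ p m s t f g)) ∧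
        (p ≠ 5 → 0 < s + t → s < m → t < m → numWeights (code p f g) = 4))) := by
  have hpp : p.Prime := Fact.out
  have hp0 : (p : ℝ) ≠ 0 := by exact_mod_cast hpp.ne_zero
  have hpos := hpp.pos
  obtain ⟨r, hr⟩ := hst
  rw [← two_mul] at hr
  have hs := hf.weaklyRegular.1.1
  have ht := hg.weaklyRegular.1.1
  subst hlg_eq he hN
  have hτ2 : √(p : ℝ) ^ (τ - 2) = (p : ℝ) ^ (m + r) / p := by
    rw [show τ - 2 = 2 * ((m + r : ℕ) : ℤ) - 2 * ((1 : ℕ) : ℤ) by omega, sqrt_zpow_eq hpos,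
      pow_one]
  have hτ4 : √(p : ℝ) ^ (τ - 4) = (p : ℝ) ^ (m + r) / p ^ 2 := by
    rw [show τ - 4 = 2 * ((m + r : ℕ) : ℤ) - 2 * ((2 : ℕ) : ℤ) by omega, sqrt_zpow_eq hpos]
  have hγ2 : √(p : ℝ) ^ (γ - 2) = (p : ℝ) ^ (m - r) / p := by
    rw [show γ - 2 = 2 * ((m - r : ℕ) : ℤ) - 2 * ((1 : ℕ) : ℤ) by omega, sqrt_zpow_eq hpos,
      pow_one]
  have hγ' : γ = ((2 * (m - r) : ℕ) : ℤ) := by omega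
  have hγ0 : (p : ℝ) ^ γ = (p : ℝ) ^ (2 * (m - r)) := by
    rw [hγ', zpow_natCast]
  have hγ1 : (p : ℝ) ^ (γ - 1) = (p : ℝ) ^ (2 * (m - r)) / p := by
    rw [hγ', zpow_sub_one_eq hpos]
  refine ⟨?_, dualCount_eq_dualCountValue hp hF hf, dualCount_eq_dualCountValue hp hF hg,
    F₁_eq_sum hp hF hg, fun i j hi0 hi hj => ?_, fun hγe => ?_⟩
  · have h1 := congrArg (Nat.cast (R := ℝ)) (card_definingSet_add_one hf.map_zero hg.map_zero)
    have h2 := congrArg (Int.cast (R := ℝ)) (mul_card_zeros hp hF hr hf hg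
      (dual_zero hp hF hf hlf) (dual_zero hp hF hg hlg))
    push_cast at h1 h2
    apply mul_left_cancel₀ hp0
    rw [hτ2, eq_sub_of_add_eq h1, mul_sub, h2,
      show 2 * m = 2 * m - 1 + 1 by omega, pow_succ, Nat.add_sub_cancel]
    field_simp
    ring
  · have h2 : p = 2 * ((p - 1) / 2) + 1 := by omega
    have h3 : (p : ℝ) = 2 * (((p - 1) / 2 : ℕ) : ℝ) + 1 := by exact_mod_cast h2
    have h4 : (((p - 1) / 2 : ℕ) : ℝ) = (p - 1) / 2 := by linarith
    rw [F₃_eq hp hF hf hg hi0 hi hj, Nat.cast_mul, Nat.cast_pow, h4]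
    push_cast
    ring
  · have he : sign p m s f * sign p m t g = 1 ∨ r + 2 ≤ m := by
      by_cases hrm : r = m
      · rw [sign_eq_one_of_eq hp hF hf (by omega), sign_eq_one_of_eq hp hF hg (by omega)]
        exact Or.inl rfl
      by_cases hγ2' : γ = 2
      · left
        have hne : (sign p m s f * sign p m t g : ℤ) ≠ -1 := fun h =>
          hγe ⟨hγ2', by exact_mod_cast h⟩
        rcases (isSignDual_sign_dual hp hf).1 with h1 | h1 <;>
          rcases (isSignDual_sign_dual hp hg).1 with h2 | h2 <;> simp [h1, h2] at hne ⊢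
      · right
        omega
    have hm1 : 1 ≤ m := by omega
    refine ⟨finrank_code hF (encode_injective hp hF hr hf hg hlf hlg he), ?_, ?_, ?_, ?_⟩
    · rintro rfl
      have h := hasWeightTable_and_numWeights_half hp hm1 hF hr hf hg hlf hlg he
      refine ⟨?_, fun h1 h2 => h.2 (by omega) (by omega)⟩
      rw [tableHalf, hτ2, hτ4, hγ0, hγ1, hγ2]
      exact h.1
    · rintro rfl
      have h := hasWeightTable_and_numWeights_sub_one hp hm1 hF hr hf hg hlf hlg he
      refine ⟨?_, fun h1 => h.2 (by omega)⟩
      rw [tableFull, hτ2, hτ4, hγ0]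
      exact h.1
    · rintro rfl h8
      have h := hasWeightTable_and_numWeights_two_of_mod_eight_eq_one h8 hm1 hF hr hf hg hlf hlg he
      refine ⟨?_, fun h1 => h.2 (by omega)⟩
      rw [tableTwoOne, hτ2, hτ4, hγ0]
      exact h.1
    · rintro rfl h8
      have h := hasWeightTable_and_numWeights_two_of_mod_eight_eq_five h8 hm1 hF hr hf hg hlf hlg he
      refine ⟨?_, fun h5 h1 => h.2 h5 (by omega)⟩
      rw [tableTwoFive, hτ2, hτ4, hγ0]
      exact h.1
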